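/- **Conventions.** Let $0\le k\le n$. $\mathrm{Br}_m$ is the braid group on $m$ strands with Artin generators $\sigma_1,\dots,\sigma_{m-1}$ ($\sigma_i$ is the positive crossing of the strands in positions $i,i+1$ counted from the top), $\sigma_{[a,b]}=\sigma_b\sigma_{b-1}\cdots\sigma_a$ (trivial if $b<a$), and $\Delta_m=(\sigma_1)(\sigma_2\sigma_1)\cdots(\sigma_{m-1}\cdots\sigma_1)$. Permutations are composed as functions. A *positroid pair* is a pair $u,w\in S_n$ such that $w^{-1}(1)<\dots<w^{-1}(k)$, $w^{-1}(k+1)<\dots<w^{-1}(n)$, and $u\le w$ in the Bruhat order. *Richardson braid.* $R_n(u,w)=\beta(w)\beta(u)^{-1}\in\mathrm{Br}_n$, where $\beta(v)$ is the positive lift of any reduced word of $v$. *Juggling braid.* Let $f=u^{-1}t_kw:\mathbb Z\to\mathbb Z$, where $t_k=[1+n,\dots,k+n,k+1,\dots,n]$ and $u,w$ are extended $n$-periodically; thus, for $i\in[1,n]$, $f(i)=u^{-1}(w(i))+n$ if $w(i)\le k$, and $f(i)=u^{-1}(w(i))$ otherwise. For $i\in[1,n]$ draw the upper half-circle arc $A_i$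 from $(f(i),0)$ to $(i,0)$, declare all crossings positive and smooth the arcs at common endpoints; the resulting $k$-strand braid, read from right to left, is $J_k(u,w)$. Sweeping out the arcs by their right ends writes it as $J_k(u,w)=\sigma_{[a_n,b_n]}\cdots\sigma_{[a_1,b_1]}$, where the $r$-th interval belongs to the arc $A_i$ with the $r$-th smallest value $f(i)$, $a_r=1+\#\{x\in[1,n]: x<i,\ f(i)<f(x)\}$ and $b_r=a_r-1+\#\{x\in[1,n]: i<x<f(i)<f(x)\}$. Put $J^{(1)}(u,w)=\sigma_{[a_{n-k},b_{n-k}]}\cdots\sigma_{[a_1,b_1]}$ (the arcs with $f(i)\le n$) and $J^{(2)}(u,w)=\sigma_{[a_n,b_n]}\cdots\sigma_{[a_{n-k+1},b_{n-k+1}]}$, so that $J_k(u,w)=J^{(2)}(u,w)J^{(1)}(u,w)$. *Le diagram and Le braid.* Let $\lambda\subseteq(n-k)^k$ be the partition with $w^{-1}(k+1-i)=k+1-i+\lambda_i$ for $i\in[1,k]$, drawn in French notation (row $1$ at the bottom). A Le diagram in $\lambda$ is a set of dots in boxes of $\lambda$ such that, whenever there are dots in boxes $(r_1,c_1)$ and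 $(r_2,c_2)$ with $r_1\le r_2$, $c_2\le c_1$ and $(r_2,c_1)$ is a box of $\lambda$, there is a dot in $(r_2,c_1)$. It is the Le diagram of $(u,w)$ if $u$ is the product of the $s_{k+j-i}$ over the boxes $(i,j)$ without dot, read by columns from left to right and each column from the bottom up. The Le braid $D_k(u,w)\in\mathrm{Br}_k$ is the concatenation of the column tangles of this diagram, the right-most column being drawn first (at the left). In the tangle of a column, row $i$ corresponds to position $k+1-i$ from the top; the strands in positions without dot are horizontal; every dot strand except the lowest goes down to the position of the next dot, over the horizontal strands; and the lowest dot strand goes up to the position of the highest dot, over all other strands. **Theorem.** Let $u,w\in S_n$ be a positroid pair. Then a Le diagram of $(u,w)$ exists, the associated Le braid satisfies $$D_k(u,w)=J^{(1)}(u,w)\,\Delta_k^{-1}\,J^{(2)}(u,w)\quad\text{in }\mathrm{Br}_k,$$ and $J_k(u,w)\Delta_k^{-1}$ is conjugate to $D_k(u,w)$ in $\mathrm{Br}_k$. Moreover, each of $D_k(u,w)$ and $J_k(u,w)\Delta_k^{-1}$ is obtained from $R_n(u,w)$ by a finite sequence of braid moves, conjugations, positive destabilizations ($\mathrm{Br}_{m+1}\ni\beta\sigma_m\to\beta\in\mathrm{Br}_m$,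 $m\ge1$) and exactly $s$ deletions of an unlinked disjoint strand ($\mathrm{Br}_{m+1}\ni\beta\to\beta\in\mathrm{Br}_m$), where $s$ is the number of fixed points of $f$ in $[1,n]$; in particular, if $f$ has no fixed point, braid moves, conjugations and positive destabilizations suffice. -/

import Mathlib

open Equiv

/-! ### Braid groups -/

/-- The Artin relations on generators `σ_1, …, σ_{n-1}`; the generator `σ_i` is indexed by the
element `i - 1` of `Fin (n - 1)`. -/
def braidRelations (n : ℕ) : Set (FreeGroup (Fin (n - 1))) :=
  {r | ∃ i j : Fin (n - 1), (i : ℕ) + 1 < j ∧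
      r = FreeGroup.of i * FreeGroup.of j * (FreeGroup.of j * FreeGroup.of i)⁻¹} ∪
  {r | ∃ i j : Fin (n - 1), (i : ℕ) + 1 = j ∧
      r = FreeGroup.of i * FreeGroup.of j * FreeGroup.of i *
        (FreeGroup.of j * FreeGroup.of i * FreeGroup.of j)⁻¹}

/-- The braid group on `n` strands, in Artin's presentation. Equality in this group is equivalence
of braid words under the braid moves (Reidemeister II and III moves, far commutations). -/
abbrev BraidGroup (n : ℕ) : Type := PresentedGroup (braidRelations n)

/-- The Artin generator `σ_i`, `1 ≤ i ≤ n - 1` (and `1` for an index out of this range). It is the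
positive crossing of the strands in positions `i` and `i + 1`, counted from the top. -/
def sigma (n i : ℕ) : BraidGroup n :=
  if h : 1 ≤ i ∧ i < n then PresentedGroup.of (⟨i - 1, by omega⟩ : Fin (n - 1)) else 1

/-- The standard inclusion of `Br_n` into `Br_{n+1}`, `σ_i ↦ σ_i`, which adds a disjoint trivial
strand in position `n + 1`. -/
def addStrand (n : ℕ) : BraidGroup n →* BraidGroup (n + 1) :=
  PresentedGroup.toGroup
    (f := fun i : Fin (n - 1) =>
      (PresentedGroup.of (⟨i, by omega⟩ : Fin (n + 1 - 1)) : BraidGroup (n + 1))) <| by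
    rintro r (⟨i, j, hij, rfl⟩ | ⟨i, j, hij, rfl⟩)
    · simp only [map_mul, map_inv, FreeGroup.lift_apply_of]
      rw [mul_inv_eq_one]
      have h : PresentedGroup.mk (braidRelations (n + 1)) _ = 1 :=
        PresentedGroup.one_of_mem (rels := braidRelations (n + 1))
          (Or.inl ⟨⟨i, by omega⟩, ⟨j, by omega⟩, hij, rfl⟩)
      rw [map_mul, map_inv, mul_inv_eq_one] at h
      simp only [map_mul] at h
      exact h
    · simp only [map_mul, map_inv, FreeGroup.lift_apply_of]
      rw [mul_inv_eq_one]
      have h : PresentedGroup.mk (braidRelations (n + 1)) _ = 1 :=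
        PresentedGroup.one_of_mem (rels := braidRelations (n + 1))
          (Or.inr ⟨⟨i, by omega⟩, ⟨j, by omega⟩, hij, rfl⟩)
      rw [map_mul, map_inv, mul_inv_eq_one] at h
      simp only [map_mul] at h
      exact h

/-- The interval braid `σ_{[a,b]} = σ_b σ_{b-1} ⋯ σ_a` (trivial if `b < a`). -/
def intervalBraid (n a b : ℕ) : BraidGroup n :=
  ((List.range' a (b + 1 - a)).reverse.map (sigma n)).prod

/-- The half twist `Δ_n = (σ_1)(σ_2 σ_1) ⋯ (σ_{n-1} ⋯ σ_1)`. -/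
def halfTwist (n : ℕ) : BraidGroup n :=
  ((List.range' 1 (n - 1)).map (intervalBraid n 1)).prod

/-- `MarkovReduces α s β`: the braid `β` is obtained from the braid `α` by a finite sequence of
braid moves (equalities in the braid group), conjugations, positive destabilizations
`Br_{m+1} ∋ β σ_m ⟶ β ∈ Br_m` (with `m ≥ 1`), and exactly `s` deletions of an unlinked disjoint
strand `Br_{m+1} ∋ β ⟶ β ∈ Br_m`. -/
inductive MarkovReduces {n : ℕ} (α : BraidGroup n) : ℕ → {m : ℕ} → BraidGroup m → Prop
  | refl : MarkovReduces α 0 α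
  | conj {s m : ℕ} {β γ : BraidGroup m} :
      MarkovReduces α s β → IsConj β γ → MarkovReduces α s γ
  | destabilize {s m : ℕ} {β : BraidGroup m} : 1 ≤ m →
      MarkovReduces α s (addStrand m β * sigma (m + 1) m) → MarkovReduces α s β
  | deleteStrand {s m : ℕ} {β : BraidGroup m} :
      MarkovReduces α s (addStrand m β) → MarkovReduces α (s + 1) β

/-! ### Permutations, Bruhat order, positroid pairs

`S_n` is `Perm (Fin n)`, so the letters `1, …, n` are shifted to `0, …, n - 1`. Products are
compositions of functions. -/

/-- The simple transposition `s_i = (i, i+1)`, `1 ≤ i ≤ n - 1` (and `1` out of this range). -/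
def simpleTransposition (n i : ℕ) : Perm (Fin n) :=
  if h : 1 ≤ i ∧ i < n then swap ⟨i - 1, by omega⟩ ⟨i, h.2⟩ else 1

/-- The Coxeter length of a permutation: its number of inversions. -/
def permLength {n : ℕ} (v : Perm (Fin n)) : ℕ :=
  (Finset.univ.filter fun p : Fin n × Fin n => p.1 < p.2 ∧ v p.2 < v p.1).card

/-- `a` is (the list of indices of) a reduced word `s_{a_1} ⋯ s_{a_ℓ}` of `v`. -/
def IsReducedWord {n : ℕ} (v : Perm (Fin n)) (a : List ℕ) : Prop :=
  (∀ i ∈ a, 1 ≤ i ∧ i < n) ∧ (a.map (simpleTransposition n)).prod = v ∧ a.length = permLength v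

/-- Bruhat order: the reflexive transitive closure of `v ⟶ v t`, with `t` a transposition such that
`ℓ(v) < ℓ(v t)`. -/
def BruhatLE {n : ℕ} (u w : Perm (Fin n)) : Prop :=
  Relation.ReflTransGen
    (fun v v' => ∃ i j : Fin n, v' = v * swap i j ∧ permLength v < permLength v') u w

/-- `w⁻¹(1) < ⋯ < w⁻¹(k)` and `w⁻¹(k+1) < ⋯ < w⁻¹(n)`. -/
def IsGrassmannian {n : ℕ} (k : ℕ) (w : Perm (Fin n)) : Prop :=
  ∀ i j : Fin n, i < j → ((j : ℕ) < k ∨ k ≤ (i : ℕ)) → w⁻¹ i < w⁻¹ j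

def IsPositroidPair {n : ℕ} (k : ℕ) (u w : Perm (Fin n)) : Prop :=
  IsGrassmannian k w ∧ BruhatLE u w

/-! ### Richardson braid -/

/-- The Richardson braid `β(w) β(u)⁻¹`, where the positive lifts `β(w)`, `β(u)` are given by the
words `a` of `w` and `b` of `u`. -/
def richardsonBraid (n : ℕ) (a b : List ℕ) : BraidGroup n :=
  (a.map (sigma n)).prod * ((b.map (sigma n)).prod)⁻¹

/-! ### Juggling braid -/

/-- The window `[f(1), …, f(n)]` of the bounded affine permutation `f = u⁻¹ t_k w`, where `t_k` adds
`n` to the first `k` letters; letters and values are shifted down by one, so that the values lie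
in `{0, …, 2n - 1}`. -/
def boundedAffine {n : ℕ} (k : ℕ) (u w : Perm (Fin n)) (i : Fin n) : ℕ :=
  (u⁻¹ (w i) : ℕ) + if (w i : ℕ) < k then n else 0

/-- The number of fixed points of `f` in the window. -/
def fixedCount {n : ℕ} (f : Fin n → ℕ) : ℕ :=
  (Finset.univ.filter fun i : Fin n => f i = (i : ℕ)).card

/-- The juggling diagram has an upper arc `A_i` from `(f(i), 0)` to `(i, 0)` for every `i`; the arcs `A_i`
and `A_x`, `i < x`, cross if and only if `x < f(i) < f(x)`, and then exactly once. Arcs are drawn so that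
these crossings lie next to the right end of `A_i`, where `A_i` descends steeply (another choice of the
arcs changes the braid word by Reidemeister III moves only).

`arcPosition f i` is the position of `A_i`, counted from the top, to the left of these crossings: it is
one plus the number of arcs that enclose `A_i`. -/
def arcPosition {n : ℕ} (f : Fin n → ℕ) (i : Fin n) : ℕ :=
  1 + (Finset.univ.filter fun x : Fin n => x < i ∧ f i < f x).card

/-- The number of arcs that `A_i` crosses next to its right end: the arcs `A_x` with
`i < x < f(i) < f(x)`. -/
def arcCrossings {n : ℕ} (f : Fin n → ℕ) (i : Fin n) : ℕ :=
  (Finset.univ.filter fun x : Fin n => i < x ∧ (x : ℕ) < f i ∧ f i < f x).card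

/-- The interval braid of the arc `A_i`: next to its right end, `A_i` moves from position `p` down to
position `p + c` through the `c` arcs that it crosses there, and all crossings are positive. Read from
right to left, this is `σ_{p+c-1} ⋯ σ_p`. -/
def arcBraid {n : ℕ} (k : ℕ) (f : Fin n → ℕ) (i : Fin n) : BraidGroup k :=
  intervalBraid k (arcPosition f i) (arcPosition f i + arcCrossings f i - 1)

/-- The part of the juggling braid given by the arcs with right ends in the list `ms`, in the order of
the list. -/
def jugglingPart {n : ℕ} (k : ℕ) (f : Fin n → ℕ) (ms : List ℕ) : BraidGroup k :=
  (ms.map fun m => (((List.finRange n).filter fun i => f i = m).map (arcBraid k f)).prod).prod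

/-- The juggling braid `J_k(f) = σ_{[a_n,b_n]} ⋯ σ_{[a_1,b_1]}`: the juggling diagram is read from
right to left, one interval braid for every arc, ordered by right ends. Arcs `i = f(i)` are points
and contribute trivially. -/
def jugglingBraid {n : ℕ} (k : ℕ) (f : Fin n → ℕ) : BraidGroup k :=
  jugglingPart k f (List.range (2 * n)).reverse

/-- `J⁽¹⁾_k = σ_{[a_{n-k},b_{n-k}]} ⋯ σ_{[a_1,b_1]}`: the arcs with `f(i) ≤ n`. -/
def jugglingBraid₁ {n : ℕ} (k : ℕ) (f : Fin n → ℕ) : BraidGroup k :=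
  jugglingPart k f (List.range n).reverse

/-- `J⁽²⁾_k = σ_{[a_n,b_n]} ⋯ σ_{[a_{n-k+1},b_{n-k+1}]}`: the arcs with `f(i) > n`. -/
def jugglingBraid₂ {n : ℕ} (k : ℕ) (f : Fin n → ℕ) : BraidGroup k :=
  jugglingPart k f (List.range' n n).reverse

/-! ### Le diagrams and the Le braid

Young diagrams are drawn in French notation. Rows are numbered `0, …, k - 1` from the bottom (longest)
row up, columns `0, …, n - k - 1` from left to right; a box is a pair (row, column). -/

/-- The length of row `i` of the partition `λ ⊆ (n-k)^k` of the `k`-Grassmannian permutation `w`,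
given by `w⁻¹ = [1 + λ_k, 2 + λ_{k-1}, …, k + λ_1, …]`. -/
def rowLength {n : ℕ} (k : ℕ) (w : Perm (Fin n)) (i : ℕ) : ℕ :=
  if h : i < k ∧ k ≤ n then (w⁻¹ ⟨k - 1 - i, by omega⟩ : ℕ) - (k - 1 - i) else 0

/-- The set of dots `L` is a Le diagram in `λ`: if a box of `λ` lies above (or at) a dot and to the
right of (or at) a dot, then it has a dot. -/
def IsLeDiagram {n : ℕ} (k : ℕ) (w : Perm (Fin n)) (L : Finset (ℕ × ℕ)) : Prop :=
  (∀ c ∈ L, c.2 < rowLength k w c.1) ∧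
  ∀ r₁ r₂ c₁ c₂ : ℕ, (r₁, c₁) ∈ L → (r₂, c₂) ∈ L → r₁ ≤ r₂ → c₂ ≤ c₁ →
    c₁ < rowLength k w r₂ → (r₂, c₁) ∈ L

/-- The letters in the boxes of `λ` without dot, read by columns from left to right, each column from
the bottom up. The box in row `i` and column `j` is filled with the letter `k + j - i`. -/
def emptyBoxWord {n : ℕ} (k : ℕ) (w : Perm (Fin n)) (L : Finset (ℕ × ℕ)) : List ℕ :=
  (List.range (n - k)).flatMap fun j =>
    ((List.range k).filter fun i => j < rowLength k w i ∧ (i, j) ∉ L).map fun i => k + j - i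

/-- `L` is the Le diagram of the positroid pair `(u, w)`: it is a Le diagram in the Young diagram of
`w`, and the boxes without dot spell `u`. -/
def IsLeDiagramOf {n : ℕ} (k : ℕ) (u w : Perm (Fin n)) (L : Finset (ℕ × ℕ)) : Prop :=
  IsLeDiagram k w L ∧ ((emptyBoxWord k w L).map (simpleTransposition n)).prod = u

/-- The positions, counted from the top, of the strands at the heights of the dots in column `j`: row
`i` has height `i + 1` from the bottom and hence position `k - i` from the top. -/
def dotPositions (k : ℕ) (L : Finset (ℕ × ℕ)) (j : ℕ) : Finset ℕ :=
  (Finset.Icc 1 k).filter fun p => (k - p, j) ∈ L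

/-- The column tangle, for a column whose dots have the positions `P` from the top. Every dot strand
but the lowest moves down to the next dot, passing over the horizontal strands in between: this gives
a negative crossing `σ_q⁻¹` for every strand `q + 1 ∉ P` between the top and the bottom dot. The lowest
dot strand moves up to the top dot over everything else: this gives `σ_{max P - 1} ⋯ σ_{min P}`.
As the latter strand is above all others, its crossings may be drawn last. -/
def columnTangle (k : ℕ) (P : Finset ℕ) : BraidGroup k :=
  if h : P.Nonempty then
    (((List.range' (P.min' h) (P.max' h - 1 - P.min' h)).filter fun q => q + 1 ∉ P).map
      fun q => (sigma k q)⁻¹).prod * intervalBraid k (P.min' h) (P.max' h - 1)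
  else 1

/-- The Le braid: the concatenation of the column tangles, from the right-most column (drawn at the
left) to the left-most one. -/
def leBraid (k n : ℕ) (L : Finset (ℕ × ℕ)) : BraidGroup k :=
  ((List.range (n - k)).reverse.map fun j => columnTangle k (dotPositions k L j)).prod

/-! Read the boundary of the Young diagram of `w` as a path of `n` steps and put the dots of a
column on the step that creates it. The permutations `u` and `w` and the function `f` can be read
off this dotted path, and everything about them is proved by removing its first step, that is, an
empty top row or a full first column. The Le condition says exactly that the word of the boxes
without dot is reduced, column by column.

For the identity `D = J⁽¹⁾ Δ⁻¹ J⁽²⁾`: the arcs of `J⁽²⁾` spell the positive braid of the ascents of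
the list `u⁻¹(1), …, u⁻¹(k)`, which for the path without steps of columns is `Δ`. Adding a first
column carries a letter through this list; this multiplies the braid of the ascents by the column
tangle and splits off the interval of the one arc that is new in `J⁽¹⁾`. The conjugacy is then a
cyclic rotation.

For the Richardson braid, a column is removed together with its strand: the crossings of the column
in `β(w)` and in `β(u)⁻¹` combine to the column tangle with one more dot on a new top strand.
Up to conjugation this strand has a single crossing with the rest, so that it can be destabilized,
unless the column has no dots. In that case the strand is unlinked, and the column belongs to a
fixed point of `f`. -/

/-! ### Words in a sequence satisfying the braid relations -/

section BraidWords

variable {Γ : Type*} [Monoid Γ] {s : ℕ → Γ} {N : ℕ}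

/-- The elements `s 1, …, s (N - 1)` satisfy the relations of the braid group on `N` strands.
Working with such sequences and not only with the Artin generators makes it possible to pass to
`fun i => s (i + 1)`, that is, to forget the top strand. -/
structure IsBraidSequence (N : ℕ) (s : ℕ → Γ) : Prop where
  commute : ∀ i j, 1 ≤ i → i + 1 < j → j < N → Commute (s i) (s j)
  braid : ∀ i, 1 ≤ i → i + 1 < N → s i * s (i + 1) * s i = s (i + 1) * s i * s (i + 1)

/-- The value of a positive braid word in the sequence `s`. -/
def wordEval (s : ℕ → Γ) (l : List ℕ) : Γ := (l.map s).prod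

/-- All letters of the word lie in `{1, …, N - 1}`: it is a positive braid word on `N` strands. -/
def IsBraidWord (N : ℕ) (l : List ℕ) : Prop := ∀ x ∈ l, 1 ≤ x ∧ x < N

/-- The word `a + l - 1, …, a + 1, a` of an interval braid, given by its last letter and its length,
so that no subtraction is needed. -/
def descWord (a l : ℕ) : List ℕ := (List.range' a l).reverse

/-- The word of the half twist. -/
def halfTwistWord : ℕ → List ℕ
  | 0 => []
  | k + 1 => halfTwistWord k ++ descWord 1 k

@[simp] lemma wordEval_nil : wordEval s [] = 1 := rfl

@[simp] lemma wordEval_cons (x : ℕ) (l : List ℕ) : wordEval s (x :: l) = s x * wordEval s l :=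
  List.prod_cons

@[simp] lemma wordEval_append (l l' : List ℕ) :
    wordEval s (l ++ l') = wordEval s l * wordEval s l' := by
  simp [wordEval]

lemma wordEval_map_succ (l : List ℕ) :
    wordEval s (l.map (· + 1)) = wordEval (fun i => s (i + 1)) l := by
  simp [wordEval, Function.comp_def]

lemma map_wordEval {Γ' : Type*} [Monoid Γ'] {φ : Γ →* Γ'} {s' : ℕ → Γ'} {l : List ℕ}
    (h : ∀ i ∈ l, φ (s i) = s' i) : φ (wordEval s l) = wordEval s' l := by
  rw [wordEval, map_list_prod, List.map_map, wordEval]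
  exact congrArg List.prod (List.map_congr_left h)

@[simp] lemma descWord_zero (a : ℕ) : descWord a 0 = [] := rfl

lemma descWord_succ (a l : ℕ) : descWord a (l + 1) = (a + l) :: descWord a l := by
  simp [descWord, List.range'_concat]

lemma descWord_succ' (a l : ℕ) : descWord a (l + 1) = descWord (a + 1) l ++ [a] := by
  simp [descWord, List.range'_succ]

lemma descWord_add (a l m : ℕ) : descWord a (l + m) = descWord (a + l) m ++ descWord a l := by
  rw [descWord, descWord, descWord, ← List.reverse_append, List.range'_append_1]

lemma mem_descWord {a l x : ℕ} : x ∈ descWord a l ↔ a ≤ x ∧ x < a + l := by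
  simp [descWord]

lemma descWord_map_succ (a l : ℕ) : (descWord a l).map (· + 1) = descWord (a + 1) l := by
  simp [descWord, List.map_reverse, List.range'_succ_left]

lemma wordEval_range'_succ (a l : ℕ) :
    wordEval s (List.range' a (l + 1)) = wordEval s (List.range' a l) * s (a + l) := by
  simp [List.range'_concat]

lemma IsBraidWord.mono {M : ℕ} {l : List ℕ} (h : IsBraidWord M l) (hM : M ≤ N) :
    IsBraidWord N l :=
  fun x hx => ⟨(h x hx).1, (h x hx).2.trans_le hM⟩

lemma IsBraidWord.append {l l' : List ℕ} (h : IsBraidWord N l) (h' : IsBraidWord N l') :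
    IsBraidWord N (l ++ l') :=
  fun x hx => (List.mem_append.1 hx).elim (h x) (h' x)

lemma IsBraidWord.map_add {l : List ℕ} (h : IsBraidWord N l) (p : ℕ) :
    IsBraidWord (N + p) (l.map (· + p)) := by
  simp only [IsBraidWord, List.forall_mem_map]
  intro x hx
  have := h x hx
  omega

lemma isBraidWord_descWord {a l : ℕ} (ha : 1 ≤ a) (h : a + l ≤ N) :
    IsBraidWord N (descWord a l) := by
  intro x hx
  rw [mem_descWord] at hx
  constructor <;> omega

lemma isBraidWord_halfTwistWord (k : ℕ) : IsBraidWord k (halfTwistWord k) := by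
  induction k with
  | zero => simp [halfTwistWord, IsBraidWord]
  | succ k ih => exact (ih.mono k.le_succ).append (isBraidWord_descWord le_rfl (by omega))

namespace IsBraidSequence

lemma mono {M : ℕ} (h : IsBraidSequence N s) (hM : M ≤ N) : IsBraidSequence M s :=
  ⟨fun i j hi hij hj => h.commute i j hi hij (hj.trans_le hM),
    fun i hi hiM => h.braid i hi (hiM.trans_le hM)⟩

lemma shift (h : IsBraidSequence (N + 1) s) : IsBraidSequence N fun i => s (i + 1) :=
  ⟨fun i j _ _ _ => h.commute _ _ (by omega) (by omega) (by omega),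
    fun i _ _ => h.braid _ (by omega) (by omega)⟩

lemma op (h : IsBraidSequence N s) : IsBraidSequence N fun i => MulOpposite.op (s i) :=
  ⟨fun i j hi hij hj => (h.commute i j hi hij hj).op, fun i hi hiN => by
    simpa only [← MulOpposite.op_mul, ← mul_assoc] using congrArg MulOpposite.op (h.braid i hi hiN)⟩

lemma commute_wordEval (h : IsBraidSequence N s) {i : ℕ} (hi : 1 ≤ i) (hiN : i < N) {l : List ℕ}
    (hl : IsBraidWord N l) (hd : ∀ x ∈ l, x + 1 < i ∨ i + 1 < x) :
    Commute (s i) (wordEval s l) := by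
  refine Commute.list_prod_right _ _ fun y hy => ?_
  obtain ⟨x, hx, rfl⟩ := List.mem_map.1 hy
  rcases hd x hx with hxi | hix
  · exact (h.commute x i (hl x hx).1 hxi hiN).symm
  · exact h.commute i x hi hix (hl x hx).2

lemma commute_wordEval_wordEval (h : IsBraidSequence N s) {l l' : List ℕ} (hl : IsBraidWord N l)
    (hl' : IsBraidWord N l') (hd : ∀ x ∈ l, ∀ y ∈ l', y + 1 < x ∨ x + 1 < y) :
    Commute (wordEval s l) (wordEval s l') := by
  refine Commute.list_prod_left _ _ fun y hy => ?_
  obtain ⟨x, hx, rfl⟩ := List.mem_map.1 hy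
  exact h.commute_wordEval (hl x hx).1 (hl x hx).2 hl' (hd x hx)

lemma mul_descWord (h : IsBraidSequence N s) {a l i : ℕ} (ha : 1 ≤ a) (hai : a ≤ i)
    (hil : i + 1 < a + l) (hN : a + l ≤ N) :
    s i * wordEval s (descWord a l) = wordEval s (descWord a l) * s (i + 1) := by
  obtain ⟨p, rfl⟩ := Nat.exists_eq_add_of_le hai
  obtain ⟨r, rfl⟩ : ∃ r, l = p + (1 + (1 + r)) := ⟨l - p - 2, by omega⟩
  set U := wordEval s (descWord (a + p + 2) r) with hU
  set V := wordEval s (descWord a p) with hV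
  have hsplit : wordEval s (descWord a (p + (1 + (1 + r)))) =
      U * (s (a + p + 1) * (s (a + p) * V)) := by
    rw [descWord_add, descWord_add, descWord_add]
    simp [hU, hV, descWord, Nat.add_assoc]
  have commU : s (a + p) * U = U * s (a + p) :=
    h.commute_wordEval (by omega) (by omega) (isBraidWord_descWord (by omega) (by omega))
      fun x hx => by rw [mem_descWord] at hx; omega
  have commV : s (a + p + 1) * V = V * s (a + p + 1) :=
    h.commute_wordEval (by omega) (by omega) (isBraidWord_descWord (by omega) (by omega))
      fun x hx => by rw [mem_descWord] at hx; omega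
  have hbraid := h.braid (a + p) (by omega) (by omega)
  calc s (a + p) * wordEval s (descWord a (p + (1 + (1 + r))))
      = U * (s (a + p) * s (a + p + 1) * s (a + p)) * V := by
        rw [hsplit, ← mul_assoc, commU]; simp only [mul_assoc]
    _ = U * (s (a + p + 1) * (s (a + p) * (s (a + p + 1) * V))) := by
        rw [hbraid]; simp only [mul_assoc]
    _ = wordEval s (descWord a (p + (1 + (1 + r)))) * s (a + p + 1) := by
        rw [commV, hsplit]; simp only [mul_assoc]

lemma wordEval_mul_descWord (h : IsBraidSequence N s) {a l : ℕ} (ha : 1 ≤ a) (hN : a + l ≤ N)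
    {w : List ℕ} (hw : ∀ x ∈ w, a ≤ x ∧ x + 1 < a + l) :
    wordEval s w * wordEval s (descWord a l) =
      wordEval s (descWord a l) * wordEval s (w.map (· + 1)) := by
  induction w with
  | nil => simp
  | cons x w ih =>
    obtain ⟨hx, hw⟩ := List.forall_mem_cons.1 hw
    rw [wordEval_cons, mul_assoc, ih hw, ← mul_assoc, h.mul_descWord ha hx.1 hx.2 hN, mul_assoc,
      List.map_cons, wordEval_cons]

lemma range'_mul_wordEval (h : IsBraidSequence N s) {a l : ℕ} (ha : 1 ≤ a) (hN : a + l ≤ N)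
    {w : List ℕ} (hw : ∀ x ∈ w, a ≤ x ∧ x + 1 < a + l) :
    wordEval s (List.range' a l) * wordEval s w =
      wordEval s (w.map (· + 1)) * wordEval s (List.range' a l) := by
  have wordEval_op (v : List ℕ) :
      wordEval (fun i => MulOpposite.op (s i)) v = MulOpposite.op (wordEval s v.reverse) := by
    simp [wordEval, MulOpposite.op_list_prod, List.map_reverse, Function.comp_def]
  have := h.op.wordEval_mul_descWord ha hN (w := w.reverse) fun x hx => hw x (List.mem_reverse.1 hx)
  simp only [wordEval_op, ← MulOpposite.op_mul, ← List.map_reverse, List.reverse_reverse,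
    descWord] at this
  exact MulOpposite.op_injective this

lemma halfTwist_succ {k : ℕ} (h : IsBraidSequence (k + 1) s) :
    wordEval s (halfTwistWord (k + 1)) =
      wordEval s (descWord 1 k) * wordEval s ((halfTwistWord k).map (· + 1)) := by
  rw [halfTwistWord, wordEval_append]
  refine h.wordEval_mul_descWord le_rfl (by omega) fun x hx => ?_
  have := isBraidWord_halfTwistWord k x hx
  omega

lemma halfTwist_mul_one {k : ℕ} (h : IsBraidSequence (k + 2) s) :
    wordEval s (halfTwistWord (k + 2)) * s 1 = s (k + 1) * wordEval s (halfTwistWord (k + 2)) := by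
  set Δ := wordEval s (halfTwistWord k)
  set D := wordEval s (descWord 1 k)
  set E := wordEval s (descWord 1 (k + 1)) with hE
  have hΔ : wordEval s (halfTwistWord (k + 2)) = Δ * D * E := by
    simp only [halfTwistWord, wordEval_append, Δ, D, E]
  have hcomm : s (k + 1) * Δ = Δ * s (k + 1) :=
    h.commute_wordEval (by omega) (by omega) ((isBraidWord_halfTwistWord k).mono (by omega))
      fun x hx => by have := isBraidWord_halfTwistWord k x hx; omega
  have hslide : D * E = E * wordEval s (descWord 2 k) := by
    have := h.wordEval_mul_descWord (a := 1) (l := k + 1) le_rfl (by omega) (w := descWord 1 k)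
      fun x hx => by rw [mem_descWord] at hx; omega
    rwa [descWord_map_succ] at this
  have hE₁ : E = s (k + 1) * D := by rw [hE, descWord_succ, wordEval_cons, Nat.add_comm 1 k]
  have hE₂ : E = wordEval s (descWord 2 k) * s 1 := by simp [hE, descWord_succ']
  calc wordEval s (halfTwistWord (k + 2)) * s 1
      = Δ * E * (wordEval s (descWord 2 k) * s 1) := by
        rw [hΔ, mul_assoc Δ, hslide]; simp only [mul_assoc]
    _ = Δ * (s (k + 1) * D) * E := by rw [← hE₂, ← hE₁]
    _ = s (k + 1) * wordEval s (halfTwistWord (k + 2)) := by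
        rw [hΔ, ← mul_assoc, ← hcomm]; simp only [mul_assoc]

lemma halfTwist_mul {k : ℕ} (h : IsBraidSequence k s) {i : ℕ} (hi : 1 ≤ i) (hik : i < k) :
    wordEval s (halfTwistWord k) * s i = s (k - i) * wordEval s (halfTwistWord k) := by
  induction k generalizing i with
  | zero => omega
  | succ k ih =>
    obtain rfl | hi1 := hi.eq_or_lt
    · obtain ⟨k, rfl⟩ := Nat.exists_eq_succ_of_ne_zero (by omega : k ≠ 0)
      exact h.halfTwist_mul_one
    · obtain ⟨j, rfl⟩ := Nat.exists_eq_add_of_le' hi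
      have hslide := h.mul_descWord (a := 1) (l := k) (i := j) le_rfl (by omega) (by omega)
        (by omega)
      have hflip := ih (h.mono k.le_succ) (i := j) (by omega) (by omega)
      rw [halfTwistWord, wordEval_append, mul_assoc, ← hslide, ← mul_assoc, hflip, mul_assoc,
        Nat.add_sub_add_right]

lemma halfTwist_mul_descWord {k : ℕ} (h : IsBraidSequence k s) {c : ℕ} (hc : c ≤ k - 1) :
    wordEval s (halfTwistWord k) * wordEval s (descWord 1 c) =
      wordEval s (List.range' (k - c) c) * wordEval s (halfTwistWord k) := by
  induction c with
  | zero => simp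
  | succ c ih =>
    rw [descWord_succ, wordEval_cons, ← mul_assoc, h.halfTwist_mul (by omega) (by omega), mul_assoc,
      ih (by omega), List.range'_succ, wordEval_cons, mul_assoc,
      show k - (1 + c) = k - (c + 1) by omega, show k - (c + 1) + 1 = k - c by omega]

end IsBraidSequence

end BraidWords

/-! ### The braid of the ascents of a list -/

section AscentWord

variable {Γ : Type*} [Monoid Γ] {s : ℕ → Γ} {N : ℕ}

/-- Removal of the letter `0`, all other letters being decreased by one. -/
def dropZero (l : List ℕ) : List ℕ := l.filterMap Nat.ppred

/-- The positive word whose crossings are the pairs of positions at which the list `l` increases,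
for a list of distinct entries less than `M`: the entries are moved to the end of the list one by
one, the largest one first. -/
def ascentWord : ℕ → List ℕ → List ℕ
  | 0, _ => []
  | M + 1, l => ascentWord M (dropZero l) ++ descWord (l.idxOf 0 + 1) (l.length - 1 - l.idxOf 0)

@[simp] lemma dropZero_nil : dropZero [] = [] := rfl

@[simp] lemma dropZero_zero_cons (l : List ℕ) : dropZero (0 :: l) = dropZero l := rfl

@[simp] lemma dropZero_succ_cons (x : ℕ) (l : List ℕ) :
    dropZero ((x + 1) :: l) = x :: dropZero l := rfl

@[simp] lemma dropZero_append (l l' : List ℕ) : dropZero (l ++ l') = dropZero l ++ dropZero l' :=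
  List.filterMap_append

@[simp] lemma dropZero_map_succ (l : List ℕ) : dropZero (l.map (· + 1)) = l := by
  simp [dropZero, List.filterMap_map, Function.comp_def, Nat.ppred]

lemma length_dropZero_le (l : List ℕ) : (dropZero l).length ≤ l.length :=
  List.length_filterMap_le _ _

lemma nodup_dropZero {l : List ℕ} (h : l.Nodup) : (dropZero l).Nodup :=
  h.filterMap fun _ _ _ ha hb => (Nat.ppred_eq_some.1 ha).symm.trans (Nat.ppred_eq_some.1 hb)

lemma map_succ_dropZero {l : List ℕ} (h : 0 ∉ l) : (dropZero l).map (· + 1) = l := by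
  induction l with
  | nil => rfl
  | cons x l ih =>
    obtain ⟨x, rfl⟩ := Nat.exists_eq_succ_of_ne_zero (List.ne_of_not_mem_cons h).symm
    simp [ih (List.not_mem_of_not_mem_cons h)]

lemma length_dropZero_of_notMem {l : List ℕ} (h : 0 ∉ l) : (dropZero l).length = l.length := by
  conv_rhs => rw [← map_succ_dropZero h, List.length_map]

lemma countP_map_succ (l : List ℕ) (M : ℕ) :
    (l.map (· + 1)).countP (· < M + 1) = l.countP (· < M) := by
  simp [List.countP_map, Function.comp_def]

lemma countP_dropZero_of_notMem {l : List ℕ} (h : 0 ∉ l) (M : ℕ) :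
    (dropZero l).countP (· < M) = l.countP (· < M + 1) := by
  conv_rhs => rw [← map_succ_dropZero h, countP_map_succ]

lemma countP_append_zero_cons {A B : List ℕ} (hA : 0 ∉ A) (hB : 0 ∉ B) (M : ℕ) :
    (A ++ 0 :: B).countP (· < M + 1) = (dropZero A ++ dropZero B).countP (· < M) + 1 := by
  rw [List.countP_append, List.countP_cons_of_pos (by simp), ← countP_dropZero_of_notMem hA,
    ← countP_dropZero_of_notMem hB, List.countP_append, Nat.add_assoc]

lemma isBraidWord_ascentWord (M : ℕ) (l : List ℕ) : IsBraidWord l.length (ascentWord M l) := by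
  induction M generalizing l with
  | zero => simp [ascentWord, IsBraidWord]
  | succ M ih =>
    refine ((ih _).mono (length_dropZero_le l)).append fun x hx => ?_
    rw [mem_descWord] at hx
    omega

lemma ascentWord_of_notMem {M : ℕ} {l : List ℕ} (h : 0 ∉ l) :
    ascentWord (M + 1) l = ascentWord M (dropZero l) := by
  rw [ascentWord, List.idxOf_eq_length h, show l.length - 1 - l.length = 0 by omega, descWord_zero,
    List.append_nil]

lemma ascentWord_append_zero_cons (M : ℕ) {A B : List ℕ} (h : 0 ∉ A) :
    ascentWord (M + 1) (A ++ 0 :: B) =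
      ascentWord M (dropZero A ++ dropZero B) ++ descWord (A.length + 1) B.length := by
  rw [ascentWord, List.idxOf_append_of_notMem h]
  simp

lemma ascentWord_map_succ (M : ℕ) (l : List ℕ) :
    ascentWord (M + 1) (l.map (· + 1)) = ascentWord M l := by
  rw [ascentWord_of_notMem (by simp), dropZero_map_succ]

lemma ascentWord_range (k : ℕ) : ascentWord k (List.range k) = halfTwistWord k := by
  induction k with
  | zero => rfl
  | succ k ih =>
    have := ascentWord_append_zero_cons k (A := []) (B := (List.range k).map (· + 1)) (by simp)
    rw [List.range_succ_eq_map, halfTwistWord, ← ih]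
    simpa using this

lemma notMem_of_nodup_append_cons {α : Type*} {x : α} {A B : List α}
    (h : (A ++ x :: B).Nodup) : x ∉ A ∧ x ∉ B := by
  simpa using (List.nodup_middle.1 h).notMem

namespace IsBraidSequence

-- The last entry `y` forms an ascent with the entries below it; its strand can be moved first.
lemma ascentWord_concat (h : IsBraidSequence N s) {M : ℕ} {V : List ℕ} {y : ℕ} (hM : y < M)
    (hnd : (V ++ [y]).Nodup) (hN : V.length + 1 ≤ N) :
    wordEval s (ascentWord M (V ++ [y])) =
      wordEval s (List.range' (V.length + 1 - V.countP (· < y)) (V.countP (· < y))) *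
        wordEval s (ascentWord M V) := by
  induction M generalizing V y with
  | zero => omega
  | succ M ih =>
    have hyV := (notMem_of_nodup_append_cons hnd).1
    have hnd' := nodup_dropZero hnd
    rcases y with _ | y
    · rw [ascentWord_append_zero_cons _ hyV, ascentWord_of_notMem hyV]
      simp
    by_cases hV : 0 ∈ V
    · obtain ⟨A, B, rfl⟩ := List.append_of_mem hV
      obtain ⟨hA, hB⟩ := notMem_of_nodup_append_cons hnd.of_append_left
      simp only [dropZero_append, dropZero_zero_cons, dropZero_succ_cons, dropZero_nil] at hnd'
      simp only [List.length_append, List.length_cons] at hN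
      have hlen : (dropZero A ++ dropZero B).length = A.length + B.length := by
        rw [List.length_append, length_dropZero_of_notMem hA, length_dropZero_of_notMem hB]
      obtain ⟨c, hc⟩ : ∃ c, (dropZero A ++ dropZero B).countP (· < y) = c := ⟨_, rfl⟩
      have hcl : c ≤ A.length + B.length := hc ▸ hlen ▸ List.countP_le_length
      have hcomm := h.commute_wordEval (i := A.length + B.length + 1) (by omega) (by omega)
        ((isBraidWord_ascentWord M (dropZero A ++ dropZero B)).mono (by omega)) fun x hx => by
          have := isBraidWord_ascentWord _ _ x hx
          omega
      have hih := ih (by omega) hnd' (by omega)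
      rw [hlen, hc] at hih
      rw [List.append_assoc, List.cons_append, ascentWord_append_zero_cons _ hA,
        ascentWord_append_zero_cons _ hA, countP_append_zero_cons hA hB, hc, dropZero_append,
        dropZero_succ_cons, dropZero_nil, ← List.append_assoc, wordEval_append, wordEval_append,
        hih]
      simp only [List.length_append, List.length_cons, List.length_nil, Nat.zero_add,
        descWord_succ, wordEval_cons, ← Nat.add_assoc, Nat.add_sub_add_right, wordEval_range'_succ,
        Nat.sub_add_cancel (by omega : c ≤ A.length + B.length + 1), Nat.add_right_comm _ 1]
      rw [mul_assoc, ← mul_assoc _ (s _), ← hcomm.eq]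
      simp only [mul_assoc]
    · rw [ascentWord_of_notMem hV, ascentWord_of_notMem (by simp [hV])]
      simp only [dropZero_append, dropZero_succ_cons, dropZero_nil] at hnd' ⊢
      rw [ih (by omega) hnd' (by rwa [length_dropZero_of_notMem hV]), countP_dropZero_of_notMem hV,
        length_dropZero_of_notMem hV]

lemma ascentWord_swap_last (h : IsBraidSequence N s) {M : ℕ} {A : List ℕ} {x y : ℕ}
    (hxy : x < y) (hy : y < M) (hnd : (A ++ [x] ++ [y]).Nodup) (hN : A.length + 2 ≤ N) :
    wordEval s (ascentWord M (A ++ [x] ++ [y])) =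
      wordEval s (ascentWord M (A ++ [y] ++ [x])) * s (A.length + 1) := by
  have hnd' : (A ++ [y] ++ [x]).Nodup := by
    rw [List.append_assoc] at hnd ⊢
    exact ((List.Perm.swap y x []).append_left A).nodup hnd
  obtain ⟨cx, hcx⟩ : ∃ c, A.countP (· < x) = c := ⟨_, rfl⟩
  obtain ⟨cy, hcy⟩ : ∃ c, A.countP (· < y) = c := ⟨_, rfl⟩
  have hcx' : (A ++ [y]).countP (· < x) = cx := by simp [hcx, hxy.le]
  have hcy' : (A ++ [x]).countP (· < y) = cy + 1 := by simp [hcy, hxy]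
  have hle : cx ≤ cy := hcx ▸ hcy ▸ List.countP_mono_left fun z _ hz =>
    decide_eq_true ((of_decide_eq_true hz).trans hxy)
  have hcyA : cy ≤ A.length := hcy ▸ List.countP_le_length
  have hslide := h.range'_mul_wordEval (a := A.length + 1 - cy) (l := cy + 1) (by omega)
    (by omega) (w := List.range' (A.length + 1 - cx) cx) fun z hz => by
      rw [List.mem_range'_1] at hz
      omega
  have hcomm := h.commute_wordEval (i := A.length + 1) (by omega) (by omega)
    ((isBraidWord_ascentWord M A).mono (by omega)) fun z hz => by
      have := isBraidWord_ascentWord _ _ z hz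
      omega
  rw [← List.range'_succ_left] at hslide
  rw [h.ascentWord_concat hy hnd (by rw [List.length_append, List.length_singleton]; omega),
    h.ascentWord_concat (hxy.trans hy) hnd.of_append_left (by omega),
    h.ascentWord_concat (hxy.trans hy) hnd'
      (by rw [List.length_append, List.length_singleton]; omega),
    h.ascentWord_concat hy hnd'.of_append_left (by omega), hcx, hcy, hcx', hcy']
  simp only [List.length_append, List.length_singleton, Nat.add_sub_add_right]
  rw [← mul_assoc, hslide, wordEval_range'_succ, Nat.sub_add_cancel (by omega), mul_assoc,
    mul_assoc, hcomm.eq, Nat.sub_add_comm (by omega : cx ≤ A.length + 1)]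
  simp only [mul_assoc]

lemma ascentWord_swap (h : IsBraidSequence N s) {M : ℕ} {A B : List ℕ} {x y : ℕ} (hxy : x < y)
    (hM : ∀ z ∈ A ++ x :: y :: B, z < M) (hnd : (A ++ x :: y :: B).Nodup)
    (hN : (A ++ x :: y :: B).length ≤ N) :
    wordEval s (ascentWord M (A ++ x :: y :: B)) =
      wordEval s (ascentWord M (A ++ y :: x :: B)) * s (A.length + 1) := by
  induction B using List.reverseRecOn with
  | nil =>
    simpa using h.ascentWord_swap_last hxy (hM y (by simp)) (by simpa using hnd) (by simpa using hN)
  | append_singleton B z ih =>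
    have hperm : (A ++ x :: y :: B).Perm (A ++ y :: x :: B) :=
      (List.Perm.swap y x B).append_left A
    rw [← List.cons_append, ← List.cons_append, ← List.append_assoc] at hM hnd hN ⊢
    have hz : z < M := hM z (by simp)
    rw [List.length_append, List.length_singleton] at hN
    rw [← List.cons_append, ← List.cons_append, ← List.append_assoc, h.ascentWord_concat hz hnd hN,
      h.ascentWord_concat hz ((hperm.append_right [z]).nodup hnd) (hperm.length_eq ▸ hN),
      ih (fun w hw => hM w (List.mem_append_left _ hw)) hnd.of_append_left (by omega),
      hperm.length_eq, hperm.countP_eq, mul_assoc]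

end IsBraidSequence

end AscentWord

/-! ### Dotted boundary paths of Young diagrams -/

/-- One pass through the list `xs` with a carried letter `c`: at a dot (`true`) the carried letter
is put down and the next one is taken up, elsewhere the carried letter moves past the next one.
`bubbleOut c bs xs` is the list of the letters left behind. -/
def bubbleOut : ℕ → List Bool → List ℕ → List ℕ
  | c, true :: bs, x :: xs => c :: bubbleOut x bs xs
  | c, false :: bs, x :: xs => x :: bubbleOut c bs xs
  | _, _, _ => []

/-- The letter that is carried at the end of the pass of `bubbleOut`. -/
def bubbleCarry : ℕ → List Bool → List ℕ → ℕ
  | _, true :: bs, x :: xs => bubbleCarry x bs xs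
  | c, false :: bs, _ :: xs => bubbleCarry c bs xs
  | c, _, _ => c

/-- In the pass of `bubbleOut`, the carried letter is always smaller than the next one. -/
inductive BubbleAscending : ℕ → List Bool → List ℕ → Prop
  | nil (c : ℕ) : BubbleAscending c [] []
  | dot {c x : ℕ} {bs : List Bool} {xs : List ℕ} (hx : c < x) (h : BubbleAscending x bs xs) :
      BubbleAscending c (true :: bs) (x :: xs)
  | gap {c x : ℕ} {bs : List Bool} {xs : List ℕ} (hx : c < x) (h : BubbleAscending c bs xs) :
      BubbleAscending c (false :: bs) (x :: xs)

/-- The places without dot in a column that is read from the top down, its first place being `q`. -/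
def gapWord : ℕ → List Bool → List ℕ
  | q, true :: bs => gapWord (q + 1) bs
  | q, false :: bs => q :: gapWord (q + 1) bs
  | _, [] => []

/-- A Young diagram with dots, given by the steps of its boundary path: `none` adds an empty top
row, and `some bs` adds a full first column with the dots `bs`, listed from the top down. -/
abbrev DotPath := List (Option (List Bool))

namespace DotPath

/-- The number of rows of the diagram. -/
def rows : DotPath → ℕ
  | [] => 0
  | none :: S => rows S + 1
  | some _ :: S => rows S

/-- The values of `w⁻¹` at the first `k` letters, where `k` is the number of rows and `w` is spelled
by all the boxes; these are the places of the steps that add a row. -/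
def rowSteps : DotPath → List ℕ
  | [] => []
  | none :: S => 0 :: (rowSteps S).map (· + 1)
  | some _ :: S => (rowSteps S).map (· + 1)

/-- The values of `w⁻¹` at the letters after the first `k`, with `w` as for `DotPath.rowSteps`;
these are the places of the steps that add a column. -/
def colSteps : DotPath → List ℕ
  | [] => []
  | none :: S => (colSteps S).map (· + 1)
  | some _ :: S => 0 :: (colSteps S).map (· + 1)

/-- The diagram of the same shape without dots. -/
def clear : DotPath → DotPath
  | [] => []
  | none :: S => none :: clear S
  | some _ :: S => some (List.replicate (rows S) false) :: clear S

/-- The values of `u⁻¹` at the first `k` letters, where `k` is the number of rows and `u` is spelled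
by the boxes without dot. -/
def high : DotPath → List ℕ
  | [] => []
  | none :: S => 0 :: (high S).map (· + 1)
  | some bs :: S => bubbleOut 0 bs ((high S).map (· + 1))

/-- The values of `u⁻¹` at the letters after the first `k`, with `u` as for `DotPath.high`. -/
def low : DotPath → List ℕ
  | [] => []
  | none :: S => (low S).map (· + 1)
  | some bs :: S => bubbleCarry 0 bs ((high S).map (· + 1)) :: (low S).map (· + 1)

/-- In every column the carried letter is smaller than the letters it meets; this is the Le
condition. -/
def Valid : DotPath → Prop
  | [] => True
  | none :: S => Valid S
  | some bs :: S => BubbleAscending 0 bs ((high S).map (· + 1)) ∧ Valid S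

/-- The positive word of the arcs that end in the first window, i.e. of the braid `J⁽¹⁾`. -/
def arcWord : DotPath → List ℕ
  | [] => []
  | none :: S => (arcWord S).map (· + 1)
  | some bs :: S =>
      arcWord S ++ descWord 1
        ((high S).countP fun z => z + 1 < bubbleCarry 0 bs ((high S).map (· + 1)))

/-- The word of the boxes without dot. -/
def gaps : DotPath → List ℕ
  | [] => []
  | none :: S => (gaps S).map (· + 1)
  | some bs :: S => (gapWord 1 bs).reverse ++ (gaps S).map (· + 1)

end DotPath

section Bubble

lemma gapWord_succ (q : ℕ) (bs : List Bool) :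
    gapWord (q + 1) bs = (gapWord q bs).map (· + 1) := by
  induction bs generalizing q with
  | nil => rfl
  | cons b bs ih => cases b <;> simp [gapWord, ih (q + 1)]

lemma gapWord_add (q p : ℕ) (bs : List Bool) :
    gapWord (q + p) bs = (gapWord q bs).map (· + p) := by
  induction p with
  | zero => simp
  | succ p ih => rw [← Nat.add_assoc, gapWord_succ, ih]; simp [Function.comp_def, Nat.add_assoc]

lemma mem_gapWord {q x : ℕ} {bs : List Bool} (h : x ∈ gapWord q bs) :
    q ≤ x ∧ x < q + bs.length := by
  induction bs generalizing q with
  | nil => simp [gapWord] at h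
  | cons b bs ih =>
    rw [List.length_cons]
    cases b with
    | false =>
      rcases List.mem_cons.1 h with rfl | h
      · omega
      · have := ih h
        omega
    | true =>
      have := ih h
      omega

lemma bubble_perm {c : ℕ} {bs : List Bool} {xs : List ℕ} (h : bs.length = xs.length) :
    (bubbleCarry c bs xs :: bubbleOut c bs xs).Perm (c :: xs) := by
  induction bs generalizing c xs with
  | nil => simp [bubbleCarry, bubbleOut, List.length_eq_zero_iff.1 h.symm]
  | cons b bs ih =>
    obtain ⟨x, xs, rfl⟩ := List.exists_cons_of_length_eq_add_one h.symm
    replace h : bs.length = xs.length := Nat.succ.inj h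
    cases b with
    | false => exact (((List.Perm.swap ..).trans ((ih h).cons x))).trans (List.Perm.swap ..)
    | true => exact (List.Perm.swap ..).trans ((ih h).cons c)

lemma BubbleAscending.length_eq {c : ℕ} {bs : List Bool} {xs : List ℕ}
    (h : BubbleAscending c bs xs) : bs.length = xs.length := by
  induction h with
  | nil => rfl
  | dot _ _ ih => simpa using ih
  | gap _ _ ih => simpa using ih

lemma length_bubbleOut {c : ℕ} {bs : List Bool} {xs : List ℕ} (h : bs.length = xs.length) :
    (bubbleOut c bs xs).length = xs.length := by
  simpa using (bubble_perm (c := c) h).length_eq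

lemma bubble_perm_append {c : ℕ} {bs : List Bool} {xs : List ℕ} (h : bs.length = xs.length)
    (A B : List ℕ) :
    (A ++ (bubbleOut c bs xs ++ bubbleCarry c bs xs :: B)).Perm (A ++ c :: (xs ++ B)) :=
  List.Perm.append_left A (List.perm_middle.trans ((bubble_perm h).append_right B))

end Bubble

section Tangle

variable {Γ : Type*} [Group Γ] {s : ℕ → Γ} {N : ℕ}

/-- The tangle of a column with the given dots, listed from the top down. -/
def tangle (s : ℕ → Γ) : List Bool → Γ
  | [] => 1
  | false :: bs => tangle (fun i => s (i + 1)) bs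
  | true :: bs =>
      (wordEval s (gapWord 1 bs).reverse)⁻¹ * wordEval s (descWord 1 bs.length)

/-- The Le braid of the diagram: the product of its column tangles from the right to the left. -/
def DotPath.braid (s : ℕ → Γ) : DotPath → Γ
  | [] => 1
  | none :: S => DotPath.braid (fun i => s (i + 1)) S
  | some bs :: S => DotPath.braid s S * tangle s bs

lemma wordEval_map_add (p : ℕ) (l : List ℕ) :
    wordEval s (l.map (· + p)) = wordEval (fun i => s (i + p)) l := by
  simp [wordEval, Function.comp_def]

lemma descWord_map_add (a l p : ℕ) : (descWord a l).map (· + p) = descWord (a + p) l := by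
  simp [descWord, List.map_reverse, Nat.add_comm _ p, List.map_add_range']

namespace IsBraidSequence

lemma ascentWord_bubble {Γ : Type*} [Monoid Γ] {s : ℕ → Γ} (h : IsBraidSequence N s) {M c : ℕ}
    {bs : List Bool} {A xs B : List ℕ} (ha : BubbleAscending c bs xs)
    (hM : ∀ z ∈ A ++ c :: (xs ++ B), z < M) (hnd : (A ++ c :: (xs ++ B)).Nodup)
    (hN : (A ++ c :: (xs ++ B)).length ≤ N) :
    wordEval s (ascentWord M (A ++ c :: (xs ++ B))) =
      wordEval s (ascentWord M (A ++ (bubbleOut c bs xs ++ bubbleCarry c bs xs :: B))) *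
        wordEval s (gapWord (A.length + 1) bs).reverse := by
  induction ha generalizing A with
  | nil => simp [bubbleCarry, bubbleOut, gapWord]
  | @dot c x bs xs _ _ ih =>
    simpa [bubbleOut, bubbleCarry, gapWord] using
      ih (A := A ++ [c]) (by simpa using hM) (by simpa using hnd) (by simpa using hN)
  | @gap c x bs xs hx _ ih =>
    have hswap : (A ++ [x] ++ c :: (xs ++ B)).Perm (A ++ c :: (x :: xs ++ B)) := by
      rw [List.append_assoc]
      exact (List.Perm.swap ..).append_left A
    have hrest := ih (A := A ++ [x]) (fun z hz => hM z (hswap.mem_iff.1 hz))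
      (hswap.nodup_iff.2 hnd) (hswap.length_eq.trans_le hN)
    rw [List.cons_append, h.ascentWord_swap (B := xs ++ B) hx hM hnd hN]
    simp only [List.append_assoc, List.cons_append, List.nil_append] at hrest
    rw [hrest]
    simp [bubbleOut, bubbleCarry, gapWord, mul_assoc]

-- The pass of `bubbleOut` takes `x` to the last place, and the last entry is then split off.
lemma ascentWord_mul_tangle_true (h : IsBraidSequence N s) {M x : ℕ} {bs : List Bool}
    {A xs : List ℕ} (ha : BubbleAscending x bs xs)
    (hM : ∀ z ∈ A ++ x :: xs, z < M + 1) (h0 : 0 ∉ A ++ x :: xs) (hnd : (A ++ x :: xs).Nodup)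
    (hN : (A ++ x :: xs).length ≤ N) :
    wordEval s (ascentWord (M + 1) (A ++ x :: xs)) *
        tangle (fun i => s (i + A.length)) (true :: bs) =
      wordEval s (List.range'
          ((A ++ x :: xs).length - (A ++ x :: xs).countP (· < bubbleCarry x bs xs))
          ((A ++ x :: xs).countP (· < bubbleCarry x bs xs))) *
        wordEval s (ascentWord (M + 1) (A ++ 0 :: bubbleOut x bs xs)) := by
  have hbubble := h.ascentWord_bubble (M := M + 1) (B := []) ha (by rwa [List.append_nil])
    (by rwa [List.append_nil]) (by rwa [List.append_nil])
  have hp := bubble_perm_append (c := x) ha.length_eq A []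
  set y := bubbleCarry x bs xs
  rw [List.append_nil] at hp hbubble
  rw [← List.append_assoc] at hp hbubble
  have h0' : 0 ∉ A ++ bubbleOut x bs xs := fun h => h0 (hp.mem_iff.1 (List.mem_append_left _ h))
  have hlen : (A ++ bubbleOut x bs xs).length + 1 = (A ++ x :: xs).length := by
    simpa [Nat.add_assoc] using hp.length_eq
  have hcount : (A ++ bubbleOut x bs xs).countP (· < y) = (A ++ x :: xs).countP (· < y) := by
    simpa using hp.countP_eq (· < y)
  rw [hbubble, h.ascentWord_concat (hM y (hp.mem_iff.1 (by simp))) (hp.nodup_iff.2 hnd)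
    (hlen.trans_le hN), hcount, hlen, ascentWord_of_notMem h0',
    ascentWord_append_zero_cons _ fun h => h0' (List.mem_append_left _ h), tangle,
    ← wordEval_map_add, ← wordEval_map_add, descWord_map_add, List.map_reverse, ← gapWord_add,
    dropZero_append, Nat.add_comm 1, ha.length_eq, length_bubbleOut ha.length_eq, wordEval_append]
  simp only [mul_assoc, mul_inv_cancel_left]

lemma ascentWord_mul_tangle (h : IsBraidSequence N s) {M : ℕ} {bs : List Bool} {A xs : List ℕ}
    (ha : BubbleAscending 0 bs xs)
    (hM : ∀ z ∈ A ++ xs, z < M + 1) (h0 : 0 ∉ A ++ xs) (hnd : (A ++ xs).Nodup)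
    (hN : (A ++ xs).length ≤ N) :
    wordEval s (ascentWord (M + 1) (A ++ xs)) * tangle (fun i => s (i + A.length)) bs =
      wordEval s (List.range' ((A ++ xs).length - (A ++ xs).countP (· < bubbleCarry 0 bs xs))
          ((A ++ xs).countP (· < bubbleCarry 0 bs xs))) *
        wordEval s (ascentWord (M + 1) (A ++ bubbleOut 0 bs xs)) := by
  induction bs generalizing A xs with
  | nil =>
    cases ha
    simp [bubbleCarry, bubbleOut, tangle]
  | cons b bs ih =>
    cases ha with
    | dot _ ha => exact h.ascentWord_mul_tangle_true ha hM h0 hnd hN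
    | @gap _ x _ xs _ ha =>
      have := ih (A := A ++ [x]) (xs := xs) ha (by simpa using hM) (by simpa using h0)
        (by simpa using hnd) (by simpa using hN)
      simp only [List.append_assoc, List.singleton_append, List.length_append (as := A) (bs := [x]),
        List.length_singleton, Nat.add_comm A.length 1, ← Nat.add_assoc] at this
      exact this

end IsBraidSequence

end Tangle

namespace DotPath

variable {Γ : Type*} {s : ℕ → Γ} {S : DotPath} {bs : List Bool}

lemma length_high (h : Valid S) : (high S).length = rows S := by
  induction S with
  | nil => rfl
  | cons b S ih =>
    cases b with
    | none => simp [high, rows, ih h]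
    | some bs => rw [high, length_bubbleOut h.1.length_eq, List.length_map, ih h.2, rows]

lemma length_eq_rows (h : Valid (some bs :: S)) : bs.length = rows S := by
  rw [h.1.length_eq, List.length_map, length_high h.2]

lemma high_append_low_perm (h : Valid S) : (high S ++ low S).Perm (List.range S.length) := by
  induction S with
  | nil => rfl
  | cons b S ih =>
    rw [List.length_cons, List.range_succ_eq_map]
    cases b with
    | none =>
      rw [high, low, List.cons_append, ← List.map_append]
      exact ((ih h).map _).cons 0
    | some bs =>
      have := bubble_perm_append (c := 0) (bs := bs) (xs := (high S).map (· + 1))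
        h.1.length_eq [] ((low S).map (· + 1))
      rw [List.nil_append, List.nil_append, ← List.map_append] at this
      exact this.trans (((ih h.2).map _).cons 0)

lemma length_high_append_low (h : Valid S) : (high S ++ low S).length = S.length := by
  rw [(high_append_low_perm h).length_eq, List.length_range]

lemma nodup_high_append_low (h : Valid S) : (high S ++ low S).Nodup :=
  (high_append_low_perm h).nodup_iff.2 List.nodup_range

lemma lt_of_mem_high_append_low (h : Valid S) {x : ℕ} (hx : x ∈ high S ++ low S) :
    x < S.length :=
  List.mem_range.1 ((high_append_low_perm h).mem_iff.1 hx)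

lemma lt_of_mem_high (h : Valid S) {x : ℕ} (hx : x ∈ high S) : x < S.length :=
  lt_of_mem_high_append_low h (List.mem_append_left _ hx)

lemma rows_le (S : DotPath) : rows S ≤ S.length := by
  induction S with
  | nil => rfl
  | cons b S ih => cases b <;> simp only [rows, List.length_cons] <;> omega

lemma countP_high_lt_bubbleCarry (h : Valid (some bs :: S)) :
    (high S).countP (fun z => z + 1 < bubbleCarry 0 bs ((high S).map (· + 1))) ≤ rows S - 1 := by
  obtain ⟨ha, hS⟩ := h
  have hy : bubbleCarry 0 bs ((high S).map (· + 1)) ∈ 0 :: (high S).map (· + 1) :=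
    (bubble_perm ha.length_eq).mem_iff.1 List.mem_cons_self
  generalize bubbleCarry 0 bs ((high S).map (· + 1)) = y at hy
  rcases List.mem_cons.1 hy with rfl | hy
  · simp
  · obtain ⟨z, hz, rfl⟩ := List.mem_map.1 hy
    rw [← length_high hS]
    refine Nat.le_sub_one_of_lt (List.countP_le_length.lt_of_ne fun heq => ?_)
    simpa using List.countP_eq_length.1 heq z hz

lemma isBraidWord_gaps (h : Valid S) : IsBraidWord S.length (gaps S) := by
  induction S with
  | nil => simp [gaps, IsBraidWord]
  | cons b S ih =>
    cases b with
    | none => exact (ih h).map_add 1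
    | some bs =>
      refine IsBraidWord.append (fun x hx => ?_) ((ih h.2).map_add 1)
      have := mem_gapWord (List.mem_reverse.1 hx)
      have := rows_le S
      rw [length_eq_rows h] at *
      rw [List.length_cons]
      omega

section Monoid

variable [Monoid Γ]

lemma ascentWord_zero_cons_map_succ (M : ℕ) (l : List ℕ) :
    ascentWord (M + 1) (0 :: l.map (· + 1)) = ascentWord M l ++ descWord 1 l.length := by
  simpa using ascentWord_append_zero_cons M (A := []) (B := l.map (· + 1)) (by simp)

lemma ascentWord_zero_cons_mul_gaps (h : Valid S) (hs : IsBraidSequence (S.length + 1) s)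
    (ih : wordEval s (ascentWord S.length (high S ++ low S)) * wordEval s (gaps S) =
      wordEval s (halfTwistWord S.length)) :
    wordEval s (ascentWord (S.length + 1) (0 :: (high S ++ low S).map (· + 1))) *
        wordEval s ((gaps S).map (· + 1)) =
      wordEval s (halfTwistWord (S.length + 1)) := by
  have hslide := hs.wordEval_mul_descWord (a := 1) (l := S.length) le_rfl (by omega) fun x hx => by
    have := isBraidWord_gaps h x hx
    omega
  rw [ascentWord_zero_cons_map_succ, length_high_append_low h, wordEval_append, mul_assoc,
    ← hslide, ← mul_assoc, ih, halfTwistWord, wordEval_append]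

theorem ascentWord_mul_gaps (h : Valid S) (hs : IsBraidSequence S.length s) :
    wordEval s (ascentWord S.length (high S ++ low S)) * wordEval s (gaps S) =
      wordEval s (halfTwistWord S.length) := by
  induction S with
  | nil => simp [gaps, halfTwistWord, ascentWord]
  | cons b S ih =>
    cases b with
    | none =>
      rw [high, low, List.cons_append, ← List.map_append]
      exact ascentWord_zero_cons_mul_gaps h hs (ih h (hs.mono S.length.le_succ))
    | some bs =>
      obtain ⟨ha, hS⟩ := h
      have hbubble := hs.ascentWord_bubble (M := S.length + 1) (A := [])
        (B := (low S).map (· + 1)) ha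
      rw [List.nil_append, List.nil_append, ← List.map_append] at hbubble
      rw [high, low, gaps, List.length_cons, wordEval_append, ← mul_assoc,
        ← ascentWord_zero_cons_mul_gaps hS hs (ih hS (hs.mono S.length.le_succ)),
        hbubble (by
            rintro (_ | z) hz
            · exact Nat.succ_pos _
            · exact Nat.succ_lt_succ (lt_of_mem_high_append_low hS (by simpa using hz)))
          (by simpa using (nodup_high_append_low hS).map (add_left_injective 1))
          (by rw [List.length_cons, List.length_map, length_high_append_low hS, List.length_cons])]
      rfl

end Monoid

section Group

variable [Group Γ]

lemma braid_none (h : Valid S) (hs : IsBraidSequence (rows S + 1) s)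
    (ih : DotPath.braid (fun i => s (i + 1)) S =
      wordEval (fun i => s (i + 1)) (arcWord S) *
        (wordEval (fun i => s (i + 1)) (halfTwistWord (rows S)))⁻¹ *
        wordEval (fun i => s (i + 1)) (ascentWord S.length (high S))) :
    DotPath.braid s (none :: S) = wordEval s (arcWord (none :: S)) *
      (wordEval s (halfTwistWord (rows S + 1)))⁻¹ *
      wordEval s (ascentWord (S.length + 1) (high (none :: S))) := by
  have hslide := hs.wordEval_mul_descWord (a := 1) (l := rows S) le_rfl (by omega)
    (w := ascentWord S.length (high S)) fun x hx => by
      have := isBraidWord_ascentWord _ _ x hx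
      rw [length_high h] at this
      omega
  rw [DotPath.braid, ih, arcWord, high, ascentWord_zero_cons_map_succ, length_high h,
    hs.halfTwist_succ, wordEval_append, hslide]
  simp only [wordEval_map_succ]
  group

lemma braid_some (h : Valid (some bs :: S)) (hs : IsBraidSequence (rows S) s)
    (ih : DotPath.braid s S = wordEval s (arcWord S) * (wordEval s (halfTwistWord (rows S)))⁻¹ *
      wordEval s (ascentWord S.length (high S))) :
    DotPath.braid s (some bs :: S) = wordEval s (arcWord (some bs :: S)) *
      (wordEval s (halfTwistWord (rows S)))⁻¹ *
      wordEval s (ascentWord (S.length + 1) (high (some bs :: S))) := by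
  have hflip := hs.halfTwist_mul_descWord (countP_high_lt_bubbleCarry h)
  obtain ⟨ha, hS⟩ := h
  have hlen : ((high S).map (· + 1)).length = rows S := by rw [List.length_map, length_high hS]
  have htangle := hs.ascentWord_mul_tangle (M := S.length) (A := []) ha
    (by simpa using fun x => lt_of_mem_high hS) (by simp)
    (by simpa using (nodup_high_append_low hS).of_append_left.map (add_left_injective 1)) hlen.le
  simp only [List.nil_append, ascentWord_map_succ, List.length_nil, Nat.add_zero, hlen,
    List.countP_map, Function.comp_def] at htangle
  rw [← eq_inv_mul_iff_mul_eq, ← mul_assoc, ← mul_inv_eq_iff_eq_mul] at hflip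
  rw [DotPath.braid, ih, mul_assoc, htangle, arcWord, high, wordEval_append, mul_assoc _ _ (_⁻¹),
    hflip]
  simp only [mul_assoc]

theorem braid_eq (h : Valid S) (hs : IsBraidSequence (rows S) s) :
    DotPath.braid s S = wordEval s (arcWord S) * (wordEval s (halfTwistWord (rows S)))⁻¹ *
      wordEval s (ascentWord S.length (high S)) := by
  induction S generalizing s with
  | nil => simp [DotPath.braid, arcWord, rows, halfTwistWord, ascentWord]
  | cons b S ih =>
    cases b with
    | none => exact braid_none h hs (ih h hs.shift)
    | some bs => exact braid_some h hs (ih h.2 hs)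

end Group

end DotPath

section Bubble

variable {c : ℕ} {bs : List Bool} {xs : List ℕ}

lemma bubble_replicate_false (c : ℕ) (xs : List ℕ) :
    bubbleOut c (List.replicate xs.length false) xs = xs ∧
      bubbleCarry c (List.replicate xs.length false) xs = c := by
  induction xs with
  | nil => exact ⟨rfl, rfl⟩
  | cons x xs ih => simp [List.replicate_succ, bubbleOut, bubbleCarry, ih]

lemma bubbleOut_of_notMem (hl : bs.length = xs.length) (h : true ∉ bs) :
    bubbleOut c bs xs = xs := by
  have hbs : bs = List.replicate xs.length false :=
    List.eq_replicate_iff.2 ⟨hl, fun b hb => by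
      cases b with
      | false => rfl
      | true => exact absurd hb h⟩
  rw [hbs, (bubble_replicate_false c xs).1]

lemma mem_bubbleOut (hl : bs.length = xs.length) (h : true ∈ bs) : c ∈ bubbleOut c bs xs := by
  induction bs generalizing xs with
  | nil => simp at h
  | cons b bs ih =>
    obtain ⟨x, xs, rfl⟩ := List.exists_cons_of_length_eq_add_one hl.symm
    cases b with
    | false => exact List.mem_cons_of_mem _ (ih (Nat.succ.inj hl) (by simpa using h))
    | true => exact List.mem_cons_self

/-- The entry at place `p`, if there is one, is smaller than all later entries. -/
def IsSuffixMin : List ℕ → ℕ → Prop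
  | [], _ => True
  | x :: xs, 0 => ∀ y ∈ xs, x < y
  | _ :: xs, p + 1 => IsSuffixMin xs p

lemma isSuffixMin_map_succ {p : ℕ} : IsSuffixMin (xs.map (· + 1)) p ↔ IsSuffixMin xs p := by
  induction xs generalizing p with
  | nil => rfl
  | cons x xs ih =>
    cases p with
    | zero => simp [IsSuffixMin]
    | succ p => exact ih

lemma bubbleAscending_of_isSuffixMin (hl : bs.length = xs.length) (hc : ∀ x ∈ xs, c < x)
    (h : ∀ p, bs.getD p false → IsSuffixMin xs p) : BubbleAscending c bs xs := by
  induction bs generalizing c xs with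
  | nil =>
    obtain rfl := List.length_eq_zero_iff.1 hl.symm
    exact .nil c
  | cons b bs ih =>
    obtain ⟨x, xs, rfl⟩ := List.exists_cons_of_length_eq_add_one hl.symm
    replace hl : bs.length = xs.length := Nat.succ.inj hl
    obtain ⟨hcx, hc⟩ := List.forall_mem_cons.1 hc
    have h' : ∀ p, bs.getD p false → IsSuffixMin xs p := fun p => h (p + 1)
    cases b with
    | false => exact .gap hcx (ih hl hc h')
    | true => exact .dot hcx (ih hl (h 0 rfl) h')

lemma exists_bubble_eq (V : List ℕ) {y : ℕ} (hnd : (V ++ [y]).Nodup) :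
    ∃ c bs xs, BubbleAscending c bs xs ∧ bubbleOut c bs xs = V ∧ bubbleCarry c bs xs = y := by
  induction V with
  | nil => exact ⟨y, [], [], .nil y, rfl, rfl⟩
  | cons v V ih =>
    rw [List.cons_append, List.nodup_cons] at hnd
    obtain ⟨c, bs, xs, ha, rfl, rfl⟩ := ih hnd.2
    have hvc : v ≠ c := fun hvc => by
      have : c ∈ bubbleCarry c bs xs :: bubbleOut c bs xs :=
        (bubble_perm ha.length_eq).mem_iff.2 List.mem_cons_self
      exact hnd.1 ((List.perm_append_singleton _ _).mem_iff.2 (hvc ▸ this))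
    rcases hvc.lt_or_gt with hvc | hvc
    · exact ⟨v, true :: bs, c :: xs, .dot hvc ha, rfl, rfl⟩
    · exact ⟨c, false :: bs, v :: xs, .gap hvc ha, rfl, rfl⟩

namespace BubbleAscending

lemma lt_of_mem (h : BubbleAscending c bs xs) {x : ℕ} (hx : x ∈ xs) : c < x := by
  induction h with
  | nil => simp at hx
  | dot hcy _ ih =>
    rcases List.mem_cons.1 hx with rfl | hx
    · exact hcy
    · exact hcy.trans (ih hx)
  | gap hcy _ ih =>
    rcases List.mem_cons.1 hx with rfl | hx
    · exact hcy
    · exact ih hx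

lemma le_of_mem_bubbleOut (h : BubbleAscending c bs xs) {x : ℕ} (hx : x ∈ bubbleOut c bs xs) :
    c ≤ x := by
  rcases List.mem_cons.1 ((bubble_perm h.length_eq).mem_iff.1 (List.mem_cons_of_mem _ hx)) with
    rfl | hx
  · exact le_rfl
  · exact (h.lt_of_mem hx).le

lemma isSuffixMin (h : BubbleAscending c bs xs) {p : ℕ} (hp : bs.getD p false) :
    IsSuffixMin xs p := by
  induction h generalizing p with
  | nil => trivial
  | dot _ h ih =>
    cases p with
    | zero => exact fun _ => h.lt_of_mem
    | succ p => exact ih hp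
  | gap _ _ ih =>
    cases p with
    | zero => cases hp
    | succ p => exact ih hp

lemma isSuffixMin_bubbleOut_iff (h : BubbleAscending c bs xs) {p : ℕ} :
    IsSuffixMin (bubbleOut c bs xs) p ↔
      bs.getD p false ∨ IsSuffixMin xs p ∧ true ∉ bs.drop (p + 1) := by
  induction h generalizing p with
  | nil => simp [IsSuffixMin, bubbleOut]
  | dot hx h ih =>
    cases p with
    | zero => exact iff_of_true (fun y hy => hx.trans_le (h.le_of_mem_bubbleOut hy)) (.inl rfl)
    | succ p => exact ih
  | @gap c x bs xs hx h ih =>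
    cases p with
    | zero =>
      suffices (∀ y ∈ bubbleOut c bs xs, x < y) ↔ (∀ y ∈ xs, x < y) ∧ true ∉ bs by
        simpa [IsSuffixMin, bubbleOut] using this
      by_cases hbs : true ∈ bs
      · exact iff_of_false (fun hmin => hx.not_gt (hmin c (mem_bubbleOut h.length_eq hbs)))
          fun hmin => hmin.2 hbs
      · rw [bubbleOut_of_notMem h.length_eq hbs, and_iff_left hbs]
    | succ p => exact ih

lemma countP_take_le (h : BubbleAscending c bs xs) (t M : ℕ) :
    ((bubbleOut c bs xs).take t).countP (· < M) ≤ (xs.take t).countP (· < M) ∨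
      xs.countP (· < M) ≤ (xs.take t).countP (· < M) := by
  induction h generalizing t with
  | nil => simp
  | @dot c x bs xs hcx h ih =>
    cases t with
    | zero => simp
    | succ t =>
      by_cases hx : x < M
      · have hc : c < M := hcx.trans hx
        simpa [bubbleOut, hx, hc] using ih t
      · right
        rw [List.countP_eq_zero.2]
        · exact Nat.zero_le _
        · intro z hz
          have : x ≤ z := by
            rcases List.mem_cons.1 hz with rfl | hz
            exacts [le_rfl, (h.lt_of_mem hz).le]
          simp only [decide_eq_true_eq]
          omega
  | @gap c x bs xs _ _ ih =>
    cases t with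
    | zero => simp
    | succ t => simpa [bubbleOut, List.countP_cons] using ih t

end BubbleAscending

end Bubble

namespace DotPath

lemma length_rowSteps (S : DotPath) : (rowSteps S).length = rows S := by
  induction S with
  | nil => rfl
  | cons b S ih => cases b <;> simp [rowSteps, rows, ih]

lemma length_clear (S : DotPath) : (clear S).length = S.length := by
  induction S with
  | nil => rfl
  | cons b S ih => cases b <;> simp [clear, ih]

lemma high_clear (S : DotPath) : high (clear S) = rowSteps S := by
  induction S with
  | nil => rfl
  | cons b S ih =>
    cases b with
    | none => rw [clear, high, ih, rowSteps]
    | some bs =>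
      rw [clear, high, ih, rowSteps, ← length_rowSteps,
        ← List.length_map (f := (· + 1)) (as := rowSteps S), (bubble_replicate_false ..).1]

lemma low_clear (S : DotPath) : low (clear S) = colSteps S := by
  induction S with
  | nil => rfl
  | cons b S ih =>
    cases b with
    | none => rw [clear, low, ih, colSteps]
    | some bs =>
      rw [clear, low, ih, colSteps, high_clear, ← length_rowSteps,
        ← List.length_map (f := (· + 1)) (as := rowSteps S), (bubble_replicate_false ..).2]

lemma valid_clear (S : DotPath) : Valid (clear S) := by
  induction S with
  | nil => trivial
  | cons b S ih =>
    cases b with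
    | none => exact ih
    | some bs =>
      refine ⟨bubbleAscending_of_isSuffixMin ?_ (by simp) fun p h => ?_, ih⟩
      · rw [List.length_replicate, List.length_map, high_clear, length_rowSteps]
      · simp only [List.getD_eq_getElem?_getD, List.getElem?_replicate] at h
        split_ifs at h <;> cases h

lemma rowSteps_append_colSteps_perm (S : DotPath) :
    (rowSteps S ++ colSteps S).Perm (List.range S.length) := by
  rw [← high_clear, ← low_clear, ← length_clear]
  exact high_append_low_perm (valid_clear S)

end DotPath

/-! ### Existence of the Le diagram -/

/-- Every initial segment of `L'` contains at least as many numbers below `M` as the initial segment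
of `L` of the same length. For the lists of values of two permutations this is the tableau criterion
for the Bruhat order. -/
def PrefixCountLE (L L' : List ℕ) : Prop :=
  ∀ t M, (L.take t).countP (· < M) ≤ (L'.take t).countP (· < M)

namespace PrefixCountLE

lemma head_eq_zero {L L' : List ℕ} {v : ℕ} (h : PrefixCountLE (0 :: L) (v :: L')) : v = 0 := by
  by_contra hv
  simpa [hv] using h 1 1

lemma of_zero_cons_map_succ {L L' : List ℕ}
    (h : PrefixCountLE (0 :: L.map (· + 1)) (0 :: L'.map (· + 1))) : PrefixCountLE L L' :=
  fun t M => by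
    simpa only [List.take_succ_cons, ← List.map_take, List.countP_cons, countP_map_succ,
      Nat.add_le_add_iff_right] using h (t + 1) (M + 1)

variable {W X V Z : List ℕ} {y : ℕ}

lemma countP_take_le (h : PrefixCountLE (W ++ 0 :: X) (V ++ y :: Z)) (hl : W.length = V.length)
    (e M : ℕ) : W.countP (· < M) + (if 0 < M then 1 else 0) + (X.take e).countP (· < M) ≤
      (y :: V).countP (· < M) + (Z.take e).countP (· < M) := by
  have := h (W.length + (e + 1)) M
  nth_rewrite 2 [hl] at this
  simp only [List.take_length_add_append, List.take_succ_cons, List.countP_append,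
    List.countP_cons, decide_eq_true_eq] at this ⊢
  omega

lemma zero_mem (h : PrefixCountLE (W ++ 0 :: X) (V ++ y :: Z)) (hl : W.length = V.length) :
    0 ∈ y :: V := by
  have hpos : 0 < (y :: V).countP (· < 1) := by
    have := h.countP_take_le hl 0 1
    simp only [Nat.zero_lt_one, if_true, List.take_zero, List.countP_nil] at this
    omega
  obtain ⟨z, hz, hz0⟩ := List.countP_pos_iff.1 hpos
  obtain rfl : z = 0 := by simpa using hz0
  exact hz

lemma eq_zero_of_bubble {c : ℕ} {bs : List Bool} {xs : List ℕ}
    (h : PrefixCountLE (W ++ 0 :: X) (bubbleOut c bs xs ++ bubbleCarry c bs xs :: Z))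
    (ha : BubbleAscending c bs xs) (hl : W.length = (bubbleOut c bs xs).length) : c = 0 := by
  have h0 := h.zero_mem hl
  rw [(bubble_perm ha.length_eq).mem_iff] at h0
  rcases List.mem_cons.1 h0 with h0 | h0
  · exact h0.symm
  · exact absurd (ha.lt_of_mem h0) (Nat.not_lt_zero _)

lemma of_bubble {bs : List Bool} {xs : List ℕ} (ha : BubbleAscending 0 bs xs)
    (hl : W.length = xs.length)
    (h : PrefixCountLE (W ++ 0 :: X) (bubbleOut 0 bs xs ++ bubbleCarry 0 bs xs :: Z)) :
    PrefixCountLE (0 :: (W ++ X)) (0 :: (xs ++ Z)) := by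
  have hlen : W.length = (bubbleOut 0 bs xs).length := hl.trans (length_bubbleOut ha.length_eq).symm
  rintro (_ | t) M
  · simp
  have hfull := h.countP_take_le hlen (t - W.length) M
  rw [(bubble_perm ha.length_eq).countP_eq] at hfull
  simp only [List.take_succ_cons, List.countP_cons, decide_eq_true_eq, List.take_append,
    List.countP_append, ← hl] at hfull ⊢
  rcases le_total t W.length with ht | ht
  · have hprefix := h t M
    rw [List.take_append_of_le_length ht, List.take_append_of_le_length (hlen ▸ ht)] at hprefix
    have := (List.take_sublist t W).countP_le (p := (· < M))
    rw [Nat.sub_eq_zero_of_le ht] at *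
    rcases ha.countP_take_le t M with hle | hle <;>
    · simp only [List.take_zero, List.countP_nil] at *
      omega
  · rw [List.take_of_length_le ht, List.take_of_length_le (hl ▸ ht : xs.length ≤ t)]
    omega

end PrefixCountLE

lemma exists_map_succ_append {V Z : List ℕ} {n : ℕ}
    (h : (0 :: (V ++ Z)).Perm (List.range (n + 1))) :
    ∃ V' Z' : List ℕ, V = V'.map (· + 1) ∧ Z = Z'.map (· + 1) ∧
      (V' ++ Z').Perm (List.range n) := by
  have h0 : 0 ∉ V ++ Z := (List.nodup_cons.1 (h.nodup_iff.2 List.nodup_range)).1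
  rw [List.mem_append, not_or] at h0
  refine ⟨_, _, (map_succ_dropZero h0.1).symm, (map_succ_dropZero h0.2).symm, ?_⟩
  rw [← List.map_perm_map_iff (add_left_injective 1), List.map_append, map_succ_dropZero h0.1,
    map_succ_dropZero h0.2]
  rwa [List.range_succ_eq_map, List.perm_cons] at h

namespace DotPath

theorem exists_valid (T : DotPath) {V Z : List ℕ} (hV : V.length = rows T)
    (hp : (V ++ Z).Perm (List.range T.length))
    (hr : PrefixCountLE (rowSteps T ++ colSteps T) (V ++ Z)) :
    ∃ S : DotPath, S.map Option.isSome = T.map Option.isSome ∧ Valid S ∧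
      high S = V ∧ low S = Z := by
  induction T generalizing V Z with
  | nil =>
    obtain ⟨rfl, rfl⟩ := List.append_eq_nil_iff.1 (List.perm_nil.1 hp)
    exact ⟨[], rfl, trivial, rfl, rfl⟩
  | cons b T ih =>
    cases b with
    | none =>
      obtain ⟨v, V, rfl⟩ := List.exists_cons_of_length_eq_add_one hV
      rw [rowSteps, colSteps, List.cons_append, List.cons_append, ← List.map_append] at hr
      obtain rfl := hr.head_eq_zero
      obtain ⟨V, Z, rfl, rfl, hp'⟩ := exists_map_succ_append hp
      rw [← List.map_append] at hr
      obtain ⟨S, hS, hval, rfl, rfl⟩ :=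
        ih (by simpa [rows] using hV) hp' hr.of_zero_cons_map_succ
      exact ⟨none :: S, by simp [hS], hval, rfl, rfl⟩
    | some bs =>
      obtain ⟨y, Z, rfl⟩ : ∃ y Z', Z = y :: Z' := List.exists_cons_of_ne_nil fun hZ => by
        have := hp.length_eq
        have := rows_le T
        simp_all [rows]
      have hlen : (rowSteps T).length = V.length := by rw [length_rowSteps, hV, rows]
      obtain ⟨c, bs, xs, ha, rfl, rfl⟩ := exists_bubble_eq V
        (((List.append_cons ..) ▸ hp.nodup_iff.2 List.nodup_range).of_append_left)
      rw [rowSteps, colSteps] at hr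
      obtain rfl := hr.eq_zero_of_bubble ha (by rwa [List.length_map])
      rw [length_bubbleOut ha.length_eq] at hlen
      replace hr := hr.of_bubble ha (by rwa [List.length_map])
      obtain ⟨xs, Z, rfl, rfl, hp'⟩ :=
        exists_map_succ_append ((bubble_perm_append ha.length_eq [] Z).symm.trans hp)
      rw [← List.map_append, ← List.map_append] at hr
      obtain ⟨S, hS, hval, rfl, rfl⟩ :=
        ih (by rw [← length_rowSteps, hlen, List.length_map]) hp' hr.of_zero_cons_map_succ
      exact ⟨some bs :: S, by simp [hS], ⟨ha, hval⟩, rfl, rfl⟩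

end DotPath

/-! ### Le diagrams as dotted paths -/

/-- The partition with `k` parts `r p ≤ n - k`, where row `p` is counted from the top down, so that
its boundary path has `n` steps. -/
structure IsShape (k n : ℕ) (r : ℕ → ℕ) : Prop where
  le : k ≤ n
  mono : ∀ p q, p ≤ q → q < k → r p ≤ r q
  bound : ∀ p < k, r p ≤ n - k

/-- The path with `n` steps of the diagram with `k` rows of lengths `r` and with dots `d`, where `p`
is counted from the top in `r p` and `d p j`. -/
def dotPath : ℕ → ℕ → (ℕ → ℕ) → (ℕ → ℕ → Bool) → DotPath
  | 0, _, _, _ => []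
  | n + 1, k, r, d =>
    if 0 < k ∧ r 0 = 0 then none :: dotPath n (k - 1) (fun p => r (p + 1)) (fun p => d (p + 1))
    else some ((List.range k).map fun p => d p 0) ::
      dotPath n k (fun p => r p - 1) (fun p j => d p (j + 1))

/-- Row `p` has a dot in each of its boxes that lies in the column of a dot in row `q`. -/
def RowCovers (r : ℕ → ℕ) (d : ℕ → ℕ → Bool) (p q : ℕ) : Prop :=
  ∀ j, d q j → j < r p → d p j

/-- The Le condition for the dots `d`, with rows counted from the top down. -/
def IsLe (k : ℕ) (r : ℕ → ℕ) (d : ℕ → ℕ → Bool) : Prop :=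
  ∀ p q i j, p < q → q < k → i ≤ j → d p i → d q j → j < r p → d p j

section DotPath

variable {n k : ℕ} {r : ℕ → ℕ}

lemma dotPath_row (d : ℕ → ℕ → Bool) (h : r 0 = 0) :
    dotPath (n + 1) (k + 1) r d =
      none :: dotPath n k (fun p => r (p + 1)) fun p => d (p + 1) := by
  simp [dotPath, h]

lemma dotPath_col (d : ℕ → ℕ → Bool) (h : ∀ p < k, 0 < r p) :
    dotPath (n + 1) k r d = some ((List.range k).map fun p => d p 0) ::
      dotPath n k (fun p => r p - 1) fun p j => d p (j + 1) := by
  rw [dotPath, if_neg fun h0 => (h 0 h0.1).ne' h0.2]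

lemma IsShape.row (h : IsShape (k + 1) (n + 1) r) : IsShape k n fun p => r (p + 1) where
  le := Nat.le_of_succ_le_succ h.le
  mono p q hpq hq := h.mono _ _ (Nat.succ_le_succ hpq) (Nat.succ_lt_succ hq)
  bound p hp := by simpa using h.bound (p + 1) (Nat.succ_lt_succ hp)

lemma IsShape.col (h : IsShape k (n + 1) r) (hr : ∀ p < k, 0 < r p) :
    IsShape k n fun p => r p - 1 where
  le := by
    rcases Nat.eq_zero_or_pos k with rfl | hk
    · exact n.zero_le
    · have := h.bound 0 hk
      have := hr 0 hk
      omega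
  mono p q hpq hq := Nat.sub_le_sub_right (h.mono p q hpq hq) 1
  bound p hp := by
    have := h.bound p hp
    omega

@[elab_as_elim]
theorem IsShape.induction {P : ∀ (k n : ℕ) (r : ℕ → ℕ), IsShape k n r → Prop}
    (nil : ∀ r h, P 0 0 r h)
    (row : ∀ k n r (h : IsShape (k + 1) (n + 1) r), r 0 = 0 →
      P k n (fun p => r (p + 1)) h.row → P (k + 1) (n + 1) r h)
    (col : ∀ k n r (h : IsShape k (n + 1) r) (hr : ∀ p < k, 0 < r p),
      P k n (fun p => r p - 1) (h.col hr) → P k (n + 1) r h)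
    {k n : ℕ} {r : ℕ → ℕ} (h : IsShape k n r) : P k n r h := by
  induction n generalizing k r with
  | zero =>
    obtain rfl := Nat.le_zero.1 h.le
    exact nil r h
  | succ n ih =>
    by_cases hr : ∀ p < k, 0 < r p
    · exact col k n r h hr (ih _)
    · push Not at hr
      obtain ⟨p, hp, h0⟩ := hr
      obtain ⟨k, rfl⟩ : ∃ m, k = m + 1 := Nat.exists_eq_add_one.2 (Nat.zero_lt_of_lt hp)
      exact row k n r h (Nat.le_zero.1 ((h.mono 0 p p.zero_le hp).trans h0)) (ih _)

lemma length_dotPath (n k : ℕ) (r : ℕ → ℕ) (d : ℕ → ℕ → Bool) : (dotPath n k r d).length = n := by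
  induction n generalizing k r d with
  | zero => rfl
  | succ n ih =>
    rw [dotPath]
    split_ifs <;> rw [List.length_cons, ih]

lemma rowSteps_dotPath (h : IsShape k n r) (d : ℕ → ℕ → Bool) :
    (dotPath n k r d).rowSteps = (List.range k).map fun p => p + r p := by
  induction h using IsShape.induction generalizing d with
  | nil => rfl
  | row k n r _ h0 ih =>
    simp [dotPath_row d h0, DotPath.rowSteps, ih, List.range_succ_eq_map, h0, Nat.add_right_comm]
  | col k n r _ hr ih =>
    rw [dotPath_col d hr, DotPath.rowSteps, ih, List.map_map]
    refine List.map_congr_left fun p hp => ?_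
    have := hr p (List.mem_range.1 hp)
    simp only [Function.comp_apply]
    omega

lemma rows_dotPath (h : IsShape k n r) (d : ℕ → ℕ → Bool) : (dotPath n k r d).rows = k := by
  rw [← DotPath.length_rowSteps, rowSteps_dotPath h, List.length_map, List.length_range]

lemma gapWord_map_range (q k : ℕ) (d : ℕ → Bool) :
    gapWord q ((List.range k).map d) =
      ((List.range k).filter fun p => d p = false).map (· + q) := by
  induction k generalizing q d with
  | zero => rfl
  | succ k ih =>
    cases hd : d 0 <;>
    simp [List.range_succ_eq_map, gapWord, ih, hd, List.filter_map, Function.comp_def,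
      ← Nat.add_assoc, Nat.add_right_comm]

lemma gaps_dotPath (h : IsShape k n r) (d : ℕ → ℕ → Bool) :
    (dotPath n k r d).gaps = (List.range (n - k)).flatMap fun j =>
      (((List.range k).filter fun p => j < r p ∧ d p j = false).map (· + j + 1)).reverse := by
  induction h using IsShape.induction generalizing d with
  | nil => rfl
  | row k n r _ h0 ih =>
    simp [dotPath_row d h0, DotPath.gaps, ih, List.map_flatMap, List.range_succ_eq_map,
      List.filter_map, h0, Function.comp_def, List.map_reverse, Nat.add_right_comm]
  | col k n r h hr ih =>
    rw [dotPath_col d hr, DotPath.gaps, ih, Nat.succ_sub (h.col hr).le, List.range_succ_eq_map,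
      List.flatMap_cons, List.flatMap_map, List.map_flatMap, gapWord_map_range]
    congr 1
    · congr 2
      refine List.filter_congr fun p hp => ?_
      simp [hr p (List.mem_range.1 hp)]
    · simp [Function.comp_def, List.map_reverse, Nat.lt_sub_iff_add_lt, Nat.add_assoc]

lemma braid_dotPath {Γ : Type*} [Group Γ] (s : ℕ → Γ) (h : IsShape k n r) {d : ℕ → ℕ → Bool}
    (hd : ∀ p < k, ∀ j, d p j → j < r p) :
    (dotPath n k r d).braid s = ((List.range (n - k)).reverse.map fun j =>
      tangle s ((List.range k).map fun p => d p j)).prod := by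
  induction h using IsShape.induction generalizing s d with
  | nil => rfl
  | row k n r _ h0 ih =>
    have hrow (j : ℕ) : d 0 j = false :=
      Bool.eq_false_iff.2 fun hj => by simpa [h0] using hd 0 k.succ_pos j hj
    rw [dotPath_row d h0, DotPath.braid, ih _ fun p hp => hd (p + 1) (Nat.succ_lt_succ hp)]
    simp [List.range_succ_eq_map, hrow, tangle, Function.comp_def]
  | col k n r h hr ih =>
    rw [dotPath_col d hr, DotPath.braid,
      ih _ fun p hp j hj => Nat.lt_sub_of_add_lt (hd p hp (j + 1) hj),
      Nat.succ_sub (h.col hr).le, List.range_succ_eq_map]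
    simp [Function.comp_def]

theorem exists_dotPath_eq (h : IsShape k n r) {S : DotPath} (hS : S.Valid)
    (hT : S.map Option.isSome = (dotPath n k r fun _ _ => false).map Option.isSome) :
    ∃ d : ℕ → ℕ → Bool, (∀ p j, d p j → p < k ∧ j < r p) ∧ dotPath n k r d = S := by
  induction h using IsShape.induction generalizing S with
  | nil =>
    obtain rfl := List.map_eq_nil_iff.1 hT
    exact ⟨fun _ _ => false, by simp, rfl⟩
  | row k n r _ h0 ih =>
    rw [dotPath_row _ h0] at hT
    obtain ⟨b, S, rfl, hb, hT'⟩ := List.map_eq_cons_iff.1 hT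
    obtain rfl : b = none := by simpa using hb
    obtain ⟨d, hd, rfl⟩ := ih (S := S) hS hT'
    refine ⟨fun p j => p.casesOn false fun p => d p j, ?_, by rw [dotPath_row _ h0]⟩
    rintro (_ | p) j hj
    · cases hj
    · exact ⟨Nat.succ_lt_succ (hd p j hj).1, (hd p j hj).2⟩
  | col k n r h hr ih =>
    rw [dotPath_col _ hr] at hT
    obtain ⟨b, S, rfl, hb, hT'⟩ := List.map_eq_cons_iff.1 hT
    obtain ⟨bs, rfl⟩ := Option.isSome_iff_exists.1 hb
    obtain ⟨d, hd, rfl⟩ := ih hS.2 hT'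
    have hlen : bs.length = k := by rw [DotPath.length_eq_rows hS, rows_dotPath (h.col hr)]
    refine ⟨fun p j => j.casesOn (bs.getD p false) fun j => d p j, ?_, ?_⟩
    · rintro p (_ | j) hj
      · have hp : p < k := by
          by_contra hp
          simp [List.getD_eq_getElem?_getD, List.getElem?_eq_none (hlen.trans_le (not_lt.1 hp))]
            at hj
        exact ⟨hp, hr p hp⟩
      · exact ⟨(hd p j hj).1, Nat.add_lt_of_lt_sub (hd p j hj).2⟩
    · rw [dotPath_col _ hr]
      congr 2
      refine List.ext_getElem (by simp [hlen]) fun p _ hp => ?_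
      simp [List.getD_eq_getElem?_getD, hp]

end DotPath

section IsLe

variable {n k p q : ℕ} {r : ℕ → ℕ} {d : ℕ → ℕ → Bool}

lemma isLe_succ_iff (h0 : r 0 = 0) :
    IsLe (k + 1) r d ↔ IsLe k (fun p => r (p + 1)) fun p => d (p + 1) := by
  refine ⟨fun h p q i j hpq hq => h _ _ i j (Nat.succ_lt_succ hpq) (Nat.succ_lt_succ hq),
    fun h p q i j hpq hq hij hp hjq hj => ?_⟩
  obtain ⟨q, rfl⟩ := Nat.exists_eq_add_one.2 (Nat.zero_lt_of_lt hpq)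
  cases p with
  | zero => omega
  | succ p => exact h p q i j (by omega) (by omega) hij hp hjq hj

lemma isLe_iff_of_columns : IsLe k r d ↔
    (∀ p q, p < q → q < k → d p 0 → RowCovers (fun p => r p - 1) (fun p j => d p (j + 1)) p q) ∧
      IsLe k (fun p => r p - 1) fun p j => d p (j + 1) := by
  refine ⟨fun h => ⟨fun p q hpq hq hp j hj hjr => ?_, fun p q i j hpq hq hij hp hj hjr => ?_⟩,
    fun h p q i j hpq hq hij hp hj hjr => ?_⟩
  · exact h p q 0 (j + 1) hpq hq j.succ.zero_le hp hj (Nat.add_lt_of_lt_sub hjr)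
  · exact h p q _ _ hpq hq (Nat.succ_le_succ hij) hp hj (Nat.add_lt_of_lt_sub hjr)
  cases j with
  | zero => exact Nat.le_zero.1 hij ▸ hp
  | succ j =>
    cases i with
    | zero => exact h.1 p q hpq hq hp j hj (Nat.lt_sub_of_add_lt hjr)
    | succ i => exact h.2 p q i j hpq hq (by omega) hp hj (Nat.lt_sub_of_add_lt hjr)

lemma rowCovers_iff_of_columns (hp : 0 < r p) : RowCovers r d p q ↔
    (d q 0 → d p 0) ∧ RowCovers (fun p => r p - 1) (fun p j => d p (j + 1)) p q := by
  refine ⟨fun h => ⟨fun hq => h 0 hq hp, fun j hj hjr => h _ hj (Nat.add_lt_of_lt_sub hjr)⟩,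
    fun h j hj hjr => ?_⟩
  cases j with
  | zero => exact h.1 hj
  | succ j => exact h.2 j hj (Nat.lt_sub_of_add_lt hjr)

lemma getD_map_range (f : ℕ → Bool) :
    ((List.range k).map f).getD p false ↔ p < k ∧ f p := by
  by_cases hp : p < k <;> simp [List.getD_eq_getElem?_getD, hp]

lemma true_mem_drop_iff {bs : List Bool} : true ∈ bs.drop p ↔ ∃ q, p ≤ q ∧ bs.getD q false := by
  simp only [List.mem_iff_getElem?, List.getElem?_drop, List.getD_eq_getElem?_getD,
    Option.getD_eq_iff, reduceCtorEq, and_false, or_false]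
  exact ⟨fun ⟨i, hi⟩ => ⟨_, Nat.le_add_right p i, hi⟩,
    fun ⟨q, hq, hbq⟩ => ⟨q - p, by rwa [Nat.add_sub_cancel' hq]⟩⟩

lemma bubbleAscending_iff {c : ℕ} {bs : List Bool} {xs : List ℕ} (hl : bs.length = xs.length)
    (hc : ∀ x ∈ xs, c < x) :
    BubbleAscending c bs xs ↔ ∀ p, bs.getD p false → IsSuffixMin xs p :=
  ⟨fun h _ => h.isSuffixMin, bubbleAscending_of_isSuffixMin hl hc⟩

/-- The path `S` is valid exactly if the dots `d` satisfy the Le condition, and then the suffix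
minima of its values are at the rows that cover all rows below them. This is what is proved by
induction for the path of `d`. -/
structure HasLePath (k : ℕ) (r : ℕ → ℕ) (d : ℕ → ℕ → Bool) (S : DotPath) : Prop where
  valid_iff : S.Valid ↔ IsLe k r d
  isSuffixMin_iff : S.Valid → ∀ p < k,
    (IsSuffixMin S.high p ↔ ∀ q, p < q → q < k → RowCovers r d p q)

lemma HasLePath.row {S : DotPath} (h0 : r 0 = 0)
    (h : HasLePath k (fun p => r (p + 1)) (fun p => d (p + 1)) S) :
    HasLePath (k + 1) r d (none :: S) := by
  refine ⟨h.valid_iff.trans (isLe_succ_iff h0).symm, fun hS p hp => ?_⟩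
  cases p with
  | zero => exact iff_of_true (by simp [DotPath.high, IsSuffixMin]) fun q _ _ j _ hj => by omega
  | succ p =>
    refine isSuffixMin_map_succ.trans ((h.isSuffixMin_iff hS p (by omega)).trans ?_)
    refine ⟨fun hcov q hpq hq => ?_, fun hcov q hpq hq => hcov (q + 1) (by omega) (by omega)⟩
    obtain ⟨q, rfl⟩ := Nat.exists_eq_add_one.2 (Nat.zero_lt_of_lt hpq)
    exact hcov q (by omega) (by omega)

lemma HasLePath.col {S : DotPath} (hr : ∀ p < k, 0 < r p) (hk : S.rows = k)
    (h : HasLePath k (fun p => r p - 1) (fun p j => d p (j + 1)) S) :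
    HasLePath k r d (some ((List.range k).map fun p => d p 0) :: S) := by
  have hdot (hS : S.Valid) :
      BubbleAscending 0 ((List.range k).map fun p => d p 0) (S.high.map (· + 1)) ↔
        ∀ p q, p < q → q < k → d p 0 →
          RowCovers (fun p => r p - 1) (fun p j => d p (j + 1)) p q := by
    rw [bubbleAscending_iff (by simp [DotPath.length_high hS, hk]) (by simp)]
    simp only [getD_map_range, isSuffixMin_map_succ]
    exact ⟨fun hmin p q hpq hq hp =>
        (h.isSuffixMin_iff hS p (hpq.trans hq)).1 (hmin p ⟨hpq.trans hq, hp⟩) q hpq hq,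
      fun hcov p hp => (h.isSuffixMin_iff hS p hp.1).2 fun q hpq hq => hcov p q hpq hq hp.2⟩
  refine ⟨?_, fun ⟨ha, hS⟩ p hp => ?_⟩
  · rw [isLe_iff_of_columns, ← h.valid_iff]
    exact and_congr_left hdot
  · rw [DotPath.high, ha.isSuffixMin_bubbleOut_iff, isSuffixMin_map_succ, h.isSuffixMin_iff hS p hp]
    simp only [getD_map_range, true_mem_drop_iff, rowCovers_iff_of_columns (hr p hp), hp, true_and]
    constructor
    · rintro (hdp | ⟨hcov, hgap⟩) q hpq hq
      · exact ⟨fun _ => hdp, (hdot hS).1 ha p q hpq hq hdp⟩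
      · exact ⟨fun hdq => absurd ⟨q, hpq, hq, hdq⟩ hgap, hcov q hpq hq⟩
    · intro hcov
      by_cases hdp : d p 0
      · exact .inl hdp
      · exact .inr ⟨fun q hpq hq => (hcov q hpq hq).2,
          fun ⟨q, hpq, hq, hdq⟩ => hdp ((hcov q hpq hq).1 hdq)⟩

theorem valid_dotPath_iff (h : IsShape k n r) (d : ℕ → ℕ → Bool) :
    (dotPath n k r d).Valid ↔ IsLe k r d := by
  suffices HasLePath k r d (dotPath n k r d) from this.valid_iff
  induction h using IsShape.induction generalizing d with
  | nil =>
    exact ⟨iff_of_true trivial fun _ _ _ _ _ hq => absurd hq (Nat.not_lt_zero _), by simp⟩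
  | row k n r _ h0 ih =>
    rw [dotPath_row d h0]
    exact (ih _).row h0
  | col k n r h hr ih =>
    rw [dotPath_col d hr]
    exact (ih _).col hr (rows_dotPath (h.col hr) _)

end IsLe

/-! ### Permutations as lists -/

/-- The list of the values of `v⁻¹`. -/
def invWindow {n : ℕ} (v : Perm (Fin n)) : List ℕ := List.ofFn fun c => (v⁻¹ c : ℕ)

/-- Exchange of the entries in positions `p` and `p + 1` of a list; the list is unchanged if it has
no such positions. -/
def swapAt : ℕ → List ℕ → List ℕ
  | 0, x :: y :: l => y :: x :: l
  | p + 1, x :: l => x :: swapAt p l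
  | _, l => l

/-- The action on lists of the product of the simple transpositions `s_p`, `p ∈ w`, where `s_p`
exchanges the entries in positions `p - 1` and `p`. -/
def wordAct (w l : List ℕ) : List ℕ := w.foldr (fun p A => swapAt (p - 1) A) l

section SwapAt

lemma swapAt_append (A B : List ℕ) (x y : ℕ) :
    swapAt A.length (A ++ x :: y :: B) = A ++ y :: x :: B := by
  induction A with
  | nil => rfl
  | cons a A ih => exact congrArg (a :: ·) ih

lemma swapAt_map (f : ℕ → ℕ) (p : ℕ) (l : List ℕ) : swapAt p (l.map f) = (swapAt p l).map f := by
  induction p generalizing l with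
  | zero => rcases l with _ | ⟨x, _ | ⟨y, l⟩⟩ <;> rfl
  | succ p ih => cases l <;> simp [swapAt, ih]

lemma exists_eq_append_cons_cons {l : List ℕ} {p : ℕ} (h : p + 1 < l.length) :
    ∃ A B, A.length = p ∧ l = A ++ l[p] :: l[p + 1] :: B :=
  ⟨l.take p, l.drop (p + 2), List.length_take_of_le (by omega), by
    rw [← List.drop_eq_getElem_cons, ← List.drop_eq_getElem_cons, List.take_append_drop]⟩

lemma getElem?_swapAt {p : ℕ} {l : List ℕ} (h : p + 1 < l.length) (i : ℕ) :
    (swapAt p l)[i]? = l[swap p (p + 1) i]? := by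
  obtain ⟨A, B, rfl, hl⟩ := exists_eq_append_cons_cons h
  rw [hl, swapAt_append, swap_apply_def]
  grind

lemma wordAct_append (w w' l : List ℕ) : wordAct (w ++ w') l = wordAct w (wordAct w' l) :=
  List.foldr_append

lemma wordAct_map_succ {w : List ℕ} (hw : ∀ p ∈ w, 1 ≤ p) (l : List ℕ) :
    wordAct (w.map (· + 1)) (0 :: l.map (· + 1)) = 0 :: (wordAct w l).map (· + 1) := by
  induction w with
  | nil => rfl
  | cons p w ih =>
    obtain ⟨p, rfl⟩ := Nat.exists_eq_add_of_le' (hw p List.mem_cons_self)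
    have ih := ih fun x hx => hw x (List.mem_cons_of_mem _ hx)
    simp only [wordAct, List.map_cons, List.foldr_cons, Nat.add_sub_cancel] at ih ⊢
    rw [ih, swapAt, swapAt_map]

lemma wordAct_gapWord {c : ℕ} {bs : List Bool} {A xs B : List ℕ} (hl : bs.length = xs.length) :
    wordAct (gapWord (A.length + 1) bs).reverse (A ++ c :: (xs ++ B)) =
      A ++ (bubbleOut c bs xs ++ bubbleCarry c bs xs :: B) := by
  induction bs generalizing c xs A with
  | nil => simp [bubbleCarry, bubbleOut, gapWord, wordAct, List.length_eq_zero_iff.1 hl.symm]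
  | cons b bs ih =>
    obtain ⟨x, xs, rfl⟩ := List.exists_cons_of_length_eq_add_one hl.symm
    replace hl : bs.length = xs.length := Nat.succ.inj hl
    cases b with
    | false =>
      have hswap : wordAct [A.length + 1] (A ++ c :: (x :: xs ++ B)) = A ++ x :: c :: (xs ++ B) :=
        swapAt_append A (xs ++ B) c x
      rw [gapWord, List.reverse_cons, wordAct_append, hswap]
      simpa [bubbleOut, bubbleCarry] using ih (c := c) (A := A ++ [x]) hl
    | true => simpa [bubbleOut, bubbleCarry, gapWord] using ih (c := x) (A := A ++ [c]) hl

lemma DotPath.wordAct_gaps {S : DotPath} (h : Valid S) :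
    wordAct (gaps S) (List.range S.length) = high S ++ low S := by
  induction S with
  | nil => rfl
  | cons b S ih =>
    have map_succ (hS : Valid S) : wordAct ((gaps S).map (· + 1)) (List.range (S.length + 1)) =
        0 :: (high S ++ low S).map (· + 1) := by
      rw [List.range_succ_eq_map, ← ih hS]
      exact wordAct_map_succ (fun p hp => (isBraidWord_gaps hS p hp).1) _
    cases b with
    | none => rw [gaps, List.length_cons, map_succ h, List.map_append, high, low, List.cons_append]
    | some bs =>
      rw [gaps, List.length_cons, wordAct_append, map_succ h.2, List.map_append]
      exact wordAct_gapWord (A := []) (by simp [length_eq_rows h, length_high h.2])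

end SwapAt

section InvWindow

variable {n : ℕ}

lemma length_invWindow (v : Perm (Fin n)) : (invWindow v).length = n := List.length_ofFn

lemma getElem_invWindow (v : Perm (Fin n)) {c : ℕ} (h : c < (invWindow v).length) :
    (invWindow v)[c] = v⁻¹ ⟨c, (length_invWindow v).symm ▸ h⟩ := by
  simp [invWindow]

lemma invWindow_injective : Function.Injective (invWindow (n := n)) := fun _ _ h =>
  inv_injective <| Equiv.ext fun c => Fin.ext <| congrFun (List.ofFn_injective h) c

lemma invWindow_one (n : ℕ) : invWindow (1 : Perm (Fin n)) = List.range n := by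
  simp [invWindow, List.ofFn_eq_map, List.map_coe_finRange_eq_range]

lemma nodup_invWindow (v : Perm (Fin n)) : (invWindow v).Nodup :=
  List.nodup_ofFn.2 (Fin.val_injective.comp v⁻¹.injective)

lemma mem_invWindow (v : Perm (Fin n)) {x : ℕ} : x ∈ invWindow v ↔ x < n := by
  rw [invWindow, List.mem_ofFn]
  exact ⟨fun ⟨c, hc⟩ => hc ▸ (v⁻¹ c).2, fun hx => ⟨v ⟨x, hx⟩, by simp⟩⟩

lemma invWindow_perm (v : Perm (Fin n)) : (invWindow v).Perm (List.range n) := by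
  rw [List.perm_ext_iff_of_nodup (nodup_invWindow v) List.nodup_range]
  simp [mem_invWindow]

lemma invWindow_simpleTransposition_mul {p : ℕ} (h1 : 1 ≤ p) (hp : p < n) (v : Perm (Fin n)) :
    invWindow (simpleTransposition n p * v) = swapAt (p - 1) (invWindow v) := by
  obtain ⟨p, rfl⟩ := Nat.exists_eq_add_of_le' h1
  refine List.ext_getElem? fun i => ?_
  rw [Nat.add_sub_cancel, getElem?_swapAt (by rwa [length_invWindow])]
  simp only [invWindow, List.getElem?_ofFn, simpleTransposition, dif_pos (And.intro h1 hp),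
    mul_inv_rev, swap_inv, Perm.mul_apply, swap_apply_def, Fin.mk.injEq, Nat.add_sub_cancel]
  split_ifs <;> first | rfl | omega

lemma invWindow_prod {w : List ℕ} (h : IsBraidWord n w) :
    invWindow (w.map (simpleTransposition n)).prod = wordAct w (List.range n) := by
  induction w with
  | nil => exact invWindow_one n
  | cons p w ih =>
    obtain ⟨hp, hw⟩ := List.forall_mem_cons.1 h
    rw [List.map_cons, List.prod_cons, invWindow_simpleTransposition_mul hp.1 hp.2, ih hw]
    rfl

end InvWindow

section Length

variable {n : ℕ} {v : Perm (Fin n)}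

lemma permLength_one : permLength (1 : Perm (Fin n)) = 0 := by
  simp only [permLength, Finset.card_eq_zero, Finset.filter_eq_empty_iff]
  exact fun p _ h => h.1.not_gt h.2

lemma permLength_simpleTransposition_mul_le {p : ℕ} (h1 : 1 ≤ p) (hp : p < n)
    (v : Perm (Fin n)) : permLength (simpleTransposition n p * v) ≤ permLength v + 1 := by
  refine (Finset.card_le_card (t := insert (v⁻¹ ⟨p - 1, by omega⟩, v⁻¹ ⟨p, hp⟩) _) ?_).trans
    (Finset.card_insert_le _ _)
  rintro ⟨i, j⟩ hij
  simp only [simpleTransposition, h1, hp, and_self, dif_pos, Finset.mem_filter, Finset.mem_univ,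
    true_and, Perm.mul_apply, swap_apply_def, Finset.mem_insert, Prod.mk.injEq,
    Perm.eq_inv_iff_eq] at hij ⊢
  grind

lemma permLength_simpleTransposition_mul_le_of_lt {p : ℕ} (h1 : 1 ≤ p) (hp : p < n)
    (h : v⁻¹ ⟨p, hp⟩ < v⁻¹ ⟨p - 1, by omega⟩) :
    permLength (simpleTransposition n p * v) ≤ permLength v := by
  refine Finset.card_le_card ?_
  rintro ⟨i, j⟩ hij
  simp only [simpleTransposition, h1, hp, and_self, dif_pos, Finset.mem_filter, Finset.mem_univ,
    true_and, Perm.mul_apply, swap_apply_def] at hij ⊢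
  have hne : v i ≠ v j := fun h => hij.1.ne (v.injective h)
  have hc : ¬ (v i = ⟨p - 1, by omega⟩ ∧ v j = ⟨p, hp⟩) := by
    rintro ⟨hi, hj⟩
    rw [← hi, ← hj, Perm.coe_inv, symm_apply_apply, symm_apply_apply] at h
    exact h.not_gt hij.1
  grind

lemma permLength_prod_le {a : List ℕ} (h : IsBraidWord n a) :
    permLength (a.map (simpleTransposition n)).prod ≤ a.length := by
  induction a with
  | nil => exact permLength_one.le
  | cons p a ih =>
    obtain ⟨hp, ha⟩ := List.forall_mem_cons.1 h
    rw [List.map_cons, List.prod_cons, List.length_cons]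
    exact (permLength_simpleTransposition_mul_le hp.1 hp.2 _).trans (Nat.succ_le_succ (ih ha))

lemma IsReducedWord.tail {p : ℕ} {a : List ℕ} (h : IsReducedWord v (p :: a)) :
    IsReducedWord (a.map (simpleTransposition n)).prod a := by
  obtain ⟨hl, rfl, hlen⟩ := h
  obtain ⟨hp, ha⟩ := List.forall_mem_cons.1 hl
  refine ⟨ha, rfl, (permLength_prod_le ha).antisymm' ?_⟩
  exact Nat.le_of_succ_le_succ (hlen.trans_le (permLength_simpleTransposition_mul_le hp.1 hp.2 _))

lemma IsReducedWord.inv_lt_inv {p : ℕ} {a : List ℕ} (h : IsReducedWord v (p :: a)) :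
    (a.map (simpleTransposition n)).prod⁻¹ ⟨p - 1, by have := h.1 p; grind⟩ <
      (a.map (simpleTransposition n)).prod⁻¹ ⟨p, by have := h.1 p; grind⟩ := by
  have hlen := h.tail.2.2
  obtain ⟨hl, rfl, hlen'⟩ := h
  obtain ⟨h1, hp⟩ := hl p List.mem_cons_self
  rw [List.map_cons, List.prod_cons, List.length_cons, hlen] at hlen'
  set v := (a.map (simpleTransposition n)).prod
  refine lt_of_le_of_ne (not_lt.1 fun hlt => ?_) fun heq => ?_
  · have := permLength_simpleTransposition_mul_le_of_lt h1 hp hlt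
    omega
  · have := Fin.ext_iff.1 (v⁻¹.injective heq)
    dsimp only at this
    omega

theorem IsReducedWord.ascentWord_mul {Γ : Type*} [Monoid Γ] {s : ℕ → Γ} (hs : IsBraidSequence n s)
    {a : List ℕ} (h : IsReducedWord v a) :
    wordEval s (ascentWord n (invWindow v)) * wordEval s a = wordEval s (halfTwistWord n) := by
  induction a generalizing v with
  | nil =>
    obtain ⟨-, rfl, -⟩ := h
    rw [List.map_nil, List.prod_nil, invWindow_one, ascentWord_range, wordEval_nil, mul_one]
  | cons p a ih =>
    have hasc := h.inv_lt_inv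
    obtain ⟨h1, hp⟩ := h.1 p List.mem_cons_self
    rw [← ih h.tail, ← h.2.1, List.map_cons, List.prod_cons,
      invWindow_simpleTransposition_mul h1 hp, wordEval_cons, ← mul_assoc]
    set v := (a.map (simpleTransposition n)).prod
    obtain ⟨p, rfl⟩ := Nat.exists_eq_add_of_le' h1
    have hlen : p + 1 < (invWindow v).length := by rwa [length_invWindow]
    have hnd := nodup_invWindow v
    have hn := length_invWindow v
    obtain ⟨A, B, rfl, hv⟩ := exists_eq_append_cons_cons hlen
    rw [getElem_invWindow, getElem_invWindow] at hv
    rw [hv] at hnd hn ⊢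
    rw [Nat.add_sub_cancel, swapAt_append]
    congr 1
    exact (hs.ascentWord_swap hasc (fun x hx => (mem_invWindow v).1 (hv ▸ hx)) hnd hn.le).symm

lemma permLength_mul_swap_le {i j : Fin n} (hij : i < j) (hv : v j < v i) :
    permLength (v * swap i j) ≤ permLength v := by
  let φ : Fin n × Fin n → Fin n × Fin n := fun p =>
    if swap i j p.1 < swap i j p.2 then (swap i j p.1, swap i j p.2) else p
  have hφ : Set.LeftInvOn φ φ {p | p.1 < p.2} := fun p (hp : p.1 < p.2) => by
    by_cases h : swap i j p.1 < swap i j p.2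
    · simp [φ, h, hp]
    · simp [φ, h]
  refine Finset.card_le_card_of_injOn φ ?_ (hφ.injOn.mono fun p hp => ?_)
  · rintro ⟨a, b⟩ hab
    obtain ⟨hab, hvab⟩ := (Finset.mem_filter.1 (Finset.mem_coe.1 hab)).2
    refine Finset.mem_coe.2 (Finset.mem_filter.2 ⟨Finset.mem_univ _, ?_⟩)
    simp only [φ, Perm.mul_apply] at hab hvab ⊢
    by_cases h : swap i j a < swap i j b
    · rw [if_pos h]
      exact ⟨h, hvab⟩
    · rw [if_neg h]
      simp only [swap_apply_def] at hvab h
      grind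
  · exact (Finset.mem_filter.1 (Finset.mem_coe.1 hp)).2.1

lemma lt_of_permLength_lt {i j : Fin n} (hij : i < j)
    (h : permLength v < permLength (v * swap i j)) : v i < v j :=
  lt_of_le_of_ne (not_lt.1 fun hv => h.not_ge (permLength_mul_swap_le hij hv))
    fun hv => hij.ne (v.injective hv)

lemma mem_take_invWindow (v : Perm (Fin n)) (x : Fin n) (t : ℕ) :
    (x : ℕ) ∈ (invWindow v).take t ↔ (v x : ℕ) < t := by
  simp only [List.mem_take_iff_getElem, getElem_invWindow, length_invWindow, lt_min_iff]
  constructor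
  · rintro ⟨c, hc, hcx⟩
    rw [← Perm.inv_eq_iff_eq.1 (Fin.ext hcx)]
    exact hc.1
  · exact fun h => ⟨v x, ⟨h, (v x).2⟩, by simp⟩

lemma invWindow_mul_swap (v : Perm (Fin n)) (i j : Fin n) :
    invWindow (v * swap i j) = (invWindow v).map (swap (i : ℕ) j) := by
  simp only [invWindow, List.map_ofFn, mul_inv_rev, swap_inv]
  congr 1
  funext c
  simp only [Perm.mul_apply, Function.comp_apply, swap_apply_def, Fin.ext_iff]
  split_ifs <;> rfl

lemma prefixCountLE_invWindow_mul_swap {i j : Fin n} (hij : i < j) (hv : v i < v j) :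
    PrefixCountLE (invWindow (v * swap i j)) (invWindow v) := by
  intro t M
  have hi := mem_take_invWindow v i t
  have hj := mem_take_invWindow v j t
  have hnd := (nodup_invWindow v).sublist (List.take_sublist t _)
  rw [invWindow_mul_swap, ← List.map_take]
  generalize (invWindow v).take t = l at *
  by_cases hjl : (j : ℕ) ∈ l
  · have hil : (i : ℕ) ∈ l := hi.2 (lt_trans hv (hj.1 hjl))
    have hmem : ∀ x ∈ l, swap (i : ℕ) j x ∈ l := fun x hx => by
      rw [swap_apply_def]
      split_ifs <;> assumption
    refine (List.Perm.countP_eq _ ?_).le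
    rw [List.perm_ext_iff_of_nodup (hnd.map (swap _ _).injective) hnd]
    exact fun x => ⟨fun hx => by obtain ⟨y, hy, rfl⟩ := List.mem_map.1 hx; exact hmem y hy,
      fun hx => List.mem_map.2 ⟨_, hmem x hx, swap_apply_self _ _ _⟩⟩
  · rw [List.countP_map]
    refine List.countP_mono_left fun x hx h => ?_
    simp only [Function.comp_apply, decide_eq_true_eq, swap_apply_def] at h ⊢
    grind

lemma BruhatLE.prefixCountLE {u w : Perm (Fin n)} (h : BruhatLE u w) :
    PrefixCountLE (invWindow w) (invWindow u) := by
  induction h with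
  | refl => exact fun _ _ => le_rfl
  | tail _ h ih =>
    obtain ⟨i, j, rfl, hlt⟩ := h
    refine fun t M => le_trans ?_ (ih t M)
    rcases lt_trichotomy i j with hij | rfl | hij
    · exact prefixCountLE_invWindow_mul_swap hij (lt_of_permLength_lt hij hlt) t M
    · exact absurd hlt (by rw [swap_self]; exact lt_irrefl _)
    · rw [swap_comm] at hlt ⊢
      exact prefixCountLE_invWindow_mul_swap hij (lt_of_permLength_lt hij hlt) t M

end Length

section Grassmannian

namespace DotPath

lemma pairwise_rowSteps (S : DotPath) : (rowSteps S).Pairwise (· < ·) := by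
  induction S with
  | nil => exact List.Pairwise.nil
  | cons b S ih => cases b <;> simp [rowSteps, List.pairwise_map, ih]

lemma pairwise_colSteps (S : DotPath) : (colSteps S).Pairwise (· < ·) := by
  induction S with
  | nil => exact List.Pairwise.nil
  | cons b S ih => cases b <;> simp [colSteps, List.pairwise_map, ih]

end DotPath

variable {n k : ℕ} {w : Perm (Fin n)}

/-- The length of row `p` of the Young diagram of `w`, where `p` is counted from the top. -/
def topRowLength (k : ℕ) (w : Perm (Fin n)) (p : ℕ) : ℕ := rowLength k w (k - 1 - p)

lemma IsGrassmannian.inv_add_le (h : IsGrassmannian k w) {i j : ℕ} (hij : i ≤ j) (hj : j < k)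
    (hjn : j < n) : (w⁻¹ ⟨i, hij.trans_lt hjn⟩ : ℕ) + (j - i) ≤ w⁻¹ ⟨j, hjn⟩ := by
  induction j, hij using Nat.le_induction with
  | base => simp
  | succ j hij ih =>
    have ih := ih (by omega) (by omega)
    have hlt : (w⁻¹ ⟨j, by omega⟩ : ℕ) < w⁻¹ ⟨j + 1, hjn⟩ :=
      h _ _ (Fin.mk_lt_mk.2 j.lt_succ_self) (Or.inl hj)
    omega

lemma IsGrassmannian.add_topRowLength (hkn : k ≤ n) (h : IsGrassmannian k w) {p : ℕ} (hp : p < k) :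
    p + topRowLength k w p = w⁻¹ ⟨p, hp.trans_le hkn⟩ := by
  have := h.inv_add_le p.zero_le hp (hp.trans_le hkn)
  simp only [topRowLength, rowLength, dif_pos (show k - 1 - p < k ∧ k ≤ n by omega),
    show k - 1 - (k - 1 - p) = p by omega]
  omega

lemma IsGrassmannian.isShape (hkn : k ≤ n) (h : IsGrassmannian k w) :
    IsShape k n (topRowLength k w) where
  le := hkn
  mono p q hpq hq := by
    have := h.add_topRowLength hkn hq
    have := h.add_topRowLength hkn (hpq.trans_lt hq)
    have := h.inv_add_le hpq hq (hq.trans_le hkn)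
    omega
  bound p hp := by
    have := h.add_topRowLength hkn hp
    have := h.inv_add_le (i := p) (j := k - 1) (by omega) (by omega) (by omega)
    have := (w⁻¹ ⟨k - 1, by omega⟩).2
    omega

lemma IsGrassmannian.invWindow_eq (hkn : k ≤ n) (h : IsGrassmannian k w) (d : ℕ → ℕ → Bool) :
    invWindow w = (dotPath n k (topRowLength k w) d).rowSteps ++
      (dotPath n k (topRowLength k w) d).colSteps := by
  set S := dotPath n k (topRowLength k w) d with hS
  have htake : (invWindow w).take k = S.rowSteps := by
    rw [hS, rowSteps_dotPath (h.isShape hkn)]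
    refine List.ext_getElem (by simp [length_invWindow, hkn]) fun p hp _ => ?_
    have hpk : p < k := (List.length_take_le _ _).trans_lt' hp
    rw [List.getElem_take, getElem_invWindow, List.getElem_map, List.getElem_range,
      h.add_topRowLength hkn hpk]
  have hperm : ((invWindow w).drop k).Perm S.colSteps := by
    rw [← List.perm_append_left_iff S.rowSteps, ← htake, List.take_append_drop, htake]
    have := S.rowSteps_append_colSteps_perm
    rw [hS, length_dotPath] at this
    exact (invWindow_perm w).trans this.symm
  have hsorted : ((invWindow w).drop k).Pairwise (· < ·) := by
    rw [List.pairwise_iff_getElem]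
    intro i j _ _ hij
    rw [List.getElem_drop, List.getElem_drop, getElem_invWindow, getElem_invWindow]
    exact h _ _ (Fin.mk_lt_mk.2 (Nat.add_lt_add_left hij k)) (Or.inr (Nat.le_add_right k i))
  rw [← List.take_append_drop k (invWindow w), htake]
  congr 1
  exact hperm.eq_of_pairwise (fun _ _ _ _ hab hba => absurd hba hab.not_gt) hsorted
    S.pairwise_colSteps

end Grassmannian

/-! ### The juggling braid of a path -/

section Arcs

lemma count_congr {p q : ℕ → Prop} [DecidablePred p] [DecidablePred q] {n : ℕ}
    (h : ∀ x < n, p x ↔ q x) : Nat.count p n = Nat.count q n :=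
  List.countP_congr fun x hx => by simpa using h x (List.mem_range.1 hx)

lemma card_filter_fin {n : ℕ} (p : ℕ → Prop) [DecidablePred p] :
    (Finset.univ.filter fun x : Fin n => p x).card = Nat.count p n := by
  rw [Nat.count_eq_card_filter_range, ← Finset.card_map Fin.valEmbedding]
  congr 1
  ext x
  simp only [Finset.mem_map, Finset.mem_filter, Finset.mem_univ, true_and, Fin.valEmbedding_apply,
    Finset.mem_range]
  exact ⟨fun ⟨a, ha, e⟩ => e ▸ ⟨a.2, ha⟩, fun ⟨hx, hp⟩ => ⟨⟨x, hx⟩, hp, rfl⟩⟩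

lemma range_eq_append_cons {c n : ℕ} (hc : c < n) :
    List.range n = List.range c ++ c :: List.range' (c + 1) (n - c - 1) := by
  rw [List.range_eq_range', List.range_eq_range', ← List.range'_succ,
    show n = c + (n - c - 1 + 1) by omega, ← List.range'_append]
  simp

/-- The interval word of the arc from `f i` to `i`, for a function on `{0, …, n - 1}`. -/
def intervalWord (n : ℕ) (f : ℕ → ℕ) (i : ℕ) : List ℕ :=
  descWord (1 + Nat.count (fun x => x < i ∧ f i < f x) n)
    (Nat.count (fun x => i < x ∧ x < f i ∧ f i < f x) n)

/-- The interval word of the arcs with right end `m`. -/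
def endWord (n : ℕ) (f : ℕ → ℕ) (m : ℕ) : List ℕ :=
  ((List.range n).filter fun i => f i = m).flatMap (intervalWord n f)

/-- The arcs of `f` that do not start at `0`, with all ends moved down by one. This is meant for
functions that do not vanish at positive arguments. -/
def arcTail (f : ℕ → ℕ) (i : ℕ) : ℕ := f (i + 1) - 1

variable {n : ℕ} {f : ℕ → ℕ}

lemma injOn_arcTail (h : ∀ i < n, 1 ≤ f (i + 1)) (hf : Set.InjOn f (Set.Iio (n + 1))) :
    Set.InjOn (arcTail f) (Set.Iio n) := fun i hi j hj e => by
  have hi' := h i hi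
  have hj' := h j hj
  have := hf (x₁ := i + 1) (x₂ := j + 1) (Set.mem_Iio.2 (Nat.succ_lt_succ hi))
    (Set.mem_Iio.2 (Nat.succ_lt_succ hj)) (by simp only [arcTail] at e; omega)
  omega

lemma intervalWord_succ {i : ℕ} (h : 1 ≤ f (i + 1)) :
    intervalWord (n + 1) f (i + 1) =
      if f (i + 1) < f 0 then (intervalWord n (arcTail f) i).map (· + 1)
      else intervalWord n (arcTail f) i := by
  have enclosing : Nat.count (fun x => x + 1 < i + 1 ∧ f (i + 1) < f (x + 1)) n =
      Nat.count (fun x => x < i ∧ arcTail f i < arcTail f x) n :=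
    count_congr fun x _ => by simp only [arcTail]; omega
  have crossing :
      Nat.count (fun x => i + 1 < x + 1 ∧ x + 1 < f (i + 1) ∧ f (i + 1) < f (x + 1)) n =
        Nat.count (fun x => i < x ∧ x < arcTail f i ∧ arcTail f i < arcTail f x) n :=
    count_congr fun x _ => by simp only [arcTail]; omega
  rw [intervalWord, Nat.count_succ', Nat.count_succ', enclosing, crossing, intervalWord,
    descWord_map_succ]
  simp only [Nat.zero_lt_succ, true_and, Nat.not_lt_zero, false_and, if_false, Nat.add_zero]
  split_ifs <;> rfl

lemma endWord_eq_nil {m : ℕ} (h : ∀ x < n, f x ≠ m) : endWord n f m = [] := by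
  rw [endWord, List.filter_eq_nil_iff.2, List.flatMap_nil]
  simpa using h

lemma endWord_succ (h : ∀ i < n, 1 ≤ f (i + 1)) {m : ℕ} (hm : f 0 ≠ m + 1) :
    endWord (n + 1) f (m + 1) =
      if m + 1 < f 0 then (endWord n (arcTail f) m).map (· + 1) else endWord n (arcTail f) m := by
  have starts : ((List.range n).filter fun i => f (i + 1) = m + 1) =
      (List.range n).filter fun i => arcTail f i = m :=
    List.filter_congr fun i hi => by
      have := h i (List.mem_range.1 hi)
      rw [decide_eq_decide, arcTail]
      omega
  have intervals : ∀ i ∈ (List.range n).filter fun i => arcTail f i = m,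
      intervalWord (n + 1) f (i + 1) =
        if m + 1 < f 0 then (intervalWord n (arcTail f) i).map (· + 1)
        else intervalWord n (arcTail f) i := fun i hi => by
    rw [List.mem_filter, List.mem_range, decide_eq_true_eq, arcTail] at hi
    have := h i hi.1
    rw [intervalWord_succ this, show f (i + 1) = m + 1 by omega]
  rw [endWord, List.range_succ_eq_map, List.filter_cons_of_neg (by simpa using hm),
    List.filter_map, List.flatMap_map]
  simp only [Function.comp_def, Nat.succ_eq_add_one]
  rw [starts, List.flatMap_congr intervals, endWord, List.map_flatMap]
  split_ifs <;> rfl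

lemma endWord_zero (h : ∀ i < n, 1 ≤ f (i + 1)) : endWord (n + 1) f 0 = [] := by
  rw [endWord, List.flatMap_eq_nil_iff]
  intro i hi
  simp only [List.mem_filter, List.mem_range, decide_eq_true_eq] at hi
  obtain rfl : i = 0 := by
    cases i with
    | zero => rfl
    | succ i => have := h i (by omega); omega
  rw [intervalWord, hi.2, Nat.count_of_forall_not (p := fun x => 0 < x ∧ x < 0 ∧ 0 < f x)
    (by simp), descWord_zero]

lemma endWord_start {c : ℕ} (h0 : f 0 = c + 1) (hne : ∀ x < n, f (x + 1) ≠ c + 1) :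
    endWord (n + 1) f (c + 1) =
      descWord 1 (Nat.count (fun x => x < c ∧ c ≤ arcTail f x) n) := by
  have starts : ((List.range n).map Nat.succ).filter (fun i => f i = c + 1) = [] := by
    simp only [List.filter_eq_nil_iff, List.mem_map, List.mem_range]
    rintro _ ⟨i, hi, rfl⟩
    simpa using hne i hi
  have crossing : Nat.count (fun x => 0 < x ∧ x < f 0 ∧ f 0 < f x) (n + 1) =
      Nat.count (fun x => x < c ∧ c ≤ arcTail f x) n := by
    rw [Nat.count_succ', if_neg (by omega), Nat.add_zero]
    refine count_congr fun x hx => ?_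
    have := hne x hx
    simp only [arcTail]
    omega
  rw [endWord, List.range_succ_eq_map, List.filter_cons_of_pos (by simp [h0]), starts,
    List.flatMap_singleton, intervalWord, crossing,
    Nat.count_of_forall_not (p := fun x => x < 0 ∧ f 0 < f x) (by simp)]

lemma arcs_succ (h : ∀ i < n, 1 ≤ f (i + 1)) :
    (List.range (n + 1)).reverse.flatMap (endWord (n + 1) f) =
      (List.range n).reverse.flatMap fun m => endWord (n + 1) f (m + 1) := by
  rw [List.range_succ_eq_map, List.reverse_cons, List.flatMap_append, ← List.map_reverse,
    List.flatMap_map, List.flatMap_singleton, endWord_zero h, List.append_nil]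

lemma arcs_succ_of_le (h : ∀ i < n, 1 ≤ f (i + 1)) (h0 : n + 1 ≤ f 0) :
    (List.range (n + 1)).reverse.flatMap (endWord (n + 1) f) =
      ((List.range n).reverse.flatMap (endWord n (arcTail f))).map (· + 1) := by
  rw [arcs_succ h, List.map_flatMap]
  refine List.flatMap_congr fun m hm => ?_
  simp only [List.mem_reverse, List.mem_range] at hm
  rw [endWord_succ h (by omega), if_pos (by omega)]

lemma arcs_succ_of_eq_zero (h : ∀ i < n, 1 ≤ f (i + 1)) (h0 : f 0 = 0) :
    (List.range (n + 1)).reverse.flatMap (endWord (n + 1) f) =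
      (List.range n).reverse.flatMap (endWord n (arcTail f)) := by
  rw [arcs_succ h]
  refine List.flatMap_congr fun m _ => ?_
  rw [endWord_succ h (by omega), if_neg (by omega)]

lemma arcs_succ_of_eq_succ (h : ∀ i < n, 1 ≤ f (i + 1)) (hf : Set.InjOn f (Set.Iio (n + 1)))
    {c : ℕ} (hc : c < n) (h0 : f 0 = c + 1) :
    ∃ A : List ℕ,
      (List.range n).reverse.flatMap (endWord n (arcTail f)) =
        A ++ (List.range c).reverse.flatMap (endWord n (arcTail f)) ∧
      (List.range (n + 1)).reverse.flatMap (endWord (n + 1) f) =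
        A ++ descWord 1 (Nat.count (fun x => x < c ∧ c ≤ arcTail f x) n) ++
          ((List.range c).reverse.flatMap (endWord n (arcTail f))).map (· + 1) := by
  have hne : ∀ x < n, f (x + 1) ≠ c + 1 := fun x hx e => by
    simpa using hf (Set.mem_Iio.2 (Nat.succ_lt_succ hx)) (Set.mem_Iio.2 n.succ_pos)
      (e.trans h0.symm)
  have hnil : endWord n (arcTail f) c = [] := endWord_eq_nil fun x hx => by
    have := hne x hx
    have := h x hx
    simp only [arcTail]
    omega
  have hrange : (List.range n).reverse =
      (List.range' (c + 1) (n - c - 1)).reverse ++ c :: (List.range c).reverse := by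
    simp [range_eq_append_cons hc]
  have above : (List.range' (c + 1) (n - c - 1)).reverse.flatMap
        (fun m => endWord (n + 1) f (m + 1)) =
      (List.range' (c + 1) (n - c - 1)).reverse.flatMap (endWord n (arcTail f)) :=
    List.flatMap_congr fun m hm => by
      simp only [List.mem_reverse, List.mem_range'_1] at hm
      rw [endWord_succ h (by omega), if_neg (by omega)]
  have below : (List.range c).reverse.flatMap (fun m => endWord (n + 1) f (m + 1)) =
      ((List.range c).reverse.flatMap (endWord n (arcTail f))).map (· + 1) := by
    rw [List.map_flatMap]
    refine List.flatMap_congr fun m hm => ?_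
    simp only [List.mem_reverse, List.mem_range] at hm
    rw [endWord_succ h (by omega), if_pos (by omega)]
  refine ⟨(List.range' (c + 1) (n - c - 1)).reverse.flatMap (endWord n (arcTail f)), ?_, ?_⟩
  · rw [hrange, List.flatMap_append, List.flatMap_cons, hnil, List.nil_append]
  · rw [arcs_succ h, hrange, List.flatMap_append, List.flatMap_cons, above, below,
      endWord_start h0 hne, List.append_assoc]

lemma crossing_count_lt {i : ℕ} (hi : i < n) (hif : i < f i) :
    Nat.count (fun x => x < i ∧ f i < f x) n +
      Nat.count (fun x => i < x ∧ x < f i ∧ f i < f x) n <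
      Nat.count (fun x => x < f i ∧ f i ≤ f x) n := by
  simp only [Nat.count_eq_card_filter_range]
  rw [← Finset.card_union_of_disjoint]
  · refine Finset.card_lt_card (Finset.ssubset_iff_of_subset (fun x hx => ?_) |>.2 ⟨i, ?_, ?_⟩)
    · simp only [Finset.mem_union, Finset.mem_filter, Finset.mem_range] at hx ⊢
      omega
    · simp [hi, hif]
    · simp
  · rw [Finset.disjoint_left]
    intro x hx hx'
    simp only [Finset.mem_filter] at hx hx'
    omega

lemma lt_of_mem_endWord {m x : ℕ} (hx : x ∈ endWord n f m) :
    1 ≤ x ∧ x < Nat.count (fun x => x < m ∧ m ≤ f x) n := by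
  simp only [endWord, List.mem_flatMap, List.mem_filter, List.mem_range, decide_eq_true_eq] at hx
  obtain ⟨i, ⟨hi, rfl⟩, hx⟩ := hx
  rw [intervalWord, mem_descWord] at hx
  have hif : i < f i := by
    obtain ⟨y, -, hy⟩ := Nat.count_ne_iff_exists.1
      (show Nat.count (fun x => i < x ∧ x < f i ∧ f i < f x) n ≠ 0 by omega)
    omega
  have := crossing_count_lt hi hif
  omega

end Arcs

section ArcsOfPath

lemma bubbleCarry_eq_zero_iff {bs : List Bool} {xs : List ℕ} (hl : bs.length = xs.length)
    (h0 : ∀ x ∈ xs, 1 ≤ x) : bubbleCarry 0 bs xs = 0 ↔ true ∉ bs := by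
  induction bs generalizing xs with
  | nil => simp [bubbleCarry]
  | cons b bs ih =>
    obtain ⟨x, xs, rfl⟩ := List.exists_cons_of_length_eq_add_one hl.symm
    have hl' : bs.length = xs.length := by simpa using hl
    cases b with
    | false => simpa [bubbleCarry] using ih hl' fun y hy => h0 y (List.mem_cons_of_mem x hy)
    | true =>
      have hmem : bubbleCarry x bs xs ∈ x :: xs := (bubble_perm hl').mem_iff.1 (by simp)
      have := h0 _ hmem
      simp only [bubbleCarry, List.mem_cons, true_or, not_true_eq_false, iff_false]
      omega

namespace DotPath

/-- The arcs of `f` are those of the juggling diagram of the path: the arcs that start at the places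
of the row steps end beyond the window, and those that start at the places of the column steps end
at the letters `low`. -/
def HasArcs (S : DotPath) (f : ℕ → ℕ) : Prop :=
  (∀ i ∈ rowSteps S, S.length ≤ f i) ∧ (colSteps S).map f = low S

/-- The number of columns without dots. -/
def emptyCols : DotPath → ℕ
  | [] => 0
  | none :: S => emptyCols S
  | some bs :: S => emptyCols S + if true ∈ bs then 0 else 1

variable {S : DotPath} {f : ℕ → ℕ} {bs : List Bool} {b : Option (List Bool)}

lemma HasArcs.le_zero (h : HasArcs (none :: S) f) : S.length + 1 ≤ f 0 := h.1 0 (by simp [rowSteps])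

lemma HasArcs.zero_eq (h : HasArcs (some bs :: S) f) :
    f 0 = bubbleCarry 0 bs ((high S).map (· + 1)) := by
  simpa [colSteps, low] using (List.cons.inj h.2).1

lemma HasArcs.succ (h : HasArcs (b :: S) f) :
    (∀ i ∈ rowSteps S, S.length + 1 ≤ f (i + 1)) ∧
      (colSteps S).map (fun i => f (i + 1)) = (low S).map (· + 1) := by
  obtain ⟨hr, hc⟩ := h
  cases b with
  | none =>
    exact ⟨fun i hi => hr _ (by simp [rowSteps, hi]), by
      simpa [colSteps, low, Function.comp_def] using hc⟩
  | some bs =>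
    exact ⟨fun i hi => hr _ (by simp [rowSteps, hi]), by
      simpa [colSteps, low, Function.comp_def] using (List.cons.inj hc).2⟩

lemma HasArcs.one_le (h : HasArcs (b :: S) f) : ∀ i < S.length, 1 ≤ f (i + 1) := fun i hi => by
  have hi' : i ∈ rowSteps S ++ colSteps S :=
    (rowSteps_append_colSteps_perm S).mem_iff.2 (List.mem_range.2 hi)
  rcases List.mem_append.1 hi' with hr | hc
  · have := h.succ.1 i hr
    omega
  · have hmem : f (i + 1) ∈ (low S).map (· + 1) := h.succ.2 ▸ List.mem_map_of_mem hc
    obtain ⟨z, -, hz⟩ := List.mem_map.1 hmem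
    omega

lemma HasArcs.tail (h : HasArcs (b :: S) f) : HasArcs S (arcTail f) := by
  refine ⟨fun i hi => Nat.le_sub_one_of_lt (h.succ.1 i hi), ?_⟩
  calc (colSteps S).map (arcTail f)
    _ = ((colSteps S).map fun i => f (i + 1)).map (· - 1) := by rw [List.map_map]; rfl
    _ = low S := by simp [h.succ.2, Function.comp_def]

lemma count_fixed (hS : Valid S) (h : HasArcs S f) :
    Nat.count (fun i => f i = i) S.length = emptyCols S := by
  induction S generalizing f with
  | nil => rfl
  | cons b S ih =>
    have step (hS : Valid S) : Nat.count (fun i => f i = i) (S.length + 1) =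
        emptyCols S + if f 0 = 0 then 1 else 0 := by
      rw [← ih hS h.tail, Nat.count_succ']
      congr 1
      refine count_congr fun x hx => ?_
      have := h.one_le x hx
      simp only [arcTail]
      omega
    cases b with
    | none => simp [step hS, emptyCols, (Nat.succ_pos _).trans_le h.le_zero |>.ne']
    | some bs =>
      have := bubbleCarry_eq_zero_iff (bs := bs) (xs := (high S).map (· + 1))
        (by simp [hS.1.length_eq]) (by simp)
      rw [List.length_cons, step hS.2, emptyCols, h.zero_eq, if_congr this rfl rfl, ite_not]

lemma count_arcs (hS : Valid S) (h : HasArcs S f) {m : ℕ} (hm : m ≤ S.length) :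
    Nat.count (fun x => x < m ∧ m ≤ f x) S.length = (high S).countP (· < m) := by
  induction S generalizing f m with
  | nil => simp [high]
  | cons b S ih =>
    cases m with
    | zero => simp [Nat.count_of_forall_not]
    | succ m =>
      have hm' : m ≤ S.length := Nat.le_of_succ_le_succ hm
      have step (hS : Valid S) :
          Nat.count (fun x => x < m + 1 ∧ m + 1 ≤ f x) (S.length + 1) =
            (high S).countP (· < m) + if m + 1 ≤ f 0 then 1 else 0 := by
        rw [← ih hS h.tail hm', Nat.count_succ']
        simp only [Nat.zero_lt_succ, true_and]
        congr 1
        refine count_congr fun x hx => ?_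
        have := h.one_le x hx
        simp only [arcTail]
        omega
      cases b with
      | none =>
        have := h.le_zero
        rw [List.length_cons, step hS, high, List.countP_cons, countP_map_succ,
          if_pos (by omega)]
        simp
      | some bs =>
        have hperm := (bubble_perm (c := 0) hS.1.length_eq).countP_eq (· < m + 1)
        rw [List.countP_cons, List.countP_cons, countP_map_succ, ← h.zero_eq] at hperm
        rw [List.length_cons, step hS.2, high]
        simp only [decide_eq_true_eq, Nat.zero_lt_succ, if_true] at hperm
        split_ifs at hperm ⊢ <;> omega

lemma countP_high_lt_rows (hS : Valid S) {c : ℕ} (hc : c ∈ high S) :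
    (high S).countP (· < c) < rows S := by
  rw [← length_high hS]
  refine Nat.lt_of_le_of_ne List.countP_le_length fun he => ?_
  simpa using List.countP_eq_length.1 he c hc

lemma HasArcs.lt_of_mem_arcs (hS : Valid S) (h : HasArcs S f) {c : ℕ} (hc : c < S.length) :
    ∀ x ∈ (List.range c).reverse.flatMap (endWord S.length f),
      1 ≤ x ∧ x < (high S).countP (· < c) := fun x hx => by
  simp only [List.mem_flatMap, List.mem_reverse, List.mem_range] at hx
  obtain ⟨m, hmc, hx⟩ := hx
  have hx' := lt_of_mem_endWord hx
  rw [count_arcs hS h (hmc.trans hc).le] at hx'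
  have hmono : (high S).countP (· < m) ≤ (high S).countP (· < c) :=
    List.countP_mono_left fun z _ hz => by
      simp only [decide_eq_true_eq] at hz ⊢
      omega
  omega

theorem wordEval_arcs_low {Γ : Type*} [Monoid Γ] (hS : Valid S) (h : HasArcs S f)
    (hf : Set.InjOn f (Set.Iio S.length)) {s : ℕ → Γ} (hs : IsBraidSequence (rows S) s) :
    wordEval s ((List.range S.length).reverse.flatMap (endWord S.length f)) =
      wordEval s (arcWord S) := by
  induction S generalizing f s with
  | nil => rfl
  | cons b S ih =>
    have hf' := injOn_arcTail h.one_le hf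
    cases b with
    | none =>
      rw [List.length_cons, arcs_succ_of_le h.one_le h.le_zero, arcWord, wordEval_map_succ,
        wordEval_map_succ, ih hS h.tail hf' hs.shift]
    | some bs =>
      have hmem : f 0 ∈ 0 :: (high S).map (· + 1) := by
        rw [h.zero_eq]
        exact (bubble_perm hS.1.length_eq).mem_iff.1 (by simp)
      rw [List.length_cons, arcWord, wordEval_append, ← h.zero_eq, ← ih hS.2 h.tail hf' hs]
      rcases List.mem_cons.1 hmem with h0 | h0
      · simp [arcs_succ_of_eq_zero h.one_le h0, h0]
      · obtain ⟨c, hc, h0⟩ := List.mem_map.1 h0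
        have hcS := lt_of_mem_high hS.2 hc
        obtain ⟨A, hlow, hcons⟩ := arcs_succ_of_eq_succ h.one_le hf hcS h0.symm
        rw [hcons, hlow, count_arcs hS.2 h.tail hcS.le, ← h0]
        simp only [Nat.add_lt_add_iff_right, wordEval_append, mul_assoc]
        congr 1
        refine (hs.wordEval_mul_descWord le_rfl ?_ fun x hx => ?_).symm
        · have := countP_high_lt_rows hS.2 hc
          simp only [rows]
          omega
        · have := h.tail.lt_of_mem_arcs hS.2 hcS x hx
          omega

end DotPath

end ArcsOfPath

section SecondWindow

lemma filter_succ_le (l : List ℕ) (m : ℕ) :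
    l.filter (m + 1 ≤ ·) = ((dropZero l).filter (m ≤ ·)).map (· + 1) := by
  induction l with
  | nil => rfl
  | cons x l ih =>
    cases x with
    | zero => simpa using ih
    | succ x =>
      have hx : decide (m + 1 ≤ x + 1) = decide (m ≤ x) := by simp
      by_cases h : m ≤ x <;> simp only [dropZero_succ_cons, List.filter_cons, hx, h, ih] <;> simp

/-- The interval word of the entry `m` of a list, among the entries which are at least `m`. -/
def entryWord (l : List ℕ) (m : ℕ) : List ℕ :=
  descWord ((l.filter (m ≤ ·)).idxOf m + 1)
    ((l.filter (m ≤ ·)).length - 1 - (l.filter (m ≤ ·)).idxOf m)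

lemma idxOf_map_add (l : List ℕ) (m p : ℕ) : (l.map (· + p)).idxOf (m + p) = l.idxOf m := by
  induction l with
  | nil => rfl
  | cons x l ih => by_cases h : x = m <;> simp [h, List.idxOf_cons_ne, ih]

lemma entryWord_succ (l : List ℕ) (m : ℕ) : entryWord l (m + 1) = entryWord (dropZero l) m := by
  simp only [entryWord, filter_succ_le, idxOf_map_add, List.length_map]

lemma ascentWord_eq_flatMap (M : ℕ) (l : List ℕ) :
    ascentWord M l = (List.range M).reverse.flatMap (entryWord l) := by
  induction M generalizing l with
  | zero => rfl
  | succ M ih =>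
    rw [List.range_succ_eq_map, List.reverse_cons, List.flatMap_append, ← List.map_reverse,
      List.flatMap_map, List.flatMap_singleton, ascentWord, ih]
    congr 1
    · exact List.flatMap_congr fun m _ => (entryWord_succ l m).symm
    · simp [entryWord]

lemma entryWord_map_add (l : List ℕ) (m p : ℕ) :
    entryWord (l.map (· + p)) (m + p) = entryWord l m := by
  have : (l.map (· + p)).filter (m + p ≤ ·) = (l.filter (m ≤ ·)).map (· + p) := by
    simp [List.filter_map, Function.comp_def]
  simp only [entryWord, this, idxOf_map_add, List.length_map]

lemma entryWord_filter_le (l : List ℕ) {m p : ℕ} (h : p ≤ m) :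
    entryWord (l.filter (p ≤ ·)) m = entryWord l m := by
  have : (l.filter (p ≤ ·)).filter (m ≤ ·) = l.filter (m ≤ ·) := by
    rw [List.filter_filter]
    refine List.filter_congr fun x _ => ?_
    rw [← Bool.decide_and, decide_eq_decide]
    omega
  simp only [entryWord, this]

lemma entryWord_of_notMem {l : List ℕ} {m : ℕ} (h : m ∉ l) : entryWord l m = [] := by
  rw [entryWord, List.idxOf_eq_length fun hm => h (List.mem_of_mem_filter hm),
    show ∀ a : ℕ, a - 1 - a = 0 by omega, descWord_zero]

lemma countP_lt_of_notMem {l : List ℕ} {m : ℕ} (h : m ∉ l) :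
    (l.filter (m ≤ ·)).length = l.countP (m < ·) := by
  rw [← List.countP_eq_length_filter]
  refine List.countP_congr fun x hx => ?_
  have : x ≠ m := fun e => h (e ▸ hx)
  simp only [decide_eq_true_eq]
  omega

lemma entryWord_append_cons {A B : List ℕ} {m : ℕ} (h : (A ++ m :: B).Nodup) :
    entryWord (A ++ m :: B) m = descWord (1 + A.countP (m < ·)) (B.countP (m < ·)) := by
  obtain ⟨hA, hB⟩ := notMem_of_nodup_append_cons h
  have hfilter : (A ++ m :: B).filter (m ≤ ·) =
      A.filter (m ≤ ·) ++ m :: B.filter (m ≤ ·) := by simp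
  have hidx : (A.filter (m ≤ ·) ++ m :: B.filter (m ≤ ·)).idxOf m = (A.filter (m ≤ ·)).length := by
    rw [List.idxOf_append_of_notMem fun hm => hA (List.mem_of_mem_filter hm), List.idxOf_cons_self,
      Nat.add_zero]
  rw [entryWord, hfilter, hidx, List.length_append, List.length_cons, countP_lt_of_notMem hA,
    countP_lt_of_notMem hB]
  congr 1 <;> omega

variable {n : ℕ} {f : ℕ → ℕ}

lemma intervalWord_of_le {i : ℕ} (hi : i < n) (h : n ≤ f i) :
    intervalWord n f i = descWord (1 + ((List.range i).map f).countP (f i < ·))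
      (((List.range' (i + 1) (n - i - 1)).map f).countP (f i < ·)) := by
  have before (x : ℕ) (hx : x ∈ List.range i) : x < i ∧ ¬i < x := by
    rw [List.mem_range] at hx
    omega
  have after (x : ℕ) (hx : x ∈ List.range' (i + 1) (n - i - 1)) : ¬x < i ∧ i < x ∧ x < f i := by
    rw [List.mem_range'_1] at hx
    omega
  have split (p : ℕ → Prop) [DecidablePred p] (hp : ¬p i) : Nat.count p n =
      (List.range i).countP p + (List.range' (i + 1) (n - i - 1)).countP p := by
    rw [Nat.count, range_eq_append_cons hi, List.countP_append, List.countP_cons_of_neg (by simpa)]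
  have enclosing : Nat.count (fun x => x < i ∧ f i < f x) n =
      ((List.range i).map f).countP (f i < ·) := by
    rw [split _ (by simp), List.countP_map, Nat.add_eq_left.2]
    · exact List.countP_congr fun x hx => by simp [(before x hx).1]
    · exact List.countP_eq_zero.2 fun x hx => by simp [(after x hx).1]
  have crossing : Nat.count (fun x => i < x ∧ x < f i ∧ f i < f x) n =
      ((List.range' (i + 1) (n - i - 1)).map f).countP (f i < ·) := by
    rw [split _ (by simp), List.countP_map, Nat.add_eq_right.2]
    · exact List.countP_congr fun x hx => by simp [(after x hx).2]
    · exact List.countP_eq_zero.2 fun x hx => by simp [(before x hx).2]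
  rw [intervalWord, enclosing, crossing]

lemma endWord_of_le (hf : Set.InjOn f (Set.Iio n)) {m : ℕ} (hm : n ≤ m) :
    endWord n f m = entryWord ((List.range n).map f) m := by
  by_cases h : ∃ i < n, f i = m
  · obtain ⟨i, hi, rfl⟩ := h
    have hnodup : ((List.range n).map f).Nodup :=
      List.nodup_range.map_on fun x hx y hy =>
        hf (Set.mem_Iio.2 (List.mem_range.1 hx)) (Set.mem_Iio.2 (List.mem_range.1 hy))
    have start : (List.range n).filter (fun x => f x = f i) = [i] := by
      rw [List.filter_congr (q := (· == i)) fun x hx => ?_, List.filter_beq,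
        List.count_eq_one_of_mem List.nodup_range (List.mem_range.2 hi), List.replicate_one]
      rw [Bool.eq_iff_iff, decide_eq_true_eq, beq_iff_eq]
      exact hf.eq_iff (Set.mem_Iio.2 (List.mem_range.1 hx)) (Set.mem_Iio.2 hi)
    rw [endWord, start, List.flatMap_singleton, intervalWord_of_le hi hm]
    rw [range_eq_append_cons hi, List.map_append, List.map_cons] at hnodup ⊢
    exact (entryWord_append_cons hnodup).symm
  · push Not at h
    rw [endWord_eq_nil h, entryWord_of_notMem (by simpa using h)]

theorem arcs_high (hf : Set.InjOn f (Set.Iio n)) {V : List ℕ}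
    (hV : ((List.range n).map f).filter (n ≤ ·) = V.map (· + n)) :
    (List.range' n n).reverse.flatMap (endWord n f) = ascentWord n V := by
  rw [ascentWord_eq_flatMap, List.range'_eq_map_range, ← List.map_reverse, List.flatMap_map]
  refine List.flatMap_congr fun m _ => ?_
  have hm : n ≤ m + n := Nat.le_add_left n m
  rw [Nat.add_comm n m, endWord_of_le hf hm, ← entryWord_filter_le _ hm, hV, entryWord_map_add]

end SecondWindow

section Comparison

variable {n : ℕ} {f : Fin n → ℕ} {g : ℕ → ℕ}

lemma arcBraid_eq (k : ℕ) (h : ∀ i : Fin n, g i = f i) (i : Fin n) :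
    arcBraid k f i = wordEval (sigma k) (intervalWord n g i) := by
  have position : arcPosition f i = 1 + Nat.count (fun x => x < (i : ℕ) ∧ g i < g x) n := by
    simp only [arcPosition, ← card_filter_fin, h, Fin.lt_def]
  have crossings : arcCrossings f i =
      Nat.count (fun x => (i : ℕ) < x ∧ x < g i ∧ g i < g x) n := by
    simp only [arcCrossings, ← card_filter_fin, h, Fin.lt_def]
  have hlen : ∀ a c : ℕ, 1 + a + c - 1 + 1 - (1 + a) = c := by omega
  rw [arcBraid, position, crossings, intervalBraid, hlen]
  rfl

lemma jugglingPart_eq (k : ℕ) (h : ∀ i : Fin n, g i = f i) (ms : List ℕ) :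
    jugglingPart k f ms = wordEval (sigma k) (ms.flatMap (endWord n g)) := by
  have arcs (l : List (Fin n)) : (l.map (arcBraid k f)).prod =
      wordEval (sigma k) (l.flatMap fun i : Fin n => intervalWord n g (i : ℕ)) := by
    induction l with
    | nil => rfl
    | cons i l ih =>
      rw [List.map_cons, List.prod_cons, List.flatMap_cons, wordEval_append, arcBraid_eq k h, ih]
  have ends (m : ℕ) : endWord n g m =
      ((List.finRange n).filter fun i => f i = m).flatMap fun i : Fin n =>
        intervalWord n g (i : ℕ) := by
    rw [endWord, ← List.map_coe_finRange_eq_range, List.filter_map, List.flatMap_map]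
    simp only [Function.comp_def, h]
  rw [jugglingPart]
  induction ms with
  | nil => rfl
  | cons m ms ih =>
    rw [List.map_cons, List.prod_cons, ih, List.flatMap_cons, wordEval_append, ends, arcs]

lemma jugglingBraid_eq_mul (k : ℕ) (f : Fin n → ℕ) :
    jugglingBraid k f = jugglingBraid₂ k f * jugglingBraid₁ k f := by
  have : (List.range (2 * n)).reverse = (List.range' n n).reverse ++ (List.range n).reverse := by
    rw [List.range_eq_range', List.range_eq_range', Nat.two_mul, ← List.range'_append]
    simp
  simp only [jugglingBraid, this, jugglingBraid₁, jugglingBraid₂, jugglingPart, List.map_append,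
    List.prod_append]

end Comparison

/-! ### Braid groups and Markov moves -/

section BraidGroups

variable {n : ℕ} {G : Type*} [Group G]

lemma sigma_of_lt {i : ℕ} (h : 1 ≤ i ∧ i < n) :
    sigma n i = PresentedGroup.of (⟨i - 1, by omega⟩ : Fin (n - 1)) := by
  rw [sigma, dif_pos h]

lemma of_eq_sigma (i : Fin (n - 1)) :
    (PresentedGroup.of i : BraidGroup n) = sigma n (i + 1) := by
  rw [sigma_of_lt ⟨by omega, by omega⟩]
  rfl

theorem isBraidSequence_sigma (n : ℕ) : IsBraidSequence n (sigma n) where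
  commute i j hi hij hj := by
    rw [sigma_of_lt ⟨hi, by omega⟩, sigma_of_lt ⟨by omega, hj⟩]
    exact PresentedGroup.mk_eq_mk_of_mul_inv_mem (Or.inl ⟨_, _, by simp only; omega, rfl⟩)
  braid i hi hij := by
    rw [sigma_of_lt ⟨hi, by omega⟩, sigma_of_lt ⟨by omega, hij⟩]
    exact PresentedGroup.mk_eq_mk_of_mul_inv_mem (Or.inr ⟨_, _, by simp only; omega, rfl⟩)

/-- The homomorphism from the braid group to `G` that maps the generator `σ_i` to `s i`, for a
sequence `s` satisfying the braid relations. -/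
def IsBraidSequence.hom {s : ℕ → G} (h : IsBraidSequence n s) : BraidGroup n →* G :=
  PresentedGroup.toGroup (f := fun i : Fin (n - 1) => s (i + 1)) <| by
    rintro r (⟨i, j, hij, rfl⟩ | ⟨i, j, hij, rfl⟩) <;>
      simp only [map_mul, map_inv, FreeGroup.lift_apply_of, mul_inv_eq_one]
    · exact h.commute _ _ (by omega) (by omega) (by omega)
    · rw [← hij]
      exact h.braid _ (by omega) (by omega)

lemma IsBraidSequence.hom_sigma {s : ℕ → G} (h : IsBraidSequence n s) {i : ℕ} (hi : 1 ≤ i)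
    (hin : i < n) : h.hom (sigma n i) = s i := by
  rw [sigma_of_lt ⟨hi, hin⟩, hom, PresentedGroup.toGroup.of, Nat.sub_add_cancel hi]

lemma BraidGroup.semiconjBy {φ ψ : BraidGroup n →* G} {g : G}
    (h : ∀ i, 1 ≤ i → i < n → SemiconjBy g (φ (sigma n i)) (ψ (sigma n i))) (β : BraidGroup n) :
    SemiconjBy g (φ β) (ψ β) := by
  have : (MulAut.conj g).toMonoidHom.comp φ = ψ := PresentedGroup.ext fun i => by
    rw [of_eq_sigma]
    exact mul_inv_eq_of_eq_mul (h _ (by omega) (by omega)).eq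
  simp [← this, SemiconjBy]

lemma addStrand_sigma {i : ℕ} (hi : 1 ≤ i) (hin : i < n) :
    addStrand n (sigma n i) = sigma (n + 1) i := by
  rw [sigma_of_lt ⟨hi, hin⟩, addStrand, PresentedGroup.toGroup.of, sigma_of_lt ⟨hi, by omega⟩]

/-- The inclusion `σ_i ↦ σ_{i+1}`, which adds a disjoint trivial strand at the top. -/
def shiftStrand (n : ℕ) : BraidGroup n →* BraidGroup (n + 1) :=
  (isBraidSequence_sigma (n + 1)).shift.hom

lemma shiftStrand_sigma {i : ℕ} (hi : 1 ≤ i) (hin : i < n) :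
    shiftStrand n (sigma n i) = sigma (n + 1) (i + 1) :=
  IsBraidSequence.hom_sigma _ hi hin

lemma shiftStrand_wordEval {l : List ℕ} (hl : IsBraidWord n l) :
    shiftStrand n (wordEval (sigma n) l) = wordEval (sigma (n + 1)) (l.map (· + 1)) := by
  rw [wordEval_map_succ]
  exact map_wordEval fun i hi => shiftStrand_sigma (hl i hi).1 (hl i hi).2

lemma halfTwist_mul_shiftStrand (β : BraidGroup n) :
    wordEval (sigma (n + 1)) (halfTwistWord (n + 1)) * shiftStrand n β =
      addStrand n (wordEval (sigma n) (halfTwistWord n) * β *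
        (wordEval (sigma n) (halfTwistWord n))⁻¹) *
        wordEval (sigma (n + 1)) (halfTwistWord (n + 1)) := by
  refine BraidGroup.semiconjBy (ψ := (addStrand n).comp (MulAut.conj _).toMonoidHom)
    (fun i hi hin => ?_) β
  have conj_sigma : wordEval (sigma n) (halfTwistWord n) * sigma n i *
      (wordEval (sigma n) (halfTwistWord n))⁻¹ = sigma n (n - i) :=
    mul_inv_eq_of_eq_mul ((isBraidSequence_sigma n).halfTwist_mul hi hin)
  rw [MonoidHom.comp_apply, MulEquiv.coe_toMonoidHom, MulAut.conj_apply, conj_sigma,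
    addStrand_sigma (by omega) (by omega), shiftStrand_sigma hi hin, SemiconjBy,
    (isBraidSequence_sigma (n + 1)).halfTwist_mul (by omega) (by omega)]
  simp only [Nat.add_sub_add_right]

/-- The inclusion of `Br_k` into `Br_{k+m}` that adds `m` disjoint trivial strands at the bottom. -/
def addStrands (k : ℕ) : (m : ℕ) → BraidGroup k →* BraidGroup (k + m)
  | 0 => MonoidHom.id _
  | m + 1 => (addStrand (k + m)).comp (addStrands k m)

lemma addStrands_sigma {k i : ℕ} (m : ℕ) (hi : 1 ≤ i) (hik : i < k) :
    addStrands k m (sigma k i) = sigma (k + m) i := by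
  induction m with
  | zero => rfl
  | succ m ih =>
    rw [addStrands, MonoidHom.comp_apply, ih, addStrand_sigma hi (by omega)]
    rfl

lemma descWord_mul_shiftStrand_addStrands {k m : ℕ} (β : BraidGroup k) :
    wordEval (sigma (k + m + 1)) (descWord 1 k) * shiftStrand (k + m) (addStrands k m β) =
      addStrands k (m + 1) β * wordEval (sigma (k + m + 1)) (descWord 1 k) := by
  refine BraidGroup.semiconjBy (φ := (shiftStrand (k + m)).comp (addStrands k m))
    (fun i hi hik => ?_) β
  rw [MonoidHom.comp_apply, addStrands_sigma _ hi hik, addStrands_sigma _ hi hik,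
    shiftStrand_sigma hi (by omega)]
  exact ((isBraidSequence_sigma (k + m + 1)).mul_descWord le_rfl hi (by omega) (by omega)).symm

end BraidGroups

section MarkovMoves

lemma isConj_of_mul_eq {G : Type*} [Group G] {a b c : G} (h : c * a = b * c) : IsConj a b :=
  isConj_iff.2 ⟨c, mul_inv_eq_of_eq_mul h⟩

lemma isConj_mul_comm {G : Type*} [Group G] (a b : G) : IsConj (a * b) (b * a) :=
  isConj_of_mul_eq (mul_assoc b a b).symm

namespace MarkovReduces

variable {N s n : ℕ} {α : BraidGroup N} {β : BraidGroup n}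

lemma deleteStrand_top (h : MarkovReduces α s (shiftStrand n β)) : MarkovReduces α (s + 1) β :=
  (h.conj (isConj_of_mul_eq (halfTwist_mul_shiftStrand β))).deleteStrand.conj
    (isConj_iff.2 ⟨_, rfl⟩).symm

lemma destabilize_top (hn : 1 ≤ n) (h : MarkovReduces α s (shiftStrand n β * sigma (n + 1) 1)) :
    MarkovReduces α s β := by
  refine ((h.conj (isConj_of_mul_eq (c := wordEval (sigma (n + 1)) (halfTwistWord (n + 1)))
    ?_)).destabilize hn).conj (isConj_iff.2 ⟨wordEval (sigma n) (halfTwistWord n), rfl⟩).symm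
  rw [← mul_assoc, halfTwist_mul_shiftStrand, mul_assoc,
    (isBraidSequence_sigma (n + 1)).halfTwist_mul le_rfl (by omega), ← mul_assoc]
  rfl

end MarkovReduces

end MarkovMoves

/-! ### Reduction of the Richardson braid, column by column -/

section DottedColumn

lemma gapWord_append (q : ℕ) (A B : List Bool) :
    gapWord q (A ++ B) = gapWord q A ++ gapWord (q + A.length) B := by
  induction A generalizing q with
  | nil => rfl
  | cons b A ih =>
    have e : q + 1 + A.length = q + (A.length + 1) := by omega
    cases b <;> simp [gapWord, ih, e]

lemma reverse_gapWord_replicate_false (q p : ℕ) :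
    (gapWord q (List.replicate p false)).reverse = descWord q p := by
  induction p generalizing q with
  | zero => rfl
  | succ p ih => rw [List.replicate_succ, gapWord, List.reverse_cons, ih, descWord_succ']

variable {Γ : Type*} [Group Γ] {s : ℕ → Γ} {N : ℕ}

lemma tangle_replicate_false_append (s : ℕ → Γ) (p : ℕ) (bs : List Bool) :
    tangle s (List.replicate p false ++ bs) = tangle (fun i => s (i + p)) bs := by
  induction p generalizing s with
  | zero => rfl
  | succ p ih =>
    rw [List.replicate_succ, List.cons_append, tangle, ih]
    simp only [Nat.add_assoc]

lemma tangle_replicate_false (s : ℕ → Γ) (p : ℕ) : tangle s (List.replicate p false) = 1 := by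
  rw [← List.append_nil (List.replicate p false), tangle_replicate_false_append]
  rfl

lemma tangle_replicate_false_append_true (s : ℕ → Γ) (p : ℕ) (bs : List Bool) :
    tangle s (List.replicate p false ++ true :: bs) =
      (wordEval s (gapWord (p + 1) bs).reverse)⁻¹ * wordEval s (descWord (p + 1) bs.length) := by
  rw [tangle_replicate_false_append, tangle, ← wordEval_map_add, ← wordEval_map_add,
    List.map_reverse, ← gapWord_add, descWord_map_add, Nat.add_comm 1 p]

lemma tangle_true_replicate_false (s : ℕ → Γ) (p : ℕ) :
    tangle s (true :: List.replicate p false) = 1 := by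
  rw [tangle, reverse_gapWord_replicate_false, List.length_replicate, inv_mul_cancel]

lemma IsBraidSequence.conj_descWord {a : ℕ} (h : IsBraidSequence N s) (haN : a + 1 < N) :
    (wordEval s (descWord 1 a))⁻¹ * s (a + 1) * wordEval s (descWord 1 a) =
      wordEval s (descWord 2 a) * s 1 * (wordEval s (descWord 2 a))⁻¹ := by
  have hmul := h.wordEval_mul_descWord (a := 1) (l := a + 1) le_rfl (by omega) (w := descWord 1 a)
    fun x hx => by
      rw [mem_descWord] at hx
      omega
  have hdesc : wordEval s (descWord 1 (a + 1)) = wordEval s (descWord 2 a) * s 1 := by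
    rw [descWord_succ']
    simp
  rw [mul_assoc, inv_mul_eq_iff_eq_mul, ← mul_assoc, eq_mul_inv_iff_mul_eq, ← hdesc, hmul,
    descWord_map_succ, descWord_succ, wordEval_cons, Nat.add_comm 1 a]

-- The top strand only passes over other strands on its way down to the next dot, so that a single
-- crossing with the strand of this dot remains, up to conjugation.
lemma IsBraidSequence.tangle_true_replicate_false_append_true (a : ℕ) (bs : List Bool)
    (h : IsBraidSequence (a + bs.length + 2) s) :
    tangle s (true :: (List.replicate a false ++ true :: bs)) =
      tangle (fun i => s (i + 1)) (List.replicate a false ++ true :: bs) *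
        (wordEval s (descWord 2 a) * s 1 * (wordEval s (descWord 2 a))⁻¹) := by
  have hgap : wordEval s (gapWord 1 (List.replicate a false ++ true :: bs)).reverse =
      wordEval s (gapWord (a + 2) bs).reverse * wordEval s (descWord 1 a) := by
    rw [gapWord_append, List.length_replicate, gapWord, List.reverse_append, wordEval_append,
      reverse_gapWord_replicate_false, show 1 + a + 1 = a + 2 by omega]
  have hdesc : wordEval s (descWord 1 (List.replicate a false ++ true :: bs).length) =
      wordEval s (descWord (a + 2) bs.length) * (s (a + 1) * wordEval s (descWord 1 a)) := by
    rw [List.length_append, List.length_replicate, List.length_cons,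
      show a + (bs.length + 1) = a + 1 + bs.length by omega, descWord_add, descWord_succ,
      show 1 + (a + 1) = a + 2 by omega, Nat.add_comm 1 a, wordEval_append, wordEval_cons]
  have hcomm {w : List ℕ} (hw : ∀ x ∈ w, a + 2 ≤ x ∧ x < a + 2 + bs.length) :
      Commute (wordEval s w) (wordEval s (descWord 1 a)) :=
    h.commute_wordEval_wordEval (fun x hx => by have := hw x hx; omega)
      (isBraidWord_descWord le_rfl (by omega)) fun x hx y hy => by
        have := hw x hx
        rw [mem_descWord] at hy
        omega
  have htangle : tangle (fun i => s (i + 1)) (List.replicate a false ++ true :: bs) =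
      (wordEval s (gapWord (a + 2) bs).reverse)⁻¹ * wordEval s (descWord (a + 2) bs.length) := by
    rw [tangle_replicate_false_append_true, ← wordEval_map_succ, ← wordEval_map_succ,
      List.map_reverse, ← gapWord_succ, descWord_map_succ]
  have htangle_comm := ((hcomm fun x hx => mem_gapWord (List.mem_reverse.1 hx)).inv_left.mul_left
    (hcomm fun x hx => mem_descWord.1 hx)).inv_right.eq
  rw [tangle, hgap, hdesc, mul_inv_rev, ← h.conj_descWord (by omega), htangle, mul_assoc,
    ← mul_assoc _ (wordEval s (descWord (a + 2) bs.length)), ← mul_assoc, ← htangle_comm]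
  simp only [mul_assoc]

lemma map_tangle {Γ' : Type*} [Group Γ'] {φ : Γ →* Γ'} {s' : ℕ → Γ'} {bs : List Bool}
    (h : ∀ i, 1 ≤ i → i < bs.length → φ (s i) = s' i) : φ (tangle s bs) = tangle s' bs := by
  induction bs generalizing s s' with
  | nil => exact map_one φ
  | cons b bs ih =>
    cases b with
    | false => exact ih fun i hi hib => h (i + 1) (by omega) (Nat.succ_lt_succ hib)
    | true =>
      rw [tangle, tangle, map_mul, map_inv, map_wordEval fun i hi => ?_,
        map_wordEval fun i hi => ?_]
      · rw [mem_descWord] at hi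
        exact h i hi.1 (by rw [List.length_cons]; omega)
      · have := mem_gapWord (List.mem_reverse.1 hi)
        exact h i this.1 (by rw [List.length_cons]; omega)

end DottedColumn

section Gaps

variable {M n q : ℕ} {l l' : List ℕ}

lemma shiftStrand_wordEval_mul_inv (hl : IsBraidWord M l) (hl' : IsBraidWord M l')
    (hM : M + q ≤ n) :
    shiftStrand n (wordEval (sigma n) (l.map (· + q)) *
        (wordEval (sigma n) (l'.map (· + q)))⁻¹) =
      wordEval (sigma (n + 1)) (l.map (· + (q + 1))) *
        (wordEval (sigma (n + 1)) (l'.map (· + (q + 1))))⁻¹ := by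
  rw [map_mul, map_inv, shiftStrand_wordEval ((hl.map_add q).mono hM),
    shiftStrand_wordEval ((hl'.map_add q).mono hM), List.map_map, List.map_map]
  rfl

lemma commute_descWord_map_add (hl : IsBraidWord M l) (hM : M + (q + 1) ≤ n) :
    Commute (wordEval (sigma n) (descWord 1 q)) (wordEval (sigma n) (l.map (· + (q + 1)))) := by
  refine (isBraidSequence_sigma n).commute_wordEval_wordEval
    (isBraidWord_descWord le_rfl (by omega)) ((hl.map_add (q + 1)).mono hM) fun x hx => ?_
  simp only [List.forall_mem_map]
  intro y hy
  have := hl y hy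
  rw [mem_descWord] at hx
  omega

end Gaps

lemma map_succ_map_add (l : List ℕ) (q : ℕ) :
    (l.map (· + 1)).map (· + q) = l.map (· + (q + 1)) := by
  simp only [List.map_map, Function.comp_def, Nat.add_assoc, Nat.add_comm 1]

lemma DotPath.isBraidWord_gaps_clear (S : DotPath) : IsBraidWord S.length S.clear.gaps :=
  S.length_clear ▸ isBraidWord_gaps S.valid_clear

namespace MarkovReduces

variable {N s k m q : ℕ} {α : BraidGroup N} {bs : List Bool} {z : BraidGroup k}
  {X : BraidGroup (k + m)}

lemma destabilize_conj {n : ℕ} {β γ : BraidGroup n} (hn : 1 ≤ n)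
    (h : MarkovReduces α s (shiftStrand n β *
      (shiftStrand n γ * sigma (n + 1) 1 * (shiftStrand n γ)⁻¹))) :
    MarkovReduces α s β := by
  have hγ : MarkovReduces α s (shiftStrand n (γ⁻¹ * β * γ) * sigma (n + 1) 1) :=
    h.conj (isConj_of_mul_eq (c := (shiftStrand n γ)⁻¹) (by simp only [map_mul, map_inv]; group))
  exact (hγ.destabilize_top hn).conj (isConj_of_mul_eq (c := γ) (by group))

lemma shift_mul_tangle (hk : q + bs.length = k)
    (hX : Commute (wordEval (sigma (k + m + 1)) (descWord 1 q)) (shiftStrand (k + m) X))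
    (h : MarkovReduces α s (addStrands k (m + 1) z *
      (wordEval (sigma (k + m + 1)) (descWord (q + 1) bs.length) * shiftStrand (k + m) X *
        (wordEval (sigma (k + m + 1)) (gapWord (q + 1) bs).reverse)⁻¹))) :
    MarkovReduces α s (shiftStrand (k + m) (addStrands k m z * X) *
      tangle (sigma (k + m + 1)) (true :: (List.replicate q false ++ bs))) := by
  have hz := descWord_mul_shiftStrand_addStrands (m := m) z
  have hdesc : wordEval (sigma (k + m + 1)) (descWord 1 k) =
      wordEval (sigma (k + m + 1)) (descWord (q + 1) bs.length) *
        wordEval (sigma (k + m + 1)) (descWord 1 q) := by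
    rw [← wordEval_append, ← hk, descWord_add, Nat.add_comm 1 q]
  have hgap : wordEval (sigma (k + m + 1))
      (gapWord 1 (List.replicate q false ++ bs)).reverse =
      wordEval (sigma (k + m + 1)) (gapWord (q + 1) bs).reverse *
        wordEval (sigma (k + m + 1)) (descWord 1 q) := by
    rw [gapWord_append, List.length_replicate, List.reverse_append, wordEval_append,
      reverse_gapWord_replicate_false, Nat.add_comm 1 q]
  rw [tangle, List.length_append, List.length_replicate, hk, hgap, map_mul]
  refine h.conj (isConj_of_mul_eq (c := (wordEval (sigma (k + m + 1)) (descWord 1 k))⁻¹) ?_)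
  generalize wordEval (sigma (k + m + 1)) (gapWord (q + 1) bs).reverse = U at *
  generalize wordEval (sigma (k + m + 1)) (descWord 1 k) = δ at *
  generalize wordEval (sigma (k + m + 1)) (descWord 1 q) = W at *
  generalize wordEval (sigma (k + m + 1)) (descWord (q + 1) bs.length) = C at *
  generalize shiftStrand (k + m) X = X' at *
  generalize shiftStrand (k + m) (addStrands k m z) = y at *
  generalize addStrands k (m + 1) z = z' at *
  rw [inv_mul_eq_iff_eq_mul]
  calc z' * (C * X' * U⁻¹) = z' * (C * (W * X' * W⁻¹) * U⁻¹) := by rw [hX.mul_inv_cancel]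
    _ = z' * δ * X' * (U * W)⁻¹ := by rw [hdesc]; group
    _ = δ * y * X' * (U * W)⁻¹ := by rw [hz]
    _ = δ * (y * X' * ((U * W)⁻¹ * δ) * δ⁻¹) := by group

lemma remove_column (hk : q + bs.length = k)
    (hX : Commute (wordEval (sigma (k + m + 1)) (descWord 1 q)) (shiftStrand (k + m) X))
    (h : MarkovReduces α s (addStrands k (m + 1) z *
      (wordEval (sigma (k + m + 1)) (descWord (q + 1) bs.length) * shiftStrand (k + m) X *
        (wordEval (sigma (k + m + 1)) (gapWord (q + 1) bs).reverse)⁻¹))) :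
    MarkovReduces α (s + if true ∈ bs then 0 else 1)
      (addStrands k m (tangle (sigma k) (List.replicate q false ++ bs) * z) * X) := by
  replace h := h.shift_mul_tangle hk hX
  split_ifs with hbs
  · obtain ⟨A, B, rfl, hA⟩ := List.eq_append_cons_of_mem hbs
    have hA : A = List.replicate A.length false :=
      List.eq_replicate_iff.2 ⟨rfl, fun b hb => by cases b <;> simp_all⟩
    rw [hA, ← List.append_assoc, List.replicate_append_replicate] at h ⊢
    simp only [List.length_append, List.length_cons] at hk
    set bs := List.replicate (q + A.length) false ++ true :: B with hbs
    have hl : bs.length = k := by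
      rw [hbs, List.length_append, List.length_replicate, List.length_cons]
      omega
    have htangle : tangle (fun i => sigma (k + m + 1) (i + 1)) bs =
        shiftStrand (k + m) (addStrands k m (tangle (sigma k) bs)) := by
      refine (map_tangle (φ := (shiftStrand (k + m)).comp (addStrands k m)) fun i hi hib => ?_).symm
      rw [MonoidHom.comp_apply, addStrands_sigma m hi (by omega), shiftStrand_sigma hi (by omega)]
    rw [((isBraidSequence_sigma _).mono (by omega)).tangle_true_replicate_false_append_true,
      ← hbs, htangle, ← mul_assoc, ← map_mul, ← descWord_map_succ,
      ← shiftStrand_wordEval (isBraidWord_descWord le_rfl (by omega))] at h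
    exact (h.destabilize_conj (by omega)).conj
      (isConj_of_mul_eq (c := addStrands k m (tangle (sigma k) bs))
        (by simp only [map_mul, mul_assoc]))
  · have hbs : bs = List.replicate bs.length false :=
      List.eq_replicate_iff.2 ⟨rfl, fun b hb => by cases b <;> simp_all⟩
    rw [hbs, List.replicate_append_replicate] at h ⊢
    rw [tangle_true_replicate_false, mul_one] at h
    rw [tangle_replicate_false, one_mul]
    exact h.deleteStrand_top

lemma remove_columns {S : DotPath} (hV : DotPath.Valid S) (hk : q + DotPath.rows S = k)
    (hm : q + S.length = k + m)
    (h : MarkovReduces α s (addStrands k m z *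
      (wordEval (sigma (k + m)) ((DotPath.gaps (DotPath.clear S)).map (· + q)) *
        (wordEval (sigma (k + m)) ((DotPath.gaps S).map (· + q)))⁻¹))) :
    MarkovReduces α (s + DotPath.emptyCols S) (DotPath.braid (fun i => sigma k (i + q)) S * z) := by
  induction S generalizing q m s z with
  | nil =>
    obtain rfl : m = 0 := by
      simp only [DotPath.rows, List.length_nil] at hk hm
      omega
    simpa [DotPath.braid, DotPath.emptyCols, DotPath.gaps, DotPath.clear, addStrands] using h
  | cons c S ih =>
    rw [List.length_cons] at hm
    cases c with
    | none =>
      simp only [DotPath.rows] at hk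
      simp only [DotPath.clear, DotPath.gaps, map_succ_map_add] at h
      simpa only [DotPath.braid, DotPath.emptyCols, Nat.add_right_comm, Nat.add_assoc,
        Nat.add_comm 1] using ih hV (by omega) (by omega) h
    | some bs =>
      have hbs : bs.length = DotPath.rows S := DotPath.length_eq_rows hV
      have hle := DotPath.rows_le S
      simp only [DotPath.rows] at hk
      obtain ⟨m, rfl⟩ : ∃ m', m = m' + 1 := ⟨m - 1, by omega⟩
      have hn : S.length + q ≤ k + m := by omega
      have hgaps : IsBraidWord S.length (DotPath.gaps S) := DotPath.isBraidWord_gaps hV.2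
      have hclear := DotPath.isBraidWord_gaps_clear S
      have hshift := shiftStrand_wordEval_mul_inv hclear hgaps hn
      rw [DotPath.braid, mul_assoc, ← tangle_replicate_false_append, DotPath.emptyCols,
        Nat.add_comm (DotPath.emptyCols S), ← Nat.add_assoc]
      refine ih (m := m) hV.2 hk (by omega) (remove_column (hbs ▸ hk) ?_ ?_)
      · rw [hshift]
        exact (commute_descWord_map_add hclear (by omega)).mul_right
          (commute_descWord_map_add hgaps (by omega)).inv_right
      · rw [hshift]
        simp only [DotPath.clear, DotPath.gaps, List.map_append, map_succ_map_add, wordEval_append,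
          reverse_gapWord_replicate_false, descWord_map_add, mul_inv_rev] at h
        rw [List.map_reverse, ← gapWord_add] at h
        simp only [hbs, mul_assoc, Nat.add_comm q 1] at h ⊢
        exact h

end MarkovReduces

/-! ### The braids of the theorem as words -/

section Columns

variable {Γ : Type*} [Group Γ]

lemma inv_wordEval_reverse (s : ℕ → Γ) (l : List ℕ) :
    (wordEval s l.reverse)⁻¹ = (l.map fun q => (s q)⁻¹).prod := by
  induction l with
  | nil => simp
  | cons x l ih => simp [← ih]

lemma tangle_append_replicate_false (s : ℕ → Γ) (bs : List Bool) (p : ℕ) :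
    tangle s (bs ++ List.replicate p false) = tangle s bs := by
  induction bs generalizing s with
  | nil => exact tangle_replicate_false s p
  | cons b bs ih =>
    cases b with
    | false => exact ih fun i => s (i + 1)
    | true =>
      rw [List.cons_append, tangle, tangle, gapWord_append, List.reverse_append, wordEval_append,
        reverse_gapWord_replicate_false, List.length_append, List.length_replicate, descWord_add,
        wordEval_append, mul_inv_rev, mul_assoc, inv_mul_cancel_left]

lemma intervalBraid_eq (n a b : ℕ) :
    intervalBraid n a b = wordEval (sigma n) (descWord a (b + 1 - a)) := rfl

lemma gapWord_eq_filter {c t : ℕ} {P : Finset ℕ} (ht : c + 1 + t ∈ P) :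
    gapWord (c + 1) ((List.range t).map fun p => decide (c + 1 + p + 1 ∈ P)) =
      (List.range' (c + 1) (t - 1)).filter fun x => x + 1 ∉ P := by
  cases t with
  | zero => rfl
  | succ t =>
    rw [gapWord_map_range, List.range_succ, List.filter_append, List.range'_eq_map_range,
      List.filter_map, List.filter_cons_of_neg]
    · simp [Function.comp_def, Nat.add_comm, Nat.add_left_comm]
    · simpa [Nat.add_assoc] using ht

lemma columnTangle_eq_tangle {k : ℕ} {P : Finset ℕ} (hP : P ⊆ Finset.Icc 1 k) :
    columnTangle k P = tangle (sigma k) ((List.range k).map fun p => decide (p + 1 ∈ P)) := by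
  rw [columnTangle]
  split_ifs with hne
  · have hmin := hP (P.min'_mem hne)
    have hmax := hP (P.max'_mem hne)
    have hle : P.min' hne ≤ P.max' hne := P.min'_le_max' hne
    rw [Finset.mem_Icc] at hmin hmax
    obtain ⟨c, hc⟩ := Nat.exists_eq_add_of_le' hmin.1
    obtain ⟨t, ht⟩ := Nat.exists_eq_add_of_le hle
    obtain ⟨e, rfl⟩ := Nat.exists_eq_add_of_le hmax.2
    have hbs : ((List.range (P.max' hne + e)).map fun p => decide (p + 1 ∈ P)) =
        List.replicate c false ++
          true :: ((List.range t).map fun p => decide (c + 1 + p + 1 ∈ P)) ++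
          List.replicate e false := by
      have hbelow : (List.range c).map (fun p => decide (p + 1 ∈ P)) = List.replicate c false := by
        refine List.eq_replicate_iff.2 ⟨by simp, List.forall_mem_map.2 fun p hp => ?_⟩
        rw [List.mem_range] at hp
        exact decide_eq_false fun hp' => absurd (P.min'_le _ hp') (by omega)
      have habove : (List.range e).map (fun p => decide (c + 1 + t + p + 1 ∈ P)) =
          List.replicate e false := by
        refine List.eq_replicate_iff.2 ⟨by simp, List.forall_mem_map.2 fun p _ => ?_⟩
        exact decide_eq_false fun hp' => absurd (P.le_max' _ hp') (by omega)
      have hc' : c + 1 ∈ P := hc ▸ P.min'_mem hne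
      simp [ht, hc, List.range_add, List.range_succ, hbelow, habove, hc', Function.comp_def]
    rw [hbs, tangle_append_replicate_false, tangle_replicate_false_append_true, List.length_map,
      List.length_range, gapWord_eq_filter (by rw [← hc, ← ht]; exact P.max'_mem hne),
      inv_wordEval_reverse, intervalBraid_eq, ht, hc, show c + 1 + t - 1 - (c + 1) = t - 1 by omega,
      show c + 1 + t - 1 + 1 - (c + 1) = t by omega]
  · have hbs : ((List.range k).map fun p => decide (p + 1 ∈ P)) = List.replicate k false := by
      simp [Finset.not_nonempty_iff_eq_empty.1 hne]
    rw [hbs, tangle_replicate_false]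

lemma columnTangle_dotPositions (k : ℕ) (L : Finset (ℕ × ℕ)) (j : ℕ) :
    columnTangle k (dotPositions k L j) =
      tangle (sigma k) ((List.range k).map fun p => decide (p < k ∧ (k - 1 - p, j) ∈ L)) := by
  rw [dotPositions, columnTangle_eq_tangle (Finset.filter_subset ..)]
  refine congrArg (tangle _) (List.map_congr_left fun p hp => ?_)
  rw [List.mem_range] at hp
  simp [hp, Nat.succ_le_of_lt hp, Nat.sub_sub, Nat.add_comm 1 p]

lemma halfTwist_eq (k : ℕ) : halfTwist k = wordEval (sigma k) (halfTwistWord k) := by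
  have h (m : ℕ) : ((List.range' 1 m).map (intervalBraid k 1)).prod =
      wordEval (sigma k) (halfTwistWord (m + 1)) := by
    induction m with
    | zero => rfl
    | succ m ih =>
      rw [List.range'_1_concat, List.map_append, List.prod_append, ih, halfTwistWord.eq_2 (m + 1),
        wordEval_append, List.map_singleton, List.prod_singleton, intervalBraid_eq,
        Nat.add_sub_cancel, Nat.add_comm 1 m]
  cases k with
  | zero => rfl
  | succ k => exact h k

end Columns

/-! ### The path of a positroid pair -/

section LeDiagram

variable {k n : ℕ} {u w : Perm (Fin n)} {L : Finset (ℕ × ℕ)}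

/-- The dots of `L`, with rows counted from the top down. -/
def topDots (k : ℕ) (L : Finset (ℕ × ℕ)) (p j : ℕ) : Bool := decide (p < k ∧ (k - 1 - p, j) ∈ L)

/-- The boundary path of the Young diagram of `w`, with the dots of `L` on its column steps. -/
def lePath (k : ℕ) (w : Perm (Fin n)) (L : Finset (ℕ × ℕ)) : DotPath :=
  dotPath n k (topRowLength k w) (topDots k L)

lemma lt_of_lt_rowLength {i j : ℕ} (h : j < rowLength k w i) : i < k := by
  by_contra hi
  simp [rowLength, hi] at h

lemma topDots_lt (hL : ∀ c ∈ L, c.2 < rowLength k w c.1) {p j : ℕ} (h : topDots k L p j) :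
    j < topRowLength k w p :=
  hL _ (of_decide_eq_true h).2

lemma isLe_topDots_iff (k : ℕ) (w : Perm (Fin n)) (L : Finset (ℕ × ℕ)) :
    IsLe k (topRowLength k w) (topDots k L) ↔
      ∀ r₁ r₂ c₁ c₂ : ℕ, (r₁, c₁) ∈ L → (r₂, c₂) ∈ L → r₁ ≤ r₂ → c₂ ≤ c₁ →
        c₁ < rowLength k w r₂ → (r₂, c₁) ∈ L := by
  constructor
  · intro h r₁ r₂ c₁ c₂ h₁ h₂ hr hc hlt
    obtain rfl | hr := hr.eq_or_lt
    · exact h₁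
    have hk := lt_of_lt_rowLength hlt
    have top {i : ℕ} (hi : i < k) : k - 1 - (k - 1 - i) = i := by omega
    have := h (k - 1 - r₂) (k - 1 - r₁) c₂ c₁ (by omega) (by omega) hc
      (decide_eq_true ⟨by omega, by rwa [top hk]⟩)
      (decide_eq_true ⟨by omega, by rwa [top (hr.trans hk)]⟩) (by rwa [topRowLength, top hk])
    simpa [topDots, top hk] using (of_decide_eq_true this).2
  · intro h p q i j hpq hq hij hp hq' hlt
    exact decide_eq_true ⟨hpq.trans hq, h _ _ _ _ (of_decide_eq_true hq').2
      (of_decide_eq_true hp).2 (by omega) hij hlt⟩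

lemma gaps_lePath (hkn : k ≤ n) (hw : IsGrassmannian k w) (L : Finset (ℕ × ℕ)) :
    (lePath k w L).gaps = emptyBoxWord k w L := by
  have hrev : List.range k = ((List.range k).map (k - 1 - ·)).reverse := by
    refine List.ext_getElem (by simp) fun p hp _ => ?_
    rw [List.length_range] at hp
    rw [List.getElem_reverse, List.getElem_map, List.getElem_range, List.getElem_range,
      List.length_map, List.length_range, Nat.sub_sub_self (Nat.le_sub_one_of_lt hp)]
  rw [lePath, gaps_dotPath (hw.isShape hkn), emptyBoxWord]
  refine List.flatMap_congr fun j _ => ?_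
  conv_rhs => rw [hrev]
  rw [List.filter_reverse, List.map_reverse, List.filter_map, List.map_map]
  have hfilter : ((List.range k).filter fun p => j < topRowLength k w p ∧ topDots k L p j = false) =
      (List.range k).filter
        ((fun i => decide (j < rowLength k w i ∧ (i, j) ∉ L)) ∘ fun p => k - 1 - p) :=
    List.filter_congr fun p hp => by
      simp [topRowLength, topDots, List.mem_range.1 hp]
  rw [hfilter]
  refine congrArg List.reverse (List.map_congr_left fun p hp => ?_)
  have := List.mem_range.1 (List.mem_of_mem_filter hp)
  simp only [Function.comp_apply]
  omega

lemma braid_lePath (hkn : k ≤ n) (hw : IsGrassmannian k w)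
    (hL : ∀ c ∈ L, c.2 < rowLength k w c.1) : (lePath k w L).braid (sigma k) = leBraid k n L := by
  rw [lePath, braid_dotPath _ (hw.isShape hkn) fun p _ j => topDots_lt hL, leBraid]
  simp only [columnTangle_dotPositions, topDots]

lemma invWindow_prod_emptyBoxWord (hkn : k ≤ n) (hw : IsGrassmannian k w)
    (hV : (lePath k w L).Valid) :
    invWindow ((emptyBoxWord k w L).map (simpleTransposition n)).prod =
      (lePath k w L).high ++ (lePath k w L).low := by
  have hn : (lePath k w L).length = n := length_dotPath ..
  have hword := DotPath.isBraidWord_gaps hV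
  have hact := DotPath.wordAct_gaps hV
  rw [hn, gaps_lePath hkn hw] at hword hact
  rw [invWindow_prod hword, hact]

lemma isLeDiagramOf_iff (hkn : k ≤ n) (hw : IsGrassmannian k w) :
    IsLeDiagramOf k u w L ↔ (∀ c ∈ L, c.2 < rowLength k w c.1) ∧ (lePath k w L).Valid ∧
      (lePath k w L).high ++ (lePath k w L).low = invWindow u := by
  rw [IsLeDiagramOf, IsLeDiagram, and_assoc, ← isLe_topDots_iff,
    ← valid_dotPath_iff (hw.isShape hkn), lePath]
  refine and_congr_right' (and_congr_right fun hV => ?_)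
  rw [← lePath] at hV ⊢
  rw [← invWindow_prod_emptyBoxWord hkn hw hV]
  exact invWindow_injective.eq_iff.symm

lemma exists_topDots_eq {m : ℕ} {d : ℕ → ℕ → Bool} (hd : ∀ p j, d p j → p < k ∧ j < m) :
    ∃ L : Finset (ℕ × ℕ), (∀ c ∈ L, c.1 < k) ∧ topDots k L = d := by
  refine ⟨(Finset.range k ×ˢ Finset.range m).filter fun c => d (k - 1 - c.1) c.2,
    fun c hc => ?_, ?_⟩
  · exact Finset.mem_range.1 (Finset.mem_product.1 (Finset.mem_filter.1 hc).1).1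
  · funext p j
    rw [topDots, ← Bool.decide_coe (d p j), decide_eq_decide]
    refine ⟨fun ⟨hp, hc⟩ => ?_, fun hdot => ?_⟩
    · have hp' := Nat.sub_sub_self (Nat.le_sub_one_of_lt hp)
      simpa only [hp'] using (Finset.mem_filter.1 hc).2
    · obtain ⟨hp, hj⟩ := hd p j hdot
      have hp' := Nat.sub_sub_self (Nat.le_sub_one_of_lt hp)
      exact ⟨hp, Finset.mem_filter.2 ⟨Finset.mk_mem_product (Finset.mem_range.2 (by omega))
        (Finset.mem_range.2 hj), by simpa only [hp'] using hdot⟩⟩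

theorem IsPositroidPair.exists_isLeDiagramOf (hkn : k ≤ n) (h : IsPositroidPair k u w) :
    ∃ L, IsLeDiagramOf k u w L := by
  obtain ⟨hw, huw⟩ := h
  have hshape := hw.isShape hkn
  set T := dotPath n k (topRowLength k w) fun _ _ => false
  obtain ⟨S, hS, hV, hhigh, hlow⟩ := T.exists_valid (V := (invWindow u).take k)
    (Z := (invWindow u).drop k) (by simp [T, rows_dotPath hshape, length_invWindow, hkn])
    (by rw [List.take_append_drop, length_dotPath]; exact invWindow_perm u)
    (by rw [List.take_append_drop, ← hw.invWindow_eq hkn]; exact huw.prefixCountLE)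
  obtain ⟨d, hd, rfl⟩ := exists_dotPath_eq hshape hV hS
  obtain ⟨L, hLk, rfl⟩ := exists_topDots_eq (m := n - k) fun p j hdot =>
    ⟨(hd p j hdot).1, (hd p j hdot).2.trans_le (hshape.bound p (hd p j hdot).1)⟩
  refine ⟨L, (isLeDiagramOf_iff hkn hw).2 ⟨fun c hc => ?_, hV, ?_⟩⟩
  · have hlt := hLk c hc
    have hck := Nat.sub_sub_self (Nat.le_sub_one_of_lt hlt)
    have hdot : topDots k L (k - 1 - c.1) c.2 := decide_eq_true ⟨by omega, by rwa [hck]⟩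
    simpa only [topRowLength, hck] using (hd _ _ hdot).2
  · rw [lePath, hhigh, hlow, List.take_append_drop]

end LeDiagram

/-- The path `S` describes the pair `(u, w)`: its steps are the window of `w⁻¹` and its dots spell
the window of `u⁻¹`. -/
structure IsPathOf {n : ℕ} (S : DotPath) (k : ℕ) (u w : Perm (Fin n)) : Prop where
  valid : S.Valid
  length_eq : S.length = n
  rows_eq : S.rows = k
  invWindow_left : invWindow u = S.high ++ S.low
  invWindow_right : invWindow w = S.rowSteps ++ S.colSteps

theorem IsLeDiagramOf.isPathOf {k n : ℕ} {u w : Perm (Fin n)} {L : Finset (ℕ × ℕ)} (hkn : k ≤ n)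
    (hw : IsGrassmannian k w) (h : IsLeDiagramOf k u w L) : IsPathOf (lePath k w L) k u w := by
  obtain ⟨-, hV, hu⟩ := (isLeDiagramOf_iff hkn hw).1 h
  exact ⟨hV, length_dotPath .., rows_dotPath (hw.isShape hkn) _, hu.symm, hw.invWindow_eq hkn _⟩

/-- The function on `ℕ` with the values `f 0, …, f (n - 1)`, extended by zero. -/
def windowExtend {n : ℕ} (f : Fin n → ℕ) (i : ℕ) : ℕ := if h : i < n then f ⟨i, h⟩ else 0

lemma windowExtend_coe {n : ℕ} (f : Fin n → ℕ) (i : Fin n) : windowExtend f i = f i :=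
  dif_pos i.2

lemma injOn_boundedAffine {n : ℕ} (k : ℕ) (u w : Perm (Fin n)) :
    Set.InjOn (windowExtend (boundedAffine k u w)) (Set.Iio n) := by
  intro i hi j hj e
  rw [Set.mem_Iio] at hi hj
  simp only [windowExtend, dif_pos hi, dif_pos hj, boundedAffine] at e
  have hlt₁ := (u⁻¹ (w ⟨i, hi⟩)).2
  have hlt₂ := (u⁻¹ (w ⟨j, hj⟩)).2
  have huw : (u⁻¹ (w ⟨i, hi⟩) : ℕ) = u⁻¹ (w ⟨j, hj⟩) := by
    split_ifs at e <;> omega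
  simpa using w.injective (u⁻¹.injective (Fin.ext huw))

lemma map_boundedAffine_invWindow {n : ℕ} (k : ℕ) (u w : Perm (Fin n)) :
    (invWindow w).map (windowExtend (boundedAffine k u w)) =
      ((invWindow u).take k).map (· + n) ++ (invWindow u).drop k := by
  have hlen : n = min k n + (n - k) := by omega
  refine List.ext_getElem (by simpa [length_invWindow] using hlen) fun c hc _ => ?_
  rw [List.length_map, length_invWindow] at hc
  rw [List.getElem_map, getElem_invWindow, windowExtend_coe, boundedAffine, List.getElem_append]
  by_cases hck : c < k
  · simp [hck, hc, length_invWindow, getElem_invWindow]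
  · have hkn : min k n = k := by omega
    have hkc : k + (c - k) = c := by omega
    simp [hck, length_invWindow, getElem_invWindow, hkn, hkc]

lemma filter_range_eq_rowSteps (S : DotPath) {p : ℕ → Bool} (hrow : ∀ i ∈ S.rowSteps, p i)
    (hcol : ∀ i ∈ S.colSteps, ¬p i) : (List.range S.length).filter p = S.rowSteps := by
  have hperm := (S.rowSteps_append_colSteps_perm.filter p).symm
  rw [List.filter_append, List.filter_eq_self.2 hrow, List.filter_eq_nil_iff.2 hcol,
    List.append_nil] at hperm
  have hsorted : ((List.range S.length).filter p).Pairwise (· < ·) :=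
    List.pairwise_lt_range.filter p
  exact hperm.eq_of_pairwise (fun _ _ _ _ hab hba => absurd hba hab.not_gt) hsorted
    S.pairwise_rowSteps

lemma IsReducedWord.wordEval_eq_gaps {Γ : Type*} [Group Γ] {s : ℕ → Γ} {n : ℕ}
    {v : Perm (Fin n)} {a : List ℕ} {S : DotPath} (hs : IsBraidSequence n s) (hS : S.Valid)
    (hn : S.length = n) (hv : invWindow v = S.high ++ S.low) (h : IsReducedWord v a) :
    wordEval s a = wordEval s S.gaps := by
  subst hn
  have hΔ := h.ascentWord_mul hs
  rw [hv, ← DotPath.ascentWord_mul_gaps hS hs] at hΔ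
  exact mul_left_cancel hΔ

namespace IsPathOf

variable {k n : ℕ} {u w : Perm (Fin n)} {S : DotPath}

lemma map_boundedAffine (h : IsPathOf S k u w) :
    S.rowSteps.map (windowExtend (boundedAffine k u w)) = S.high.map (· + n) ∧
      S.colSteps.map (windowExtend (boundedAffine k u w)) = S.low := by
  have hlen : S.high.length = k := (DotPath.length_high h.valid).trans h.rows_eq
  have hmap := map_boundedAffine_invWindow k u w
  rw [h.invWindow_left, h.invWindow_right, ← hlen, List.take_left, List.drop_left,
    List.map_append, hlen] at hmap
  refine List.append_inj hmap ?_
  rw [List.length_map, List.length_map, DotPath.length_rowSteps, hlen, h.rows_eq]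

lemma hasArcs (h : IsPathOf S k u w) : S.HasArcs (windowExtend (boundedAffine k u w)) := by
  refine ⟨fun i hi => ?_, h.map_boundedAffine.2⟩
  have hmem := List.mem_map_of_mem (f := windowExtend (boundedAffine k u w)) hi
  rw [h.map_boundedAffine.1] at hmem
  obtain ⟨y, -, hy⟩ := List.mem_map.1 hmem
  rw [← hy, h.length_eq]
  exact Nat.le_add_left n y

lemma filter_map_boundedAffine (h : IsPathOf S k u w) :
    ((List.range n).map (windowExtend (boundedAffine k u w))).filter (n ≤ ·) =
      S.high.map (· + n) := by
  obtain ⟨hrow, hcol⟩ := h.map_boundedAffine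
  have hn := h.length_eq
  subst hn
  rw [List.filter_map, filter_range_eq_rowSteps S, hrow]
  · intro i hi
    simpa using h.hasArcs.1 i hi
  · intro i hi
    have hmem := List.mem_map_of_mem (f := windowExtend (boundedAffine k u w)) hi
    rw [hcol] at hmem
    simpa using DotPath.lt_of_mem_high_append_low h.valid (List.mem_append_right _ hmem)

theorem braid_eq (h : IsPathOf S k u w) : S.braid (sigma k) =
    jugglingBraid₁ k (boundedAffine k u w) * (halfTwist k)⁻¹ *
      jugglingBraid₂ k (boundedAffine k u w) := by
  have hs : IsBraidSequence S.rows (sigma k) := h.rows_eq ▸ isBraidSequence_sigma k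
  have hlow := DotPath.wordEval_arcs_low h.valid h.hasArcs
    (h.length_eq.symm ▸ injOn_boundedAffine k u w) hs
  have hhigh := arcs_high (injOn_boundedAffine k u w) h.filter_map_boundedAffine
  rw [h.length_eq] at hlow
  rw [DotPath.braid_eq h.valid hs, jugglingBraid₁, jugglingBraid₂,
    jugglingPart_eq k (windowExtend_coe _), jugglingPart_eq k (windowExtend_coe _), hlow, hhigh,
    halfTwist_eq, h.length_eq, h.rows_eq]

theorem fixedCount_eq (h : IsPathOf S k u w) :
    fixedCount (boundedAffine k u w) = S.emptyCols := by
  rw [← DotPath.count_fixed h.valid h.hasArcs, h.length_eq, ← card_filter_fin, fixedCount]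
  simp only [windowExtend_coe]

theorem markovReduces (h : IsPathOf S k u w) (hkn : k ≤ n) {a b : List ℕ}
    (ha : IsReducedWord w a) (hb : IsReducedWord u b) :
    MarkovReduces (richardsonBraid n a b) (fixedCount (boundedAffine k u w))
      (S.braid (sigma k)) := by
  have hR : richardsonBraid n a b = wordEval (sigma n) S.clear.gaps *
      (wordEval (sigma n) S.gaps)⁻¹ := by
    rw [← ha.wordEval_eq_gaps (isBraidSequence_sigma n) S.valid_clear
      (S.length_clear.trans h.length_eq)
      (by rw [S.high_clear, S.low_clear, h.invWindow_right]),
      ← hb.wordEval_eq_gaps (isBraidSequence_sigma n) h.valid h.length_eq h.invWindow_left]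
    rfl
  obtain ⟨m, rfl⟩ := Nat.exists_eq_add_of_le hkn
  have hred := MarkovReduces.remove_columns (α := richardsonBraid (k + m) a b) (s := 0) (q := 0)
    (z := 1) h.valid (by rw [h.rows_eq, Nat.zero_add]) (by rw [h.length_eq, Nat.zero_add])
    (by simp only [Nat.add_zero, List.map_id', map_one, one_mul, ← hR]; exact MarkovReduces.refl)
  rw [h.fixedCount_eq]
  simpa using hred

end IsPathOf

theorem theorem3p17 (k n : ℕ) (hkn : k ≤ n) (u w : Equiv.Perm (Fin n))
    (huw : IsPositroidPair k u w) :
    (∃ L : Finset (ℕ × ℕ), IsLeDiagramOf k u w L) ∧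
    ∀ L : Finset (ℕ × ℕ), IsLeDiagramOf k u w L →
      leBraid k n L =
        jugglingBraid₁ k (boundedAffine k u w) * (halfTwist k)⁻¹ *
          jugglingBraid₂ k (boundedAffine k u w) ∧
      IsConj (jugglingBraid k (boundedAffine k u w) * (halfTwist k)⁻¹) (leBraid k n L) ∧
      ∀ a b : List ℕ, IsReducedWord w a → IsReducedWord u b →
        MarkovReduces (richardsonBraid n a b) (fixedCount (boundedAffine k u w))
          (leBraid k n L) ∧
        MarkovReduces (richardsonBraid n a b) (fixedCount (boundedAffine k u w))
          (jugglingBraid k (boundedAffine k u w) * (halfTwist k)⁻¹) := by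
  refine ⟨huw.exists_isLeDiagramOf hkn, fun L hL => ?_⟩
  have hpath := hL.isPathOf hkn huw.1
  have hbraid := braid_lePath hkn huw.1 hL.1.1
  have hle := hbraid.symm.trans hpath.braid_eq
  have hconj : IsConj (leBraid k n L)
      (jugglingBraid k (boundedAffine k u w) * (halfTwist k)⁻¹) := by
    rw [hle, jugglingBraid_eq_mul, mul_assoc _ _ (halfTwist k)⁻¹]
    exact isConj_mul_comm _ _
  refine ⟨hle, hconj.symm, fun a b ha hb => ?_⟩
  have hred := hbraid ▸ hpath.markovReduces hkn ha hb
  exact ⟨hred, hred.conj hconj⟩
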